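/- **Proposition 3.2.** Let $n\ge 1$, $\mathbb R^n_+=\{x=(x',x_n)\in\mathbb R^n: x_n>0\}$, and consider complex-valued functions, identified when they agree almost everywhere. A locally integrable $F$ on $\mathbb R^n$ is in $\mathrm{BMO}(\mathbb R^n)$ if $$\|F\|_{\mathrm{BMO}}=\sup_Q\frac1{|Q|}\int_Q|F-F_Q|\,dx<\infty ,$$ where $Q$ runs over all cubes of $\mathbb R^n$ and $F_Q=\frac1{|Q|}\int_QF$. For a function $f$ on $\mathbb R^n_+$: * $f\in\mathrm{BMO}_r$ if $f=F|_{\mathbb R^n_+}$ for some $F\in\mathrm{BMO}(\mathbb R^n)$; $\|f\|_{\mathrm{BMO}_r}$ is the infimum of $\|F\|_{\mathrm{BMO}}$ over all such $F$; * $f\in\mathrm{BMO}_z$, $\mathrm{BMO}_e$, $\mathrm{BMO}_o$ if, respectively, the extension of $f$ by zero, the even extension $f_e(x',-x_n)=f(x',x_n)$, the odd extension $f_o(x',-x_n)=-f(x',x_n)$ is in $\mathrm{BMO}(\mathbb R^n)$; the norm is the $\mathrm{BMO}(\mathbb R^n)$ norm of that extension. Let $\Delta_{D_+}$ and $\Delta_{N_+}$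 be the (positive) Dirichlet and Neumann Laplacians on $\mathbb R^n_+$, i.e. the self-adjoint operators on $L^2(\mathbb R^n_+)$ associated with the form $(u,v)\mapsto\int_{\mathbb R^n_+}\nabla u\cdot\overline{\nabla v}\,dx$ with domain $W^{1,2}_0(\mathbb R^n_+)$ and $W^{1,2}(\mathbb R^n_+)$ respectively. Let $L$ be one of them. Let $\mathcal M$ be the set of $f\in L^1_{\mathrm{loc}}(\mathbb R^n_+)$ with $\int_{\mathbb R^n_+}|f(x)|^2(1+|x|^{n+d})^{-1}dx<\infty$ for some $d>0$; the semigroup $e^{-tL}$ acts on $\mathcal M$ through its heat kernel. Say that $f\in\mathcal M$ is in $\mathrm{BMO}_L$ if $$\|f\|_{\mathrm{BMO}_L}=\sup_{B(y,r)}\frac1{|B(y,r)|}\int_{B(y,r)}|f(x)-e^{-r^2L}f(x)|\,dx<\infty ,$$ where $B(y,r)=\{x\in\mathbb R^n_+:|x-y|<r\}$, $y\in\mathbb R^n_+$, $r>0$. Elements of $\mathrm{BMO}_L$ are taken modulo $\mathcal K_L=\{f\in\mathcal M: e^{-tL}f=f\ \text{for all } t>0\}$. Then, with constants depending only on $n$: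 (i) $\mathrm{BMO}_z=\mathrm{BMO}_o$ with equivalent norms, and this space coincides with $\mathrm{BMO}_{\Delta_{D_+}}$ modulo $\mathcal K_{\Delta_{D_+}}$, with equivalent norms. That is, $\mathrm{BMO}_{\Delta_{D_+}}=\mathrm{BMO}_z+\mathcal K_{\Delta_{D_+}}$; if $f=g+k$ with $g\in\mathrm{BMO}_z$ and $k\in\mathcal K_{\Delta_{D_+}}$, then $\|f\|_{\mathrm{BMO}_{\Delta_{D_+}}}$ and $\|g\|_{\mathrm{BMO}_z}$ are comparable; and $\mathrm{BMO}_z\cap\mathcal K_{\Delta_{D_+}}=\{0\}$. (ii) $\mathrm{BMO}_r=\mathrm{BMO}_e$ with equivalent norms, and this space, modulo constants, coincides with $\mathrm{BMO}_{\Delta_{N_+}}$ modulo $\mathcal K_{\Delta_{N_+}}$, with equivalent norms. That is, $\mathrm{BMO}_{\Delta_{N_+}}=\mathrm{BMO}_r+\mathcal K_{\Delta_{N_+}}$; if $f=g+k$ with $g\in\mathrm{BMO}_r$ and $k\in\mathcal K_{\Delta_{N_+}}$, then $\|f\|_{\mathrm{BMO}_{\Delta_{N_+}}}$ and $\|g\|_{\mathrm{BMO}_r}$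 are comparable; and $\mathrm{BMO}_r\cap\mathcal K_{\Delta_{N_+}}$ consists exactly of the constant functions. -/

import Mathlib

open MeasureTheory Filter Topology
open scoped ENNReal NNReal ContDiff ComplexConjugate

namespace HalfSpaceBMO

noncomputable section

/-! ### The half space, reflections and extensions

A function on an open set `Ω` is represented by a function on the whole space whose values
outside `Ω` are never used. -/

/-- The upper half space in dimension `n + 1`: the last coordinate is positive. -/
def halfSpace (n : ℕ) : Set (EuclideanSpace ℝ (Fin (n + 1))) :=
  {x | 0 < x (Fin.last n)}

/-- The reflection `(x', x_last) ↦ (x', -x_last)`. -/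
def reflect {n : ℕ} (x : EuclideanSpace ℝ (Fin (n + 1))) : EuclideanSpace ℝ (Fin (n + 1)) :=
  WithLp.toLp 2 (Function.update x.ofLp (Fin.last n) (-(x (Fin.last n))))

/-- Extension by zero of a function on the half space. -/
def zeroExt {n : ℕ} (f : EuclideanSpace ℝ (Fin (n + 1)) → ℂ) :
    EuclideanSpace ℝ (Fin (n + 1)) → ℂ :=
  fun x => if 0 < x (Fin.last n) then f x else 0

/-- Even extension of a function on the half space (value `0` on the boundary, a null set). -/
def evenExt {n : ℕ} (f : EuclideanSpace ℝ (Fin (n + 1)) → ℂ) :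
    EuclideanSpace ℝ (Fin (n + 1)) → ℂ :=
  fun x => if 0 < x (Fin.last n) then f x
    else if x (Fin.last n) < 0 then f (reflect x) else 0

/-- Odd extension of a function on the half space (value `0` on the boundary, a null set). -/
def oddExt {n : ℕ} (f : EuclideanSpace ℝ (Fin (n + 1)) → ℂ) :
    EuclideanSpace ℝ (Fin (n + 1)) → ℂ :=
  fun x => if 0 < x (Fin.last n) then f x
    else if x (Fin.last n) < 0 then -f (reflect x) else 0

/-! ### Classical BMO -/

/-- The (closed, axis-parallel) cube with centre `c` and side length `l`. -/
def cube {d : ℕ} (c : EuclideanSpace ℝ (Fin d)) (l : ℝ) : Set (EuclideanSpace ℝ (Fin d)) :=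
  {x | ∀ i, |x i - c i| ≤ l / 2}

/-- The mean oscillation norm: supremum over all cubes `Q` of the mean of `|f - f_Q|` on `Q`. -/
def bmoNorm {d : ℕ} (f : EuclideanSpace ℝ (Fin d) → ℂ) : ℝ≥0∞ :=
  ⨆ (c : EuclideanSpace ℝ (Fin d)) (l : ℝ) (_ : 0 < l),
    (volume (cube c l))⁻¹ * ∫⁻ x in cube c l, ‖f x - ⨍ y in cube c l, f y‖ₑ

/-- Membership in the classical space `BMO` of the whole space. -/
def MemBMO {d : ℕ} (f : EuclideanSpace ℝ (Fin d) → ℂ) : Prop :=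
  LocallyIntegrable f volume ∧ bmoNorm f < ⊤

/-! ### Classical BMO spaces on the half space -/

/-- `BMO_r`: restrictions of `BMO` functions. -/
def MemBMOr {n : ℕ} (f : EuclideanSpace ℝ (Fin (n + 1)) → ℂ) : Prop :=
  ∃ F, MemBMO F ∧ Set.EqOn F f (halfSpace n)

/-- The `BMO_r` norm: infimum of the norms of all `BMO` extensions. -/
def bmoRNorm {n : ℕ} (f : EuclideanSpace ℝ (Fin (n + 1)) → ℂ) : ℝ≥0∞ :=
  ⨅ (F : EuclideanSpace ℝ (Fin (n + 1)) → ℂ)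
    (_ : MemBMO F ∧ Set.EqOn F f (halfSpace n)), bmoNorm F

/-- `BMO_z`: the extension by zero is in `BMO`. -/
def MemBMOz {n : ℕ} (f : EuclideanSpace ℝ (Fin (n + 1)) → ℂ) : Prop := MemBMO (zeroExt f)

/-- The `BMO_z` norm. -/
def bmoZNorm {n : ℕ} (f : EuclideanSpace ℝ (Fin (n + 1)) → ℂ) : ℝ≥0∞ := bmoNorm (zeroExt f)

/-- `BMO_e`: the even extension is in `BMO`. -/
def MemBMOe {n : ℕ} (f : EuclideanSpace ℝ (Fin (n + 1)) → ℂ) : Prop := MemBMO (evenExt f)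

/-- The `BMO_e` norm. -/
def bmoENorm {n : ℕ} (f : EuclideanSpace ℝ (Fin (n + 1)) → ℂ) : ℝ≥0∞ := bmoNorm (evenExt f)

/-- `BMO_o`: the odd extension is in `BMO`. -/
def MemBMOo {n : ℕ} (f : EuclideanSpace ℝ (Fin (n + 1)) → ℂ) : Prop := MemBMO (oddExt f)

/-- The `BMO_o` norm. -/
def bmoONorm {n : ℕ} (f : EuclideanSpace ℝ (Fin (n + 1)) → ℂ) : ℝ≥0∞ := bmoNorm (oddExt f)

/-! ### Sobolev spaces, Dirichlet and Neumann Laplacians -/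

/-- Smooth complex functions with compact support inside `Ω`. -/
def IsTest {d : ℕ} (Ω : Set (EuclideanSpace ℝ (Fin d))) (φ : EuclideanSpace ℝ (Fin d) → ℂ) :
    Prop :=
  ContDiff ℝ ∞ φ ∧ HasCompactSupport φ ∧ tsupport φ ⊆ Ω

/-- The classical `i`-th partial derivative. -/
def partialDeriv {d : ℕ} (i : Fin d) (φ : EuclideanSpace ℝ (Fin d) → ℂ) :
    EuclideanSpace ℝ (Fin d) → ℂ :=
  fun x => fderiv ℝ φ x (EuclideanSpace.single i 1)

/-- `u ∈ W^{1,2}(Ω)` with weak gradient `G`. -/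
def W12 {d : ℕ} (Ω : Set (EuclideanSpace ℝ (Fin d))) (u : EuclideanSpace ℝ (Fin d) → ℂ)
    (G : Fin d → EuclideanSpace ℝ (Fin d) → ℂ) : Prop :=
  MemLp u 2 (volume.restrict Ω) ∧ (∀ i, MemLp (G i) 2 (volume.restrict Ω)) ∧
    ∀ φ, IsTest Ω φ → ∀ i, ∫ x in Ω, u x * partialDeriv i φ x = -∫ x in Ω, G i x * φ x

/-- `u ∈ W_0^{1,2}(Ω)`, the closure of the test functions in `W^{1,2}(Ω)`, with gradient `G`. -/
def W120 {d : ℕ} (Ω : Set (EuclideanSpace ℝ (Fin d))) (u : EuclideanSpace ℝ (Fin d) → ℂ)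
    (G : Fin d → EuclideanSpace ℝ (Fin d) → ℂ) : Prop :=
  MemLp u 2 (volume.restrict Ω) ∧ (∀ i, MemLp (G i) 2 (volume.restrict Ω)) ∧
    ∃ φ : ℕ → EuclideanSpace ℝ (Fin d) → ℂ, (∀ k, IsTest Ω (φ k)) ∧
      Tendsto (fun k => eLpNorm (φ k - u) 2 (volume.restrict Ω)) atTop (𝓝 0) ∧
      ∀ i, Tendsto (fun k => eLpNorm (partialDeriv i (φ k) - G i) 2 (volume.restrict Ω))
        atTop (𝓝 0)

/-- The graph `L u = g` of the self-adjoint operator on `L²(Ω)` associated with the form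
`(u, v) ↦ ∫_Ω ∇u · conj ∇v` with form domain `V` (`V u G` says that `u` belongs to the form domain
and has gradient `G`). For `V = W120 Ω` this is the (positive) Dirichlet Laplacian on `Ω`, and for
`V = W12 Ω` the (positive) Neumann Laplacian. -/
def LaplaceGraph {d : ℕ} (Ω : Set (EuclideanSpace ℝ (Fin d)))
    (V : (EuclideanSpace ℝ (Fin d) → ℂ) → (Fin d → EuclideanSpace ℝ (Fin d) → ℂ) → Prop)
    (u g : EuclideanSpace ℝ (Fin d) → ℂ) : Prop :=
  MemLp g 2 (volume.restrict Ω) ∧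
    ∃ G, V u G ∧ ∀ v H, V v H →
      ∑ i, ∫ x in Ω, G i x * conj (H i x) = ∫ x in Ω, g x * conj (v x)

/-! ### Heat semigroups and heat kernels -/

/-- `u` is the orbit `u t = exp (-t L) f`, `t > 0`, of the semigroup generated by `L` (the operator
with graph `LaplaceGraph Ω V`), described as the `L²(Ω)`-valued solution of `u' = -L u`,
`u 0 = f`. -/
def IsHeatOrbit {d : ℕ} (Ω : Set (EuclideanSpace ℝ (Fin d)))
    (V : (EuclideanSpace ℝ (Fin d) → ℂ) → (Fin d → EuclideanSpace ℝ (Fin d) → ℂ) → Prop)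
    (f : EuclideanSpace ℝ (Fin d) → ℂ) (u : ℝ → EuclideanSpace ℝ (Fin d) → ℂ) : Prop :=
  (∀ t, 0 < t → ∃ g, LaplaceGraph Ω V (u t) g ∧
    Tendsto (fun h : ℝ =>
      eLpNorm (fun x => (h : ℂ)⁻¹ * (u (t + h) x - u t x) + g x) 2 (volume.restrict Ω))
      (𝓝[≠] 0) (𝓝 0)) ∧
  Tendsto (fun t => eLpNorm (u t - f) 2 (volume.restrict Ω)) (𝓝[>] 0) (𝓝 0)

/-- The integral operator on `Ω` with kernel `p t`. -/
def kernelOp {d : ℕ} (Ω : Set (EuclideanSpace ℝ (Fin d)))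
    (p : ℝ → EuclideanSpace ℝ (Fin d) → EuclideanSpace ℝ (Fin d) → ℝ) (t : ℝ)
    (f : EuclideanSpace ℝ (Fin d) → ℂ) : EuclideanSpace ℝ (Fin d) → ℂ :=
  fun x => ∫ y in Ω, (p t x y : ℂ) * f y

/-- `p` is a heat kernel of `L`: it is measurable, satisfies a Gaussian upper bound, and for `t > 0`
the integral operator with kernel `p t` is `exp (-t L)`. Since the Gaussian bound makes the integral
operators bounded on `L²(Ω)`, the last point is required on the dense subspace of test functions
only; it determines `p t` almost everywhere on `Ω × Ω`. -/
def IsHeatKernel {d : ℕ} (Ω : Set (EuclideanSpace ℝ (Fin d)))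
    (V : (EuclideanSpace ℝ (Fin d) → ℂ) → (Fin d → EuclideanSpace ℝ (Fin d) → ℂ) → Prop)
    (p : ℝ → EuclideanSpace ℝ (Fin d) → EuclideanSpace ℝ (Fin d) → ℝ) : Prop :=
  (∀ t, 0 < t → Measurable (Function.uncurry (p t))) ∧
  (∃ C c : ℝ, 0 < C ∧ 0 < c ∧ ∀ t, 0 < t → ∀ x ∈ Ω, ∀ y ∈ Ω,
    |p t x y| ≤ C / t ^ ((d : ℝ) / 2) * Real.exp (-c * ‖x - y‖ ^ 2 / t)) ∧
  ∀ f, IsTest Ω f → IsHeatOrbit Ω V f (fun t => kernelOp Ω p t f)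

/-- The heat kernel of `L`. -/
def heatKernel {d : ℕ} (Ω : Set (EuclideanSpace ℝ (Fin d)))
    (V : (EuclideanSpace ℝ (Fin d) → ℂ) → (Fin d → EuclideanSpace ℝ (Fin d) → ℂ) → Prop) :
    ℝ → EuclideanSpace ℝ (Fin d) → EuclideanSpace ℝ (Fin d) → ℝ :=
  Classical.epsilon (IsHeatKernel Ω V)

/-! ### BMO spaces associated with operators -/

/-- The class `M(Ω)` of locally integrable functions with `∫_Ω |f|² / (1 + |x|^(d + δ)) < ∞` for
some `δ > 0`, where `d` is the dimension. -/
def MemM {d : ℕ} (Ω : Set (EuclideanSpace ℝ (Fin d))) (f : EuclideanSpace ℝ (Fin d) → ℂ) : Prop :=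
  LocallyIntegrableOn f Ω volume ∧
    ∃ δ : ℝ, 0 < δ ∧
      IntegrableOn (fun x => ‖f x‖ ^ 2 / (1 + ‖x‖ ^ ((d : ℝ) + δ))) Ω volume

/-- The extension of `exp (-t L)` to `M(Ω)`, through the heat kernel. -/
def heatOp {d : ℕ} (Ω : Set (EuclideanSpace ℝ (Fin d)))
    (V : (EuclideanSpace ℝ (Fin d) → ℂ) → (Fin d → EuclideanSpace ℝ (Fin d) → ℂ) → Prop) (t : ℝ)
    (f : EuclideanSpace ℝ (Fin d) → ℂ) : EuclideanSpace ℝ (Fin d) → ℂ :=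
  kernelOp Ω (heatKernel Ω V) t f

/-- The seminorm of `BMO_L(Ω)`: supremum over all balls `B` of the metric space `Ω`, with centre in
`Ω` and radius `r > 0`, of the mean of `|f - exp (-r² L) f|` on `B`. -/
def bmoLNorm {d : ℕ} (Ω : Set (EuclideanSpace ℝ (Fin d)))
    (V : (EuclideanSpace ℝ (Fin d) → ℂ) → (Fin d → EuclideanSpace ℝ (Fin d) → ℂ) → Prop)
    (f : EuclideanSpace ℝ (Fin d) → ℂ) : ℝ≥0∞ :=
  ⨆ (y : EuclideanSpace ℝ (Fin d)) (_ : y ∈ Ω) (r : ℝ) (_ : 0 < r),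
    (volume (Metric.ball y r ∩ Ω))⁻¹ *
      ∫⁻ x in Metric.ball y r ∩ Ω, ‖f x - heatOp Ω V (r ^ 2) f x‖ₑ

/-- `f` is (a representative of an element of) `BMO_L(Ω)`. -/
def MemBMOL {d : ℕ} (Ω : Set (EuclideanSpace ℝ (Fin d)))
    (V : (EuclideanSpace ℝ (Fin d) → ℂ) → (Fin d → EuclideanSpace ℝ (Fin d) → ℂ) → Prop)
    (f : EuclideanSpace ℝ (Fin d) → ℂ) : Prop :=
  MemM Ω f ∧ bmoLNorm Ω V f < ⊤

/-- The kernel space `K_L`: functions in `M(Ω)` with `exp (-t L) f = f` for all `t > 0`. The space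
`BMO_L(Ω)` is taken modulo `K_L`. -/
def MemK {d : ℕ} (Ω : Set (EuclideanSpace ℝ (Fin d)))
    (V : (EuclideanSpace ℝ (Fin d) → ℂ) → (Fin d → EuclideanSpace ℝ (Fin d) → ℂ) → Prop)
    (f : EuclideanSpace ℝ (Fin d) → ℂ) : Prop :=
  MemM Ω f ∧ ∀ t, 0 < t → heatOp Ω V t f =ᵐ[volume.restrict Ω] f

end

end HalfSpaceBMO

open HalfSpaceBMO

/-! The half space is removed by reflection. By the method of images the kernel `reflKernel σ`, the
Gaussian plus `σ` times its mirror image, is a heat kernel of the Dirichlet Laplacian for `σ = -1`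
and of the Neumann Laplacian for `σ = 1`. Since `heatKernel` is an arbitrary choice among heat
kernels, it also has to be shown that any two agree almost everywhere (`IsHeatKernel.ae_eq`, by an
energy estimate). Hence `exp (-t L) f` is the restriction of the free heat flow of the odd or even
extension `symExt σ f`. The two statements become one statement about functions of fixed parity on
the whole space.

On the whole space three facts are needed. A function of bounded mean oscillation is close in mean
to its heat flow at time `r²` on every ball of radius `r` (`exists_lintegral_sub_flow_le`).
Conversely, if `F` is that close to its flow at all scales, then `F` is the sum of a caloric
function `H`, fixed by the flow at all times, and a function of bounded mean oscillation
(`exists_caloric_part`). Finally, a caloric function of bounded mean oscillation is constant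
(`HasOsc.exists_ae_eq_const`), which makes the decomposition unique up to constants and gives the
equivalence of norms.

For the converse, the increment from time `s` to a time at most `2s` is the flow at time `s` of a
function `F - flow (r²) F` with `r² ≤ s`. It is bounded by a constant `K` and has Lipschitz constant
of order `K / √s`. The Lipschitz constants sum along dyadic times although the bounds do not, so the
flow at time `k` minus its value at the origin converges to some `H`. The flow changes `H` by a
constant depending additively and boundedly on time, so the constant vanishes. At time comparable to
`ρ²` the flow of `F` differs from `H` on a ball of radius `ρ` by a constant up to `O(K)`, while `F`
is close in mean to that flow.

The growth class requires a weighted square integral, which for functions of bounded mean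
oscillation comes from a square-mean form of the John–Nirenberg inequality. The comparisons of zero
with odd and of restricted with even extensions are tested on balls that avoid the boundary or are
centred on it (`hasOsc_of_cases`), where reflection symmetry can be used. -/

namespace HalfSpaceBMO
noncomputable section

set_option linter.unusedSectionVars false

/-! ### Pointwise estimates for the Gaussian kernel and its polynomial majorant -/

section Kernel

variable {E : Type*} [NormedAddCommGroup E] [InnerProductSpace ℝ E]

/-- The Gauss–Weierstrass kernel. -/
def heat (t : ℝ) (z : E) : ℝ :=
  (4 * Real.pi * t) ^ (-((Module.finrank ℝ E : ℝ) / 2)) * Real.exp (-(1 / (4 * t)) * ‖z‖ ^ 2)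

/-- A Poisson-type majorant at scale `R`. -/
def poly (R : ℝ) (z : E) : ℝ :=
  (R ^ Module.finrank ℝ E)⁻¹ * ((1 + ‖z‖ / R) ^ (Module.finrank ℝ E + 1))⁻¹

lemma heat_pos {t : ℝ} (ht : 0 < t) (z : E) : 0 < heat t z := by
  unfold heat; positivity

lemma continuous_heat (t : ℝ) : Continuous (heat t : E → ℝ) := by
  unfold heat; fun_prop

lemma poly_pos {R : ℝ} (hR : 0 < R) (z : E) : 0 < poly R z := by
  unfold poly; positivity

lemma continuous_poly {R : ℝ} (hR : 0 < R) : Continuous (poly R : E → ℝ) := by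
  unfold poly
  refine continuous_const.mul (Continuous.inv₀ (by fun_prop) fun z => by positivity)

/-- Moving the argument by at most `R` at most doubles `1 + ‖z‖ / R`. This allows the base point of
an integral against `poly R` to be moved inside a ball of radius `R`. -/
lemma poly_le_of_norm_sub_le {R : ℝ} (hR : 0 < R) {a b : E} (h : ‖a - b‖ ≤ R) :
    poly R a ≤ 2 ^ (Module.finrank ℝ E + 1) * poly R b := by
  unfold poly
  have h1 : 1 + ‖b‖ / R ≤ 2 * (1 + ‖a‖ / R) := by
    have h2 : ‖b‖ ≤ ‖a‖ + R := by
      have := norm_sub_norm_le b a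
      rw [norm_sub_rev] at this
      linarith
    have : ‖b‖ / R ≤ ‖a‖ / R + 1 := by
      rw [div_add_one hR.ne', div_le_div_iff_of_pos_right hR]; exact h2
    have : 0 ≤ ‖a‖ / R := by positivity
    linarith
  have h3 : (1 + ‖b‖ / R) ^ (Module.finrank ℝ E + 1)
      ≤ 2 ^ (Module.finrank ℝ E + 1) * (1 + ‖a‖ / R) ^ (Module.finrank ℝ E + 1) := by
    rw [← mul_pow]; gcongr
  have h4 : ((1 + ‖a‖ / R) ^ (Module.finrank ℝ E + 1))⁻¹ ≤
      2 ^ (Module.finrank ℝ E + 1) * ((1 + ‖b‖ / R) ^ (Module.finrank ℝ E + 1))⁻¹ := by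
    rw [← div_eq_mul_inv, le_div_iff₀ (by positivity), inv_mul_le_iff₀ (by positivity)]
    linarith
  calc _ ≤ (R ^ Module.finrank ℝ E)⁻¹ * (2 ^ (Module.finrank ℝ E + 1) *
        ((1 + ‖b‖ / R) ^ (Module.finrank ℝ E + 1))⁻¹) := by gcongr
    _ = _ := by ring

/-- Gaussian decay beats polynomial growth. -/
lemma exp_neg_sq_le (m : ℕ) {a : ℝ} (ha : 0 < a) :
    ∃ C : ℝ, 0 < C ∧ ∀ r : ℝ, 0 ≤ r → Real.exp (-a * r ^ 2) ≤ C * ((1 + r) ^ m)⁻¹ := by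
  -- After `(1 + r) ^ m ≤ exp (m r)`, the constant is the maximum over `r` of `exp (m r - a r²)`.
  refine ⟨Real.exp ((m : ℝ) ^ 2 / (4 * a)), Real.exp_pos _, fun r hr => ?_⟩
  rw [← div_eq_mul_inv, le_div_iff₀ (by positivity)]
  have h1 : (1 + r) ^ m ≤ Real.exp (m * r) := by
    rw [Real.exp_nat_mul]
    gcongr
    linarith [Real.add_one_le_exp r]
  calc Real.exp (-a * r ^ 2) * (1 + r) ^ m ≤ Real.exp (-a * r ^ 2) * Real.exp (m * r) := by gcongr
    _ = Real.exp (-a * r ^ 2 + m * r) := by rw [Real.exp_add]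
    _ ≤ _ := by
      apply Real.exp_le_exp.2
      rw [le_div_iff₀ (by positivity)]
      nlinarith [sq_nonneg (2 * a * r - m)]

lemma heat_le_decay (m : ℕ) {t : ℝ} (ht : 0 < t) :
    ∃ C : ℝ, 0 < C ∧ ∀ z : E, heat t z ≤ C * ((1 + ‖z‖) ^ m)⁻¹ := by
  obtain ⟨C, hC, h⟩ := exp_neg_sq_le m (a := 1 / (4 * t)) (by positivity)
  refine ⟨(4 * Real.pi * t) ^ (-((Module.finrank ℝ E : ℝ) / 2)) * C, by positivity, fun z => ?_⟩
  have := h ‖z‖ (norm_nonneg z)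
  calc heat t z ≤ (4 * Real.pi * t) ^ (-((Module.finrank ℝ E : ℝ) / 2)) *
        (C * ((1 + ‖z‖) ^ m)⁻¹) := by unfold heat; gcongr
    _ = _ := by ring

/-- Scaling of the Gauss–Weierstrass kernel. -/
lemma heat_sq {R : ℝ} (hR : 0 < R) (z : E) :
    heat (R ^ 2) z = (R ^ Module.finrank ℝ E)⁻¹ * heat 1 (R⁻¹ • z) := by
  unfold heat
  have h1 : (4 * Real.pi * R ^ 2) ^ (-((Module.finrank ℝ E : ℝ) / 2)) =
      (R ^ Module.finrank ℝ E)⁻¹ * (4 * Real.pi * 1) ^ (-((Module.finrank ℝ E : ℝ) / 2)) := by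
    rw [mul_one, Real.mul_rpow (by positivity) (by positivity), mul_comm]
    congr 1
    rw [← Real.rpow_natCast R 2, ← Real.rpow_mul hR.le, ← Real.rpow_natCast,
      ← Real.rpow_neg hR.le]
    congr 1
    push_cast; ring
  rw [h1, norm_smul, Real.norm_eq_abs, abs_of_pos (inv_pos.2 hR), mul_assoc]
  congr 3
  field_simp

lemma poly_eq {R : ℝ} (hR : 0 < R) (z : E) :
    poly R z = (R ^ Module.finrank ℝ E)⁻¹ * poly 1 (R⁻¹ • z) := by
  unfold poly
  rw [norm_smul, Real.norm_eq_abs, abs_of_pos (inv_pos.2 hR)]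
  simp [div_eq_inv_mul]

/-- Mean value inequality for `exp`. The exponent is weakened from `1/4` to `1/8` so that a single
Gaussian in `a` dominates both endpoints: `a² ≤ 2 b² + 2 (a - b)²` and `|a - b| ≤ 1`. -/
lemma abs_exp_neg_sub_le {a b : ℝ} (ha : 0 ≤ a) (hb : 0 ≤ b) (h : |a - b| ≤ 1) :
    |Real.exp (-(1 / 4) * a ^ 2) - Real.exp (-(1 / 4) * b ^ 2)| ≤
      |a - b| * (2 * Real.exp (1 / 4) * ((1 + a) * Real.exp (-(1 / 8) * a ^ 2))) := by
  obtain ⟨h1, h2⟩ := abs_le.1 h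
  have mv : ∀ u v w : ℝ, u ≤ w → v ≤ w → |Real.exp u - Real.exp v| ≤ |u - v| * Real.exp w := by
    intro u v w hu hv
    wlog huv : v ≤ u generalizing u v
    · rw [abs_sub_comm, abs_sub_comm u]; exact this v u hv hu (le_of_not_ge huv)
    rw [abs_of_nonneg (by simpa using huv), abs_of_nonneg (by simpa using huv)]
    have h3 : 1 - (u - v) ≤ Real.exp (v - u) := by linarith [Real.add_one_le_exp (v - u)]
    have h4 : Real.exp v = Real.exp u * Real.exp (v - u) := by rw [← Real.exp_add]; ring_nf
    have h5 : Real.exp u ≤ Real.exp w := Real.exp_le_exp.2 hu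
    calc _ ≤ Real.exp u * (u - v) := by rw [h4]; nlinarith [Real.exp_pos u]
      _ ≤ _ := by rw [mul_comm]; gcongr
  have h6 := mv (-(1 / 4) * a ^ 2) (-(1 / 4) * b ^ 2) (1 / 4 + -(1 / 8) * a ^ 2)
    (by nlinarith [sq_nonneg a]) (by nlinarith [sq_nonneg (2 * b - a), sq_nonneg (a - b)])
  have h7 : |-(1 / 4) * a ^ 2 - -(1 / 4) * b ^ 2| ≤ |a - b| * (2 * (1 + a)) := by
    have : -(1 / 4) * a ^ 2 - -(1 / 4) * b ^ 2 = -((a - b) * ((a + b) / 4)) := by ring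
    rw [this, abs_neg, abs_mul]
    gcongr
    rw [abs_of_nonneg (by positivity)]
    linarith
  calc _ ≤ _ := h6
    _ ≤ (|a - b| * (2 * (1 + a))) * Real.exp (1 / 4 + -(1 / 8) * a ^ 2) := by gcongr
    _ = _ := by rw [Real.exp_add]; ring

variable (E) in
/-- The heat kernel at time `R²` and its difference quotients are dominated at scale `R`. -/
lemma exists_heat_le_poly : ∃ C : ℝ, 0 < C ∧
    (∀ R : ℝ, 0 < R → ∀ z : E, heat (R ^ 2) z ≤ C * poly R z) ∧
    (∀ R : ℝ, 0 < R → ∀ a b : E, ‖a - b‖ ≤ R →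
      |heat (R ^ 2) a - heat (R ^ 2) b| ≤ C * (‖a - b‖ / R) * poly R a) := by
  obtain ⟨C₁, hC₁, h₁⟩ := heat_le_decay (E := E) (Module.finrank ℝ E + 1) one_pos
  -- One power more than in `poly`, to absorb the factor `1 + ‖a‖` produced by differentiating the
  -- Gaussian.
  obtain ⟨C₂, hC₂, h₂⟩ := exp_neg_sq_le (Module.finrank ℝ E + 1 + 1) (a := 1 / 8) (by positivity)
  set c : ℝ := (4 * Real.pi * 1) ^ (-((Module.finrank ℝ E : ℝ) / 2)) with hc
  have hcpos : 0 < c := by positivity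
  -- Both estimates are proved at scale one and transported to scale `R` by `heat_sq` and `poly_eq`.
  have base1 : ∀ z : E, heat 1 z ≤ C₁ * poly 1 z := by
    intro z; simpa [poly] using h₁ z
  have base2 : ∀ a b : E, ‖a - b‖ ≤ 1 →
      |heat 1 a - heat 1 b| ≤ (c * (2 * Real.exp (1 / 4) * C₂)) * ‖a - b‖ * poly 1 a := by
    intro a b hab
    have h3 := abs_exp_neg_sub_le (norm_nonneg a) (norm_nonneg b)
      ((abs_norm_sub_norm_le a b).trans hab)
    have h4 : (1 + ‖a‖) * Real.exp (-(1 / 8) * ‖a‖ ^ 2) ≤ C₂ * poly 1 a := by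
      have := h₂ ‖a‖ (norm_nonneg _)
      calc _ ≤ (1 + ‖a‖) * (C₂ * ((1 + ‖a‖) ^ (Module.finrank ℝ E + 1 + 1))⁻¹) := by gcongr
        _ = _ := by
          unfold poly
          have : (1 + ‖a‖) ≠ 0 := by positivity
          simp only [one_pow, inv_one, one_mul, div_one]
          field_simp
          ring
    have h5 : heat 1 a - heat 1 b =
        c * (Real.exp (-(1 / 4) * ‖a‖ ^ 2) - Real.exp (-(1 / 4) * ‖b‖ ^ 2)) := by
      simp only [heat, hc, mul_one]; ring
    rw [h5, abs_mul, abs_of_pos hcpos]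
    calc _ ≤ c * (|‖a‖ - ‖b‖| * (2 * Real.exp (1 / 4) *
          ((1 + ‖a‖) * Real.exp (-(1 / 8) * ‖a‖ ^ 2)))) := by gcongr
      _ ≤ c * (‖a - b‖ * (2 * Real.exp (1 / 4) * (C₂ * poly 1 a))) := by
          gcongr
          exact abs_norm_sub_norm_le a b
      _ = _ := by ring
  refine ⟨max C₁ (c * (2 * Real.exp (1 / 4) * C₂)), lt_max_of_lt_left hC₁, ?_, ?_⟩
  · intro R hR z
    rw [heat_sq hR, poly_eq hR]
    have := base1 (R⁻¹ • z)
    have hp := poly_pos one_pos (R⁻¹ • z)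
    calc _ ≤ (R ^ Module.finrank ℝ E)⁻¹ * (C₁ * poly 1 (R⁻¹ • z)) := by gcongr
      _ ≤ (R ^ Module.finrank ℝ E)⁻¹ *
          (max C₁ (c * (2 * Real.exp (1 / 4) * C₂)) * poly 1 (R⁻¹ • z)) := by
        gcongr; exact le_max_left _ _
      _ = _ := by ring
  · intro R hR a b hab
    rw [heat_sq hR, heat_sq hR, poly_eq hR, ← mul_sub, abs_mul, abs_of_pos (by positivity)]
    have hn : ‖R⁻¹ • a - R⁻¹ • b‖ = ‖a - b‖ / R := by
      rw [← smul_sub, norm_smul, Real.norm_eq_abs, abs_of_pos (inv_pos.2 hR), div_eq_inv_mul]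
    have := base2 (R⁻¹ • a) (R⁻¹ • b) (by rw [hn]; exact (div_le_one hR).2 hab)
    rw [hn] at this
    have hp := poly_pos one_pos (R⁻¹ • a)
    calc _ ≤ (R ^ Module.finrank ℝ E)⁻¹ *
          ((c * (2 * Real.exp (1 / 4) * C₂)) * (‖a - b‖ / R) * poly 1 (R⁻¹ • a)) := by gcongr
      _ ≤ (R ^ Module.finrank ℝ E)⁻¹ * (max C₁ (c * (2 * Real.exp (1 / 4) * C₂)) *
          (‖a - b‖ / R) * poly 1 (R⁻¹ • a)) := by
        gcongr; exact le_max_right _ _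
      _ = _ := by ring

end Kernel

/-! ### Gaussian integrals and the Chapman–Kolmogorov identity -/

section KernelIntegrals

variable {E : Type*} [NormedAddCommGroup E] [InnerProductSpace ℝ E] [FiniteDimensional ℝ E]
  [MeasurableSpace E] [BorelSpace E]

/-- The value of the Gaussian integral is known and nonzero, whereas the Bochner integral of a
non-integrable function is zero by convention. -/
lemma integrable_exp_neg_mul_sq_norm {b : ℝ} (hb : 0 < b) :
    Integrable (fun z : E => Real.exp (-b * ‖z‖ ^ 2)) := by
  have h := GaussianFourier.integral_rexp_neg_mul_sq_norm (V := E) hb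
  by_contra h'
  rw [integral_undef h'] at h
  exact (by positivity : (Real.pi / b) ^ ((Module.finrank ℝ E : ℝ) / 2) ≠ 0) h.symm

lemma integrable_heat {t : ℝ} (ht : 0 < t) : Integrable (heat t : E → ℝ) :=
  (integrable_exp_neg_mul_sq_norm (by positivity)).const_mul _

lemma integral_heat {t : ℝ} (ht : 0 < t) : ∫ z : E, heat t z = 1 := by
  unfold heat
  rw [integral_const_mul, GaussianFourier.integral_rexp_neg_mul_sq_norm (by positivity),
    Real.rpow_neg (by positivity), show Real.pi / (1 / (4 * t)) = 4 * Real.pi * t by field_simp]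
  exact inv_mul_cancel₀ (by positivity)

/-- The Chapman–Kolmogorov identity. -/
lemma integral_heat_mul_heat {s t : ℝ} (hs : 0 < s) (ht : 0 < t) (x y : E) :
    ∫ z, heat s (x - z) * heat t (z - y) = heat (s + t) (x - y) := by
  -- Completing the square: the product of the two Gaussians is a Gaussian in `z` centred at the
  -- weighted mean `a`, times a factor depending only on `x - y`.
  set a : E := (s + t)⁻¹ • (t • x + s • y) with ha
  set b : ℝ := (s + t) / (4 * s * t) with hb
  have hst : s + t ≠ 0 := by positivity
  have key : ∀ z, -(1 / (4 * s)) * ‖x - z‖ ^ 2 + -(1 / (4 * t)) * ‖z - y‖ ^ 2 =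
      -(1 / (4 * (s + t))) * ‖x - y‖ ^ 2 + -b * ‖z - a‖ ^ 2 := by
    intro z
    have e1 : ‖x - z‖ ^ 2 = ‖(x - y) - (z - y)‖ ^ 2 := by congr 2; abel
    have e2 : z - a = (z - y) - (t / (s + t)) • (x - y) := by
      rw [ha]
      have : y = (s + t)⁻¹ • (s + t) • y := by rw [smul_smul, inv_mul_cancel₀ hst, one_smul]
      rw [div_eq_inv_mul, mul_smul, smul_sub t, add_smul] at *
      nth_rewrite 2 [this]
      rw [← sub_eq_zero]
      module
    rw [e1, e2]
    generalize x - y = u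
    generalize z - y = v
    rw [norm_sub_sq_real, norm_sub_sq_real, norm_smul, real_inner_smul_right,
      real_inner_comm u v, Real.norm_eq_abs, mul_pow, sq_abs, hb]
    field_simp
    ring
  have h1 : ∀ z, heat s (x - z) * heat t (z - y) =
      ((4 * Real.pi * s) ^ (-((Module.finrank ℝ E : ℝ) / 2)) *
        (4 * Real.pi * t) ^ (-((Module.finrank ℝ E : ℝ) / 2)) *
        Real.exp (-(1 / (4 * (s + t))) * ‖x - y‖ ^ 2)) * Real.exp (-b * ‖z - a‖ ^ 2) := by
    intro z
    unfold heat
    rw [mul_mul_mul_comm, ← Real.exp_add, key, Real.exp_add]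
    ring
  simp_rw [h1]
  rw [integral_const_mul, integral_sub_right_eq_self (fun z => Real.exp (-b * ‖z‖ ^ 2)) a,
    GaussianFourier.integral_rexp_neg_mul_sq_norm (by positivity)]
  unfold heat
  rw [mul_right_comm]
  congr 1
  rw [Real.rpow_neg (by positivity), Real.rpow_neg (by positivity), Real.rpow_neg (by positivity),
    ← mul_inv, ← Real.mul_rpow (by positivity) (by positivity), inv_mul_eq_div,
    ← Real.div_rpow (by positivity) (by positivity), ← Real.inv_rpow (by positivity)]
  congr 1
  rw [hb]; field_simp
  
end KernelIntegrals

/-! ### Integrals against the polynomial majorant -/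

section PolyIntegrals

variable {E : Type*} [NormedAddCommGroup E] [InnerProductSpace ℝ E] [FiniteDimensional ℝ E]
  [MeasurableSpace E] [BorelSpace E]

lemma volume_ball_eq (x : E) {r : ℝ} (hr : 0 < r) :
    volume (Metric.ball x r) =
      ENNReal.ofReal (r ^ Module.finrank ℝ E) * volume (Metric.ball (0 : E) 1) :=
  Measure.addHaar_ball_of_pos _ _ hr

/-- Integration against the kernel `poly R` is controlled by averages over dyadic balls. -/
lemma lintegral_poly_mul_le {R : ℝ} (hR : 0 < R) (x : E) {w : E → ℝ≥0∞} (hw : AEMeasurable w)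
    {b : ℕ → ℝ≥0∞}
    (h : ∀ k : ℕ, ∫⁻ y in Metric.ball x (2 ^ k * R), w y ≤
      b k * volume (Metric.ball x (2 ^ k * R))) :
    ∫⁻ y, ENNReal.ofReal (poly R (x - y)) * w y ≤
      ENNReal.ofReal (2 ^ (Module.finrank ℝ E + 1)) * volume (Metric.ball (0 : E) 1) *
        ∑' k, ENNReal.ofReal ((1 / 2) ^ k) * b k := by
  set D := Module.finrank ℝ E with hD
  -- `c k` bounds `poly R` on the shell `2 ^ (k-1) R ≤ ‖x - y‖ < 2 ^ k R`, where `1 + ‖x - y‖ / R ≥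
  -- 2 ^ (k-1)`. Multiplied by the volume of the ball of radius `2 ^ k R`, it leaves the summable
  -- weight `2 ^ (-k)`.
  set c : ℕ → ℝ := fun k => (R ^ D)⁻¹ * 2 ^ (D + 1) * (((2 : ℝ) ^ k) ^ (D + 1))⁻¹ with hc
  have hc0 : ∀ k, 0 ≤ c k := fun k => by simp only [hc]; positivity
  have pt : ∀ y, ENNReal.ofReal (poly R (x - y)) * w y ≤
      ∑' k, ENNReal.ofReal (c k) * (Metric.ball x (2 ^ k * R)).indicator w y := by
    intro y
    have hex : ∃ k : ℕ, ‖x - y‖ < 2 ^ k * R := by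
      obtain ⟨k, hk⟩ := pow_unbounded_of_one_lt (‖x - y‖ / R) (one_lt_two (α := ℝ))
      exact ⟨k, by rwa [div_lt_iff₀ hR] at hk⟩
    classical
    have hk := Nat.find_spec hex
    have hmin := fun j hj => Nat.find_min hex (m := j) hj
    set k := Nat.find hex
    refine le_trans ?_ (ENNReal.le_tsum k)
    rw [Set.indicator_of_mem (by rwa [Metric.mem_ball, dist_comm, dist_eq_norm])]
    gcongr
    simp only [hc, poly]
    rw [mul_assoc]
    gcongr
    rw [← div_eq_mul_inv, ← div_pow, ← inv_pow]
    gcongr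
    -- The innermost ball has no lower bound on the distance; there `1 + ‖x - y‖ / R ≥ 1` suffices.
    rcases Nat.eq_zero_or_pos k with h0 | h0
    · rw [h0]
      have : 0 ≤ ‖x - y‖ / R := by positivity
      calc (1 + ‖x - y‖ / R)⁻¹ ≤ 1 := inv_le_one_of_one_le₀ (by linarith)
        _ ≤ _ := by norm_num
    · have h1 := not_lt.1 (hmin (k - 1) (by omega))
      have h2 : (2 : ℝ) ^ k = 2 * 2 ^ (k - 1) := by
        rw [← pow_succ']; congr 1; omega
      rw [h2, ← le_div_iff₀ hR] at *
      rw [inv_le_comm₀ (by positivity) (by positivity), inv_div,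
        mul_div_cancel_left₀ _ (two_ne_zero)]
      linarith
  calc _ ≤ ∫⁻ y, ∑' k, ENNReal.ofReal (c k) * (Metric.ball x (2 ^ k * R)).indicator w y :=
        lintegral_mono pt
    _ = ∑' k, ENNReal.ofReal (c k) * ∫⁻ y in Metric.ball x (2 ^ k * R), w y := by
        rw [lintegral_tsum fun k => (hw.indicator measurableSet_ball).const_mul _]
        congr 1; ext k
        rw [lintegral_const_mul' _ _ ENNReal.ofReal_ne_top, lintegral_indicator measurableSet_ball]
    _ ≤ ∑' k, ENNReal.ofReal (2 ^ (D + 1)) * volume (Metric.ball (0 : E) 1) *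
          (ENNReal.ofReal ((1 / 2) ^ k) * b k) := by
        refine ENNReal.tsum_le_tsum fun k => ?_
        refine (mul_le_mul_right (h k) _).trans (le_of_eq ?_)
        rw [volume_ball_eq x (by positivity)]
        have : c k * (2 ^ k * R) ^ D = 2 ^ (D + 1) * (1 / 2) ^ k := by
          simp only [hc]
          rw [one_div, inv_pow]
          field_simp
          ring
        calc _ = (ENNReal.ofReal (c k) * ENNReal.ofReal ((2 ^ k * R) ^ D)) *
              volume (Metric.ball (0 : E) 1) * b k := by ring
          _ = _ := by
            rw [← ENNReal.ofReal_mul (hc0 k), this, ENNReal.ofReal_mul (by positivity)]; ring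
    _ = _ := ENNReal.tsum_mul_left

variable (E) in
lemma exists_lintegral_poly_le : ∃ C : ℝ≥0, ∀ R : ℝ, 0 < R → ∀ x : E,
    ∫⁻ y, ENNReal.ofReal (poly R (x - y)) ≤ C := by
  have hfin : ENNReal.ofReal (2 ^ (Module.finrank ℝ E + 1)) * volume (Metric.ball (0 : E) 1) *
        ∑' k : ℕ, ENNReal.ofReal ((1 / 2) ^ k) * 1 ≠ ⊤ := by
    refine ENNReal.mul_ne_top (ENNReal.mul_ne_top ENNReal.ofReal_ne_top
      measure_ball_lt_top.ne) ?_
    simp_rw [mul_one]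
    exact summable_geometric_two.tsum_ofReal_ne_top
  refine ⟨_, fun R hR x => le_trans ?_ (ENNReal.coe_toNNReal hfin).ge⟩
  have := lintegral_poly_mul_le hR x (w := fun _ => 1) (b := fun _ => 1) aemeasurable_const
    (fun k => by simp)
  simpa using this

variable (E) in
/-- A function with controlled averages at scale `r` has controlled integrals against
`poly R` for all `R ≥ r`. -/
lemma exists_lintegral_poly_mul_le_of_average : ∃ C : ℝ≥0, ∀ r R : ℝ, 0 < r → r ≤ R →
    ∀ (w : E → ℝ≥0∞) (N : ℝ≥0∞), AEMeasurable w →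
      (∀ᵐ z, ∫⁻ y in Metric.ball z r, w y ≤ N * volume (Metric.ball z r)) →
        ∀ x : E, ∫⁻ y, ENNReal.ofReal (poly R (x - y)) * w y ≤ C * N := by
  obtain ⟨C, hC⟩ := exists_lintegral_poly_le E
  refine ⟨2 ^ (Module.finrank ℝ E + 1) * C, fun r R hr hrR w N hw h x => ?_⟩
  have hR : 0 < R := hr.trans_le hrR
  set V := volume (Metric.ball (0 : E) r) with hV
  have hVx : ∀ z : E, volume (Metric.ball z r) = V := fun z =>
    Measure.addHaar_ball_center _ _ _
  have hV0 : V ≠ 0 := (Metric.measure_ball_pos _ _ hr).ne'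
  have hVt : V ≠ ⊤ := measure_ball_lt_top.ne
  have hmp : Measurable fun y : E => ENNReal.ofReal (poly R (x - y)) :=
    ((continuous_poly hR).comp (by fun_prop : Continuous fun y : E => x - y)).measurable.ennreal_ofReal
  have hS : MeasurableSet {p : E × E | dist p.1 p.2 < r} :=
    measurableSet_lt (by fun_prop) measurable_const
  -- Averaging at scale `r`: the constant ball volume `V` is written as an integral over centres `z`
  -- near `y` and the order of integration is exchanged. As `‖y - z‖ < r ≤ R`, the majorant at `y`
  -- can be replaced by the one at `z`, leaving averages of `w` over balls of radius `r`.
  have step1 : ∫⁻ y, ENNReal.ofReal (poly R (x - y)) * w y * V =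
      ∫⁻ y, ∫⁻ z, {p : E × E | dist p.1 p.2 < r}.indicator
        (fun p => ENNReal.ofReal (poly R (x - p.1)) * w p.1) (y, z) := by
    congr 1; ext y
    rw [← hVx y, ← setLIntegral_const, ← lintegral_indicator measurableSet_ball]
    congr 1; ext z
    by_cases hz : dist y z < r
    · rw [Set.indicator_of_mem (by rwa [Metric.mem_ball, dist_comm]),
        Set.indicator_of_mem (show (y, z) ∈ {p : E × E | dist p.1 p.2 < r} from hz)]
    · rw [Set.indicator_of_notMem (by rwa [Metric.mem_ball, dist_comm]),
        Set.indicator_of_notMem (show (y, z) ∉ {p : E × E | dist p.1 p.2 < r} from hz)]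
  have hmeas : AEMeasurable (fun p : E × E => {p : E × E | dist p.1 p.2 < r}.indicator
        (fun p => ENNReal.ofReal (poly R (x - p.1)) * w p.1) p) (volume.prod volume) := by
    refine AEMeasurable.indicator ?_ hS
    exact (hmp.comp measurable_fst).aemeasurable.mul hw.comp_fst
  have step2 : ∫⁻ y, ENNReal.ofReal (poly R (x - y)) * w y * V ≤
      2 ^ (Module.finrank ℝ E + 1) * C * N * V := by
    rw [step1, lintegral_lintegral_swap hmeas]
    calc _ ≤ ∫⁻ z, ENNReal.ofReal (2 ^ (Module.finrank ℝ E + 1) * poly R (x - z)) *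
          (N * V) := by
          -- The centre `z` is an integration variable, so almost every centre is enough. In the
          -- application this discards centres on the boundary hyperplane.
          refine lintegral_mono_ae ?_
          filter_upwards [h] with z hz
          rw [hVx] at hz
          refine le_trans ?_ (mul_le_mul_right hz _)
          rw [← lintegral_const_mul' _ _ ENNReal.ofReal_ne_top,
            ← lintegral_indicator measurableSet_ball]
          refine lintegral_mono fun y => ?_
          by_cases hy : dist y z < r
          · rw [Set.indicator_of_mem (show (y, z) ∈ {p : E × E | dist p.1 p.2 < r} from hy),
              Set.indicator_of_mem (by rwa [Metric.mem_ball])]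
            gcongr
            refine poly_le_of_norm_sub_le hR ?_
            rw [sub_sub_sub_cancel_left, ← dist_eq_norm, dist_comm]
            exact hy.le.trans hrR
          · rw [Set.indicator_of_notMem (show (y, z) ∉ {p : E × E | dist p.1 p.2 < r} from hy)]
            exact zero_le
      _ ≤ 2 ^ (Module.finrank ℝ E + 1) * C * (N * V) := by
          have hm2 : Measurable fun z : E =>
              ENNReal.ofReal (2 ^ (Module.finrank ℝ E + 1) * poly R (x - z)) := by
            simp_rw [ENNReal.ofReal_mul (by positivity : (0 : ℝ) ≤ 2 ^ (Module.finrank ℝ E + 1))]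
            exact hmp.const_mul _
          rw [lintegral_mul_const _ hm2]
          gcongr
          simp_rw [ENNReal.ofReal_mul (by positivity : (0 : ℝ) ≤ 2 ^ (Module.finrank ℝ E + 1))]
          rw [lintegral_const_mul _ hmp, ENNReal.ofReal_pow (by norm_num)]
          gcongr
          · simp
          · exact hC R hR x
      _ = _ := by ring
  rw [lintegral_mul_const' _ _ hVt] at step2
  have := (ENNReal.mul_le_mul_iff_left hV0 hVt).1 step2
  push_cast
  exact this

end PolyIntegrals

/-! ### The heat flow on functions of polynomial growth -/

section Flow

variable {E : Type*} [NormedAddCommGroup E] [InnerProductSpace ℝ E]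
  [MeasurableSpace E] [BorelSpace E] [FiniteDimensional ℝ E]

/-- The action of the heat semigroup of the whole space. -/
def flow (t : ℝ) (F : E → ℂ) (x : E) : ℂ := ∫ y, heat t (x - y) • F y

/-- Functions of at most polynomial growth in the mean. -/
def Tempered (F : E → ℂ) : Prop :=
  ∃ m : ℕ, Integrable (fun y => ((1 + ‖y‖) ^ m)⁻¹ • F y)

lemma continuous_inv_one_add_norm_pow (m : ℕ) :
    Continuous (fun y : E => ((1 + ‖y‖) ^ m)⁻¹) :=
  Continuous.inv₀ (by fun_prop) fun y => by positivity

lemma Tempered.aestronglyMeasurable {F : E → ℂ} (hF : Tempered F) :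
    AEStronglyMeasurable F := by
  obtain ⟨m, hm⟩ := hF
  have h1 : Continuous (fun y : E => (1 + ‖y‖) ^ m) := by fun_prop
  have := h1.aestronglyMeasurable (μ := volume) |>.smul hm.aestronglyMeasurable
  refine this.congr (Eventually.of_forall fun y => ?_)
  have : (1 + ‖y‖) ^ m ≠ 0 := by positivity
  simp only [Pi.smul_apply', smul_smul, mul_inv_cancel₀ this, one_smul]

lemma integrable_inv_pow_of_le {F : E → ℂ} {m m' : ℕ} (h : m ≤ m')
    (hm : Integrable (fun y => ((1 + ‖y‖) ^ m)⁻¹ • F y)) :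
    Integrable (fun y => ((1 + ‖y‖) ^ m')⁻¹ • F y) := by
  refine hm.mono ((continuous_inv_one_add_norm_pow m').aestronglyMeasurable.smul
    (Tempered.aestronglyMeasurable ⟨m, hm⟩)) (Eventually.of_forall fun y => ?_)
  rw [norm_smul, norm_smul]
  gcongr
  rw [Real.norm_of_nonneg (by positivity), Real.norm_of_nonneg (by positivity)]
  gcongr
  linarith [norm_nonneg y]

lemma Tempered.add {F G : E → ℂ} (hF : Tempered F) (hG : Tempered G) : Tempered (F + G) := by
  obtain ⟨m, hm⟩ := hF
  obtain ⟨k, hk⟩ := hG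
  refine ⟨max m k, ?_⟩
  simp only [Pi.add_apply, smul_add]
  exact (integrable_inv_pow_of_le (le_max_left _ _) hm).add
    (integrable_inv_pow_of_le (le_max_right _ _) hk)

lemma Tempered.neg {F : E → ℂ} (hF : Tempered F) : Tempered (-F) := by
  obtain ⟨m, hm⟩ := hF
  refine ⟨m, ?_⟩
  simp only [Pi.neg_apply, smul_neg]
  exact Integrable.fun_neg hm

lemma Tempered.sub {F G : E → ℂ} (hF : Tempered F) (hG : Tempered G) : Tempered (F - G) := by
  rw [sub_eq_add_neg]; exact hF.add hG.neg

lemma integrable_inv_one_add_norm_pow :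
    Integrable (fun y : E => ((1 + ‖y‖) ^ (Module.finrank ℝ E + 1))⁻¹) := by
  have := integrable_one_add_norm (E := E) (μ := volume) (r := Module.finrank ℝ E + 1) (by simp)
  refine this.congr (Eventually.of_forall fun y => ?_)
  simp only
  rw [Real.rpow_neg (by positivity)]
  norm_cast

lemma Tempered.of_norm_le {F : E → ℂ} (hF : AEStronglyMeasurable F) {C : ℝ} {m : ℕ}
    (h : ∀ᵐ x, ‖F x‖ ≤ C * (1 + ‖x‖) ^ m) : Tempered F := by
  refine ⟨m + (Module.finrank ℝ E + 1), ?_⟩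
  refine (integrable_inv_one_add_norm_pow.const_mul C).mono'
    ((continuous_inv_one_add_norm_pow _).aestronglyMeasurable.smul hF) ?_
  filter_upwards [h] with x hx
  rw [norm_smul, Real.norm_of_nonneg (by positivity), inv_mul_le_iff₀ (by positivity)]
  refine hx.trans (le_of_eq ?_)
  rw [pow_add]
  field_simp

lemma tempered_const (c : ℂ) : Tempered (fun _ : E => c) :=
  .of_norm_le (C := ‖c‖) (m := 0) aestronglyMeasurable_const (by simp)

/-- Peetre's inequality `1 + ‖y‖ ≤ (1 + ‖x‖) (1 + ‖x - y‖)`: decay away from `x` is traded for decay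
away from the origin, at polynomial cost in `x`. -/
lemma inv_one_add_norm_sub_pow_le (m : ℕ) (x y : E) :
    ((1 + ‖x - y‖) ^ m)⁻¹ ≤ (1 + ‖x‖) ^ m * ((1 + ‖y‖) ^ m)⁻¹ := by
  rw [← div_eq_mul_inv, le_div_iff₀ (by positivity), inv_mul_le_iff₀ (by positivity), ← mul_pow]
  gcongr
  have : ‖y‖ ≤ ‖x‖ + ‖x - y‖ := by
    have := norm_sub_norm_le y x
    rw [norm_sub_rev] at this; linarith
  nlinarith [norm_nonneg x, norm_nonneg (x - y)]

/-- The heat flow of a tempered function converges and has polynomial growth. -/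
lemma Tempered.heat_smul {F : E → ℂ} (hF : Tempered F) {t : ℝ} (ht : 0 < t) :
    (∀ x, Integrable (fun y => heat t (x - y) • F y)) ∧
      ∃ C : ℝ, 0 ≤ C ∧ ∃ m : ℕ, ∀ x, ‖flow t F x‖ ≤ C * (1 + ‖x‖) ^ m := by
  obtain ⟨m, hm⟩ := id hF
  obtain ⟨C, hC, h⟩ := heat_le_decay (E := E) m ht
  have key : ∀ x y, ‖heat t (x - y) • F y‖ ≤
      C * (1 + ‖x‖) ^ m * ‖((1 + ‖y‖) ^ m)⁻¹ • F y‖ := by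
    intro x y
    rw [norm_smul, norm_smul, Real.norm_of_nonneg (heat_pos ht _).le,
      Real.norm_of_nonneg (by positivity), ← mul_assoc]
    gcongr
    refine (h _).trans ?_
    rw [mul_assoc]
    gcongr
    exact inv_one_add_norm_sub_pow_le m x y
  refine ⟨fun x => ?_, C * ∫ y, ‖((1 + ‖y‖) ^ m)⁻¹ • F y‖, ?_, m, fun x => ?_⟩
  · refine (hm.norm.const_mul (C * (1 + ‖x‖) ^ m)).mono' ?_ (Eventually.of_forall (key x))
    exact ((continuous_heat t).comp
      (by fun_prop : Continuous fun y : E => x - y)).aestronglyMeasurable.smul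
      hF.aestronglyMeasurable
  · exact mul_nonneg hC.le (integral_nonneg fun _ => norm_nonneg _)
  · refine (norm_integral_le_of_norm_le (hm.norm.const_mul (C * (1 + ‖x‖) ^ m))
      (Eventually.of_forall (key x))).trans (le_of_eq ?_)
    rw [integral_const_mul]; ring

lemma Tempered.integrable_heat {F : E → ℂ} (hF : Tempered F) {t : ℝ} (ht : 0 < t) (x : E) :
    Integrable (fun y => heat t (x - y) • F y) := (hF.heat_smul ht).1 x

lemma flow_congr_ae {F G : E → ℂ} (h : F =ᵐ[volume] G) (t : ℝ) : flow t F = flow t G := by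
  ext x
  exact integral_congr_ae (h.mono fun y hy => by simp only [hy])

lemma flow_add {F G : E → ℂ} (hF : Tempered F) (hG : Tempered G) {t : ℝ} (ht : 0 < t) :
    flow t (F + G) = flow t F + flow t G := by
  ext x
  simp only [flow, Pi.add_apply, smul_add]
  exact integral_add (hF.integrable_heat ht x) (hG.integrable_heat ht x)

lemma flow_sub {F G : E → ℂ} (hF : Tempered F) (hG : Tempered G) {t : ℝ} (ht : 0 < t) :
    flow t (F - G) = flow t F - flow t G := by
  ext x
  simp only [flow, Pi.sub_apply, smul_sub]
  exact integral_sub (hF.integrable_heat ht x) (hG.integrable_heat ht x)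

lemma integral_heat_sub {t : ℝ} (ht : 0 < t) (x : E) : ∫ y, heat t (x - y) = 1 := by
  rw [integral_sub_left_eq_self (heat t) volume x, integral_heat ht]

lemma flow_const {t : ℝ} (ht : 0 < t) (c : ℂ) : flow t (fun _ : E => c) = fun _ => c := by
  ext x
  rw [flow, integral_smul_const, integral_heat_sub ht, one_smul]

lemma stronglyMeasurable_flow {F : E → ℂ} (hF : AEStronglyMeasurable F) (t : ℝ) :
    StronglyMeasurable (flow t F) := by
  rw [flow_congr_ae hF.ae_eq_mk t]
  refine StronglyMeasurable.integral_prod_right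
    (f := fun x y => heat t (x - y) • hF.mk F y) ?_
  have h1 : StronglyMeasurable fun p : E × E => heat t (p.1 - p.2) :=
    ((continuous_heat t).comp
      (by fun_prop : Continuous fun p : E × E => p.1 - p.2)).stronglyMeasurable
  exact h1.smul (hF.stronglyMeasurable_mk.comp_measurable measurable_snd)

lemma Tempered.flow {F : E → ℂ} (hF : Tempered F) {t : ℝ} (ht : 0 < t) :
    Tempered (flow t F) := by
  obtain ⟨-, C, -, m, h⟩ := hF.heat_smul ht
  exact .of_norm_le (stronglyMeasurable_flow hF.aestronglyMeasurable t).aestronglyMeasurable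
    (Eventually.of_forall h)

/-- The semigroup property. -/
lemma flow_flow {F : E → ℂ} (hF : Tempered F) {s t : ℝ} (hs : 0 < s) (ht : 0 < t) :
    HalfSpaceBMO.flow s (HalfSpaceBMO.flow t F) = HalfSpaceBMO.flow (s + t) F := by
  ext x
  have hprod : Integrable (Function.uncurry fun z y =>
      (heat s (x - z) * heat t (z - y)) • F y) (volume.prod volume) := by
    rw [integrable_prod_iff']
    · constructor
      · refine Eventually.of_forall fun y => Integrable.smul_const (c := F y) ?_
        -- If the product of kernels were not integrable, its integral would be zero by convention,
        -- but the Chapman–Kolmogorov value is positive.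
        by_contra h'
        have h1 := integral_heat_mul_heat hs ht x y
        rw [integral_undef h'] at h1
        exact (heat_pos (add_pos hs ht) (x - y)).ne h1
      · refine ((hF.integrable_heat (add_pos hs ht) x).norm).congr (Eventually.of_forall fun y => ?_)
        simp only [Function.uncurry, norm_smul, norm_mul,
          Real.norm_of_nonneg (heat_pos hs _).le, Real.norm_of_nonneg (heat_pos ht _).le,
          Real.norm_of_nonneg (heat_pos (add_pos hs ht) _).le]
        rw [integral_mul_const, integral_heat_mul_heat hs ht]
    · have h1 : Continuous fun p : E × E => heat s (x - p.1) * heat t (p.1 - p.2) :=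
        ((continuous_heat s).comp (by fun_prop : Continuous fun p : E × E => x - p.1)).mul
          ((continuous_heat t).comp (by fun_prop : Continuous fun p : E × E => p.1 - p.2))
      exact h1.aestronglyMeasurable.smul hF.aestronglyMeasurable.comp_snd
  have e1 : HalfSpaceBMO.flow s (HalfSpaceBMO.flow t F) x =
      ∫ z, ∫ y, (heat s (x - z) * heat t (z - y)) • F y := by
    unfold HalfSpaceBMO.flow
    congr 1; ext z
    rw [← integral_smul]
    simp_rw [smul_smul]
  rw [e1, integral_integral_swap hprod]
  unfold HalfSpaceBMO.flow
  congr 1; ext y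
  rw [integral_smul_const, integral_heat_mul_heat hs ht]

variable (E) in
/-- Pointwise and Lipschitz bounds for the heat flow near a point in terms of the majorant
`poly`. -/
lemma exists_norm_flow_le_of_lintegral_le : ∃ C : ℝ≥0, ∀ R : ℝ, 0 < R → ∀ (h : E → ℂ) (M : ℝ≥0),
    AEStronglyMeasurable h → ∀ x : E,
      ∫⁻ y, ENNReal.ofReal (poly R (x - y)) * ‖h y‖ₑ ≤ M →
        ‖HalfSpaceBMO.flow (R ^ 2) h x‖ ≤ C * M ∧
          ∀ x', ‖x - x'‖ ≤ R →
            ‖HalfSpaceBMO.flow (R ^ 2) h x - HalfSpaceBMO.flow (R ^ 2) h x'‖ ≤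
              C * M * (‖x - x'‖ / R) := by
  obtain ⟨C, hC, h1, h2⟩ := exists_heat_le_poly E
  refine ⟨C.toNNReal, fun R hR h M hh x hM => ?_⟩
  rw [Real.coe_toNNReal _ hC.le]
  have hR2 : 0 < R ^ 2 := by positivity
  have hmp : ∀ x : E, Continuous fun y : E => poly R (x - y) := fun x =>
    (continuous_poly hR).comp (by fun_prop : Continuous fun y : E => x - y)
  have hmh : ∀ x : E, Continuous fun y : E => heat (R ^ 2) (x - y) := fun x =>
    (continuous_heat _).comp (by fun_prop : Continuous fun y : E => x - y)
  have hnorm : ∀ y, ‖poly R (x - y) • h y‖ₑ = ENNReal.ofReal (poly R (x - y)) * ‖h y‖ₑ := by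
    intro y
    rw [enorm_smul, Real.enorm_of_nonneg (poly_pos hR _).le]
  have hint : Integrable fun y => poly R (x - y) • h y :=
    ⟨(hmp x).aestronglyMeasurable.smul hh, by
      unfold HasFiniteIntegral
      simp_rw [hnorm]
      exact hM.trans_lt ENNReal.coe_lt_top⟩
  have hintM : ∫ y, ‖poly R (x - y) • h y‖ ≤ M := by
    rw [integral_norm_eq_lintegral_enorm hint.aestronglyMeasurable]
    simp_rw [hnorm]
    exact ENNReal.toReal_le_coe_of_le_coe hM
  have hb : ∀ y, ‖heat (R ^ 2) (x - y) • h y‖ ≤ C * ‖poly R (x - y) • h y‖ := by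
    intro y
    rw [norm_smul, norm_smul, Real.norm_of_nonneg (heat_pos hR2 _).le,
      Real.norm_of_nonneg (poly_pos hR _).le, ← mul_assoc]
    gcongr
    exact h1 R hR _
  have hint2 : ∀ x', ‖x - x'‖ ≤ R → Integrable fun y => heat (R ^ 2) (x' - y) • h y := by
    intro x' hx'
    refine (hint.norm.const_mul (C * 2 ^ (Module.finrank ℝ E + 1))).mono'
      ((hmh x').aestronglyMeasurable.smul hh) (Eventually.of_forall fun y => ?_)
    rw [norm_smul, norm_smul, Real.norm_of_nonneg (heat_pos hR2 _).le,
      Real.norm_of_nonneg (poly_pos hR _).le, ← mul_assoc]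
    gcongr
    refine (h1 R hR _).trans ?_
    rw [mul_assoc]
    gcongr
    refine poly_le_of_norm_sub_le hR ?_
    rwa [sub_sub_sub_cancel_right, norm_sub_rev]
  constructor
  · refine (norm_integral_le_of_norm_le (hint.norm.const_mul C)
      (Eventually.of_forall hb)).trans ?_
    rw [integral_const_mul]
    gcongr
  · intro x' hx
    have e : HalfSpaceBMO.flow (R ^ 2) h x - HalfSpaceBMO.flow (R ^ 2) h x' =
        ∫ y, (heat (R ^ 2) (x - y) - heat (R ^ 2) (x' - y)) • h y := by
      simp only [sub_smul]
      exact (integral_sub (hint2 x (by simpa using hR.le)) (hint2 x' hx)).symm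
    have hb2 : ∀ y, ‖(heat (R ^ 2) (x - y) - heat (R ^ 2) (x' - y)) • h y‖ ≤
        C * (‖x - x'‖ / R) * ‖poly R (x - y) • h y‖ := by
      intro y
      rw [norm_smul, norm_smul, Real.norm_of_nonneg (poly_pos hR _).le, ← mul_assoc]
      gcongr
      have := h2 R hR (x - y) (x' - y) (by rwa [sub_sub_sub_cancel_right])
      rwa [sub_sub_sub_cancel_right] at this
    rw [e]
    refine (norm_integral_le_of_norm_le (hint.norm.const_mul _)
      (Eventually.of_forall hb2)).trans ?_
    rw [integral_const_mul]
    calc C * (‖x - x'‖ / R) * ∫ y, ‖poly R (x - y) • h y‖ ≤ C * (‖x - x'‖ / R) * M := by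
          gcongr
      _ = _ := by ring

variable (E) in
/-- Pointwise and Lipschitz bounds for the heat flow in terms of the majorant `poly`. -/
lemma exists_norm_flow_le : ∃ C : ℝ≥0, ∀ R : ℝ, 0 < R → ∀ (h : E → ℂ) (M : ℝ≥0),
    AEStronglyMeasurable h →
      (∀ x, ∫⁻ y, ENNReal.ofReal (poly R (x - y)) * ‖h y‖ₑ ≤ M) →
        (∀ x, ‖HalfSpaceBMO.flow (R ^ 2) h x‖ ≤ C * M) ∧
          ∀ x x', ‖HalfSpaceBMO.flow (R ^ 2) h x - HalfSpaceBMO.flow (R ^ 2) h x'‖ ≤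
            C * M * (‖x - x'‖ / R) := by
  obtain ⟨C, hC⟩ := exists_norm_flow_le_of_lintegral_le E
  refine ⟨2 * C, fun R hR h M hh hM => ?_⟩
  have bd := fun x => (hC R hR h M hh x (hM x)).1
  have h0 : (0 : ℝ) ≤ C * M := by positivity
  push_cast
  refine ⟨fun x => (bd x).trans (by linarith), fun x x' => ?_⟩
  have hp : 0 ≤ ‖x - x'‖ / R := by positivity
  -- Beyond distance `R` the two pointwise bounds already imply the Lipschitz bound, at the price of
  -- doubling the constant.
  by_cases hx : ‖x - x'‖ ≤ R
  · refine ((hC R hR h M hh x (hM x)).2 x' hx).trans ?_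
    nlinarith [mul_nonneg h0 hp]
  · have h3 : 1 ≤ ‖x - x'‖ / R := by rw [le_div_iff₀ hR]; linarith
    calc _ ≤ ‖HalfSpaceBMO.flow (R ^ 2) h x‖ + ‖HalfSpaceBMO.flow (R ^ 2) h x'‖ :=
          norm_sub_le _ _
      _ ≤ 2 * C * M := by linarith [bd x, bd x']
      _ ≤ _ := le_mul_of_one_le_right (by positivity) h3

end Flow

/-! ### Splitting off the caloric part -/

section CaloricPart

variable {E : Type*} [NormedAddCommGroup E] [InnerProductSpace ℝ E]
  [MeasurableSpace E] [BorelSpace E] [FiniteDimensional ℝ E]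

/-- Mean oscillation over balls at most `A`. -/
def HasOsc (F : E → ℂ) (A : ℝ≥0∞) : Prop :=
  ∀ x r, 0 < r → ∃ a : ℂ,
    ∫⁻ y in Metric.ball x r, ‖F y - a‖ₑ ≤ A * volume (Metric.ball x r)

lemma integrable_heat_mul_pow {t : ℝ} (ht : 0 < t) (m : ℕ) :
    Integrable (fun z : E => heat t z * (1 + ‖z‖) ^ m) := by
  obtain ⟨C, hC, h⟩ := heat_le_decay (E := E) (m + (Module.finrank ℝ E + 1)) ht
  refine (integrable_inv_one_add_norm_pow.const_mul C).mono' (Continuous.aestronglyMeasurable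
    ((continuous_heat t).mul (by fun_prop))) (Eventually.of_forall fun z => ?_)
  rw [Real.norm_of_nonneg (mul_nonneg (heat_pos ht _).le (by positivity))]
  calc heat t z * (1 + ‖z‖) ^ m ≤
        C * ((1 + ‖z‖) ^ (m + (Module.finrank ℝ E + 1)))⁻¹ * (1 + ‖z‖) ^ m := by
        gcongr; exact h z
    _ = _ := by rw [pow_add]; field_simp

/-- The kernel has mass one and a finite first moment, so the flow at a fixed time moves a
`K`-Lipschitz function by at most `K` times a constant depending on the time. -/
lemma exists_norm_flow_sub_self_le {t : ℝ} (ht : 0 < t) : ∃ M : ℝ, 0 ≤ M ∧ ∀ G : E → ℂ,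
    Tempered G → ∀ K : ℝ, 0 ≤ K → (∀ x x', ‖G x - G x'‖ ≤ K * ‖x - x'‖) →
      ∀ x, ‖flow t G x - G x‖ ≤ K * M := by
  refine ⟨∫ z : E, heat t z * (1 + ‖z‖) ^ 1,
    integral_nonneg fun z => mul_nonneg (heat_pos ht _).le (by positivity),
    fun G hG K hK h x => ?_⟩
  have e : flow t G x - G x = ∫ y, heat t (x - y) • (G y - G x) := by
    simp only [smul_sub]
    rw [integral_sub (hG.integrable_heat ht x)
      (((integrable_heat ht).comp_sub_left x).smul_const _), integral_smul_const,
      integral_heat_sub ht, one_smul, flow]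
  rw [e, ← integral_sub_left_eq_self (fun z => heat t z * (1 + ‖z‖) ^ 1) volume x,
    ← integral_const_mul]
  refine norm_integral_le_of_norm_le
    (((integrable_heat_mul_pow ht 1).comp_sub_left x).const_mul K) (Eventually.of_forall fun y => ?_)
  rw [norm_smul, Real.norm_of_nonneg (heat_pos ht _).le]
  have h1 := h y x
  rw [norm_sub_rev y x] at h1
  have h2 : ‖G y - G x‖ ≤ K * (1 + ‖x - y‖) ^ 1 := h1.trans (by rw [pow_one]; gcongr; linarith)
  calc _ ≤ heat t (x - y) * (K * (1 + ‖x - y‖) ^ 1) := by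
        have := (heat_pos ht (x - y)).le
        gcongr
    _ = _ := by ring

/-- Bounds for the increments `flow s F - flow s' F`. -/
lemma norm_flow_sub_flow_le {F : E → ℂ} (hF : Tempered F) {K : ℝ} (hK : 0 ≤ K)
    (h : ∀ r R : ℝ, 0 < r → r ≤ R →
      (∀ x, ‖flow (R ^ 2) (F - flow (r ^ 2) F) x‖ ≤ K) ∧
      ∀ x x', ‖flow (R ^ 2) (F - flow (r ^ 2) F) x - flow (R ^ 2) (F - flow (r ^ 2) F) x'‖ ≤
        K * (‖x - x'‖ / R)) :
    (∀ s s', 0 < s → s ≤ s' → s' ≤ 2 * s → ∀ x, ‖flow s F x - flow s' F x‖ ≤ K) ∧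
    ∀ s s', 0 < s → s ≤ s' → ∀ x x',
      ‖(flow s F x - flow s' F x) - (flow s F x' - flow s' F x')‖ ≤
        4 * K * (‖x - x'‖ / √s) := by
  have base : ∀ s s', 0 < s → s ≤ s' → s' ≤ 2 * s →
      (∀ x, ‖flow s F x - flow s' F x‖ ≤ K) ∧ ∀ x x',
      ‖(flow s F x - flow s' F x) - (flow s F x' - flow s' F x')‖ ≤ K * (‖x - x'‖ / √s) := by
    intro s s' hs hss' hs2
    rcases hss'.eq_or_lt with rfl | hlt
    · simp only [sub_self, norm_zero]
      exact ⟨fun _ => hK, fun x x' => by positivity⟩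
    have hr : 0 < s' - s := by linarith
    have h1 := h (√(s' - s)) (√s) (Real.sqrt_pos.2 hr) (Real.sqrt_le_sqrt (by linarith))
    rw [Real.sq_sqrt hr.le, Real.sq_sqrt hs.le, flow_sub hF (hF.flow hr) hs,
      flow_flow hF hs hr, add_sub_cancel] at h1
    exact h1
  refine ⟨fun s s' h1 h2 h3 => (base s s' h1 h2 h3).1, ?_⟩
  -- Induction over doublings of the starting time. Since `√(2 s) ≥ (4/3) √s`, the bound closes with
  -- constant `4`, because `1 + 4 · (3/4) = 4`.
  have ind : ∀ k : ℕ, ∀ s s', 0 < s → s ≤ s' → s' ≤ 2 ^ k * s → ∀ x x',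
      ‖(flow s F x - flow s' F x) - (flow s F x' - flow s' F x')‖ ≤
        4 * K * (‖x - x'‖ / √s) := by
    intro k
    induction k with
    | zero =>
      intro s s' hs h1 h2 x x'
      have : s = s' := by linarith
      subst this
      simp only [sub_self, norm_zero]
      positivity
    | succ k ih =>
      intro s s' hs h1 h2 x x'
      have hp : 0 ≤ ‖x - x'‖ / √s := by positivity
      by_cases h3 : s' ≤ 2 * s
      · refine ((base s s' hs h1 h3).2 x x').trans ?_
        nlinarith [mul_nonneg hK hp]
      · have i1 := (base s (2 * s) hs (by linarith) le_rfl).2 x x'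
        have i2 := ih (2 * s) s' (by linarith) (by linarith) (by rw [pow_succ] at h2; linarith) x x'
        have i3 : ‖x - x'‖ / √(2 * s) ≤ (3 / 4) * (‖x - x'‖ / √s) := by
          have : (4 / 3) * √s ≤ √(2 * s) := by
            apply Real.le_sqrt_of_sq_le
            rw [mul_pow, Real.sq_sqrt hs.le]; linarith
          have hs0 : 0 < √s := Real.sqrt_pos.2 hs
          calc ‖x - x'‖ / √(2 * s) ≤ ‖x - x'‖ / ((4 / 3) * √s) := by gcongr
            _ = _ := by field_simp
        have e : (flow s F x - flow s' F x) - (flow s F x' - flow s' F x') =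
            ((flow s F x - flow (2 * s) F x) - (flow s F x' - flow (2 * s) F x')) +
            ((flow (2 * s) F x - flow s' F x) - (flow (2 * s) F x' - flow s' F x')) := by ring
        rw [e]
        refine (norm_add_le _ _).trans ?_
        calc _ ≤ K * (‖x - x'‖ / √s) + 4 * K * ((3 / 4) * (‖x - x'‖ / √s)) := by
              refine add_le_add i1 (i2.trans ?_); gcongr
          _ = _ := by ring
  intro s s' hs h1 x x'
  obtain ⟨k, hk⟩ := pow_unbounded_of_one_lt (s' / s) (one_lt_two (α := ℝ))
  exact ind k s s' hs h1 (by rw [div_lt_iff₀ hs] at hk; exact hk.le) x x'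

lemma tendsto_const_mul_div_sqrt (c : ℝ) :
    Tendsto (fun k : ℕ => c / √((k : ℝ) + 1)) atTop (𝓝 0) := by
  refine Tendsto.div_atTop tendsto_const_nhds ?_
  exact Real.tendsto_sqrt_atTop.comp
    (tendsto_atTop_add_const_right _ _ tendsto_natCast_atTop_atTop)

/-- The caloric limit of the renormalised heat flow. -/
lemma exists_flow_limit {F : E → ℂ} (hF : Tempered F) {K : ℝ} (hK : 0 ≤ K)
    (hb : ∀ s s', 0 < s → s ≤ s' → s' ≤ 2 * s → ∀ x, ‖flow s F x - flow s' F x‖ ≤ K)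
    (hL : ∀ s s', 0 < s → s ≤ s' → ∀ x x',
      ‖(flow s F x - flow s' F x) - (flow s F x' - flow s' F x')‖ ≤
        4 * K * (‖x - x'‖ / √s)) :
    ∃ H : E → ℂ, StronglyMeasurable H ∧ (∃ C : ℝ, ∃ m : ℕ, ∀ x, ‖H x‖ ≤ C * (1 + ‖x‖) ^ m) ∧
      (∀ t, 0 < t → flow t H = H) ∧
      (∀ x, Tendsto (fun k : ℕ => flow ((k : ℝ) + 1) F x - flow ((k : ℝ) + 1) F 0) atTop
        (𝓝 (H x))) ∧
      ∀ s, 0 < s → ∀ x x', ‖(flow s F x - H x) - (flow s F x' - H x')‖ ≤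
        4 * K * (‖x - x'‖ / √s) := by
  -- The increments over successive doublings of time are only bounded and need not sum, so the flow
  -- itself may diverge. Spatial differences converge, hence the normalisation at the origin.
  set u : ℕ → E → ℂ := fun k x => flow ((k : ℝ) + 1) F x - flow ((k : ℝ) + 1) F 0 with hu
  have hk1 : ∀ k : ℕ, (0 : ℝ) < (k : ℝ) + 1 := fun k => by positivity
  have hlim : ∀ x, ∃ y, Tendsto (fun k => u k x) atTop (𝓝 y) := by
    intro x
    apply cauchySeq_tendsto_of_complete
    refine cauchySeq_of_le_tendsto_0' (fun k : ℕ => (4 * K * ‖x‖) / √((k : ℝ) + 1)) ?_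
      (tendsto_const_mul_div_sqrt _)
    intro k j hkj
    rw [dist_eq_norm]
    have := hL ((k : ℝ) + 1) ((j : ℝ) + 1) (hk1 k) (by gcongr) x 0
    rw [sub_zero, ← mul_div_assoc] at this
    refine le_trans (le_of_eq ?_) this
    simp only [hu]; congr 1; ring
  choose H hH using hlim
  have hHL : ∀ s, 0 < s → ∀ x x', ‖(flow s F x - H x) - (flow s F x' - H x')‖ ≤
      4 * K * (‖x - x'‖ / √s) := by
    intro s hs x x'
    have ht : Tendsto (fun k => ‖(flow s F x - u k x) - (flow s F x' - u k x')‖) atTop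
        (𝓝 ‖(flow s F x - H x) - (flow s F x' - H x')‖) :=
      ((tendsto_const_nhds.sub (hH x)).sub (tendsto_const_nhds.sub (hH x'))).norm
    refine le_of_tendsto ht ?_
    obtain ⟨n, hn⟩ := exists_nat_ge s
    filter_upwards [eventually_ge_atTop n] with k hk
    have hk' : s ≤ (k : ℝ) + 1 := by
      have : (n : ℝ) ≤ k := by exact_mod_cast hk
      linarith
    refine le_trans (le_of_eq ?_) (hL s ((k : ℝ) + 1) hs hk' x x')
    simp only [hu]; congr 1; ring
  have hHm : StronglyMeasurable H := by
    refine stronglyMeasurable_of_tendsto (f := u) atTop (fun k => ?_) (tendsto_pi_nhds.2 hH)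
    exact (stronglyMeasurable_flow hF.aestronglyMeasurable _).sub stronglyMeasurable_const
  have hHb : ∃ C : ℝ, ∃ m : ℕ, ∀ x, ‖H x‖ ≤ C * (1 + ‖x‖) ^ m := by
    obtain ⟨-, C, hC, m, h⟩ := hF.heat_smul one_pos
    have hH0 : H 0 = 0 := by
      have := hH 0
      simp only [hu, sub_self] at this
      exact tendsto_nhds_unique this tendsto_const_nhds
    refine ⟨C + ‖flow 1 F 0‖ + 4 * K, m + 1, fun x => ?_⟩
    have h1 := hHL 1 one_pos x 0
    rw [hH0, sub_zero, sub_zero, Real.sqrt_one, div_one] at h1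
    have h2 : ‖H x‖ ≤ ‖flow 1 F x‖ + ‖flow 1 F 0‖ + 4 * K * ‖x‖ := by
      have e : H x = flow 1 F x - flow 1 F 0 - (flow 1 F x - H x - flow 1 F 0) := by ring
      calc ‖H x‖ = _ := congrArg norm e
        _ ≤ _ := (norm_sub_le _ _).trans (add_le_add (norm_sub_le _ _) h1)
    have h3 : (1 : ℝ) ≤ (1 + ‖x‖) ^ (m + 1) := one_le_pow₀ (by linarith [norm_nonneg x])
    have h4 : (1 + ‖x‖) ^ m ≤ (1 + ‖x‖) ^ (m + 1) :=
      pow_le_pow_right₀ (by linarith [norm_nonneg x]) (by omega)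
    have h5 : ‖x‖ ≤ (1 + ‖x‖) ^ (m + 1) := by
      calc ‖x‖ ≤ (1 + ‖x‖) ^ 1 := by rw [pow_one]; linarith
        _ ≤ _ := pow_le_pow_right₀ (by linarith [norm_nonneg x]) (by omega)
    calc ‖H x‖ ≤ _ := h2
      _ ≤ C * (1 + ‖x‖) ^ (m + 1) + ‖flow 1 F 0‖ * (1 + ‖x‖) ^ (m + 1) +
          4 * K * (1 + ‖x‖) ^ (m + 1) := by
        gcongr
        · exact (h x).trans (by gcongr)
        · exact le_mul_of_one_le_right (norm_nonneg _) h3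
      _ = _ := by ring
  obtain ⟨CH, mH, hCH⟩ := id hHb
  have hHT : Tempered H := .of_norm_le hHm.aestronglyMeasurable (Eventually.of_forall hCH)
  -- The function `flow (k + 1) F - H` has Lipschitz constant of order `1 / √(k + 1)`, so applying
  -- the flow for a fixed time `t` hardly changes it.
  have hlim2 : ∀ t, 0 < t → ∀ x, Tendsto
      (fun k : ℕ => flow (t + ((k : ℝ) + 1)) F x - flow ((k : ℝ) + 1) F x) atTop
      (𝓝 (flow t H x - H x)) := by
    intro t ht x
    obtain ⟨M, hM, hMG⟩ := exists_norm_flow_sub_self_le (E := E) ht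
    have : Tendsto (fun k : ℕ => (flow (t + ((k : ℝ) + 1)) F x - flow ((k : ℝ) + 1) F x) -
        (flow t H x - H x)) atTop (𝓝 0) := by
      refine squeeze_zero_norm (fun k => ?_) (tendsto_const_mul_div_sqrt (4 * K * M))
      have hT := (hF.flow (hk1 k)).sub hHT
      have h1 := hMG (flow ((k : ℝ) + 1) F - H) hT (4 * K / √((k : ℝ) + 1)) (by positivity)
        (fun x x' => by
          have := hHL _ (hk1 k) x x'
          simp only [Pi.sub_apply]
          rwa [div_mul_eq_mul_div, mul_div_assoc]) x
      rw [flow_sub (hF.flow (hk1 k)) hHT ht, flow_flow hF ht (hk1 k)] at h1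
      refine le_trans (le_of_eq ?_) (h1.trans (le_of_eq (by ring)))
      simp only [Pi.sub_apply]; congr 1; ring
    simpa using this.add_const (flow t H x - H x)
  have hbound : ∀ t, 0 < t → ∀ x, ‖flow t H x - H x‖ ≤ K := by
    intro t ht x
    refine le_of_tendsto (hlim2 t ht x).norm ?_
    obtain ⟨n, hn⟩ := exists_nat_ge t
    filter_upwards [eventually_ge_atTop n] with k hk
    have : (n : ℝ) ≤ k := by exact_mod_cast hk
    rw [norm_sub_rev]
    exact hb _ _ (hk1 k) (by linarith) (by linarith) x
  -- The increment of `flow (k + 1) F` over time `t` varies in space by at most a multiple of `‖x‖ /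
  -- √(k + 1)`, so its limit `flow t H - H` is constant.
  have hconst : ∀ t, 0 < t → ∀ x, flow t H x - H x = flow t H 0 - H 0 := by
    intro t ht x
    rw [← sub_eq_zero]
    refine tendsto_nhds_unique ((hlim2 t ht x).sub (hlim2 t ht 0)) ?_
    refine squeeze_zero_norm (fun k => ?_) (tendsto_const_mul_div_sqrt (4 * K * ‖x - 0‖))
    have := hL ((k : ℝ) + 1) (t + ((k : ℝ) + 1)) (hk1 k) (by linarith) x 0
    rw [mul_div_assoc]
    refine le_trans (le_of_eq ?_) this
    rw [← norm_neg]; congr 1; ring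
  set e : ℝ → ℂ := fun t => flow t H 0 - H 0 with he
  have hflow : ∀ t, 0 < t → flow t H = H + fun _ => e t := by
    intro t ht
    ext x
    have := hconst t ht x
    simp only [Pi.add_apply, he]
    rw [← this]; ring
  -- By the semigroup law the constant `e t` is additive in `t`. It is bounded by `K`, so it must
  -- vanish.
  have hadd : ∀ s t, 0 < s → 0 < t → e (s + t) = e s + e t := by
    intro s t hs ht
    have h1 : flow (s + t) H = H + (fun _ => e s) + fun _ => e t := by
      rw [← flow_flow hHT hs ht, hflow t ht, flow_add hHT (tempered_const _) hs, hflow s hs,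
        flow_const hs]
    have h2 := congrFun h1 0
    simp only [Pi.add_apply] at h2
    simp only [he] at h2 ⊢
    rw [h2]; ring
  have hmul : ∀ t, 0 < t → ∀ n : ℕ, e (((n : ℝ) + 1) * t) = ((n : ℂ) + 1) * e t := by
    intro t ht n
    induction n with
    | zero => simp
    | succ n ih =>
      push_cast
      rw [add_mul (_ + 1 : ℝ), one_mul, hadd _ _ (by positivity) ht, ih]; ring
  have hzero : ∀ t, 0 < t → e t = 0 := by
    intro t ht
    have h1 : ∀ n : ℕ, ((n : ℝ) + 1) * ‖e t‖ ≤ K := by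
      intro n
      have h2 := hbound (((n : ℝ) + 1) * t) (by positivity) 0
      change ‖e _‖ ≤ K at h2
      rw [hmul t ht n, norm_mul] at h2
      have : ‖(n : ℂ) + 1‖ = (n : ℝ) + 1 := by
        rw [← Nat.cast_one, ← Nat.cast_add, Complex.norm_natCast]; push_cast; rfl
      rwa [this] at h2
    by_contra hne
    have hpos : 0 < ‖e t‖ := norm_pos_iff.2 hne
    obtain ⟨n, hn⟩ := exists_nat_gt (K / ‖e t‖)
    rw [div_lt_iff₀ hpos] at hn
    nlinarith [h1 n]
  refine ⟨H, hHm, hHb, fun t ht => ?_, hH, hHL⟩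
  rw [hflow t ht, hzero t ht]
  ext x; simp

variable (E) in
/-- A tempered function whose distance to its heat flow is controlled in the mean at every scale
is the sum of a caloric function and a function of bounded mean oscillation. -/
theorem exists_caloric_part : ∃ C : ℝ≥0, ∀ (F : E → ℂ) (N : ℝ≥0), Tempered F →
    (∀ᵐ y, ∀ r, 0 < r → ∫⁻ x in Metric.ball y r, ‖F x - flow (r ^ 2) F x‖ₑ ≤
      N * volume (Metric.ball y r)) →
    ∃ H : E → ℂ, StronglyMeasurable H ∧ (∃ C : ℝ, ∃ m : ℕ, ∀ x, ‖H x‖ ≤ C * (1 + ‖x‖) ^ m) ∧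
      (∀ t, 0 < t → flow t H = H) ∧
      (∀ x, Tendsto (fun k : ℕ => flow ((k : ℝ) + 1) F x - flow ((k : ℝ) + 1) F 0) atTop
        (𝓝 (H x))) ∧ HasOsc (F - H) ((C * N : ℝ≥0) : ℝ≥0∞) := by
  obtain ⟨C₁, hC₁⟩ := exists_lintegral_poly_mul_le_of_average E
  obtain ⟨C₂, hC₂⟩ := exists_norm_flow_le E
  -- The first summand is the volume ratio between balls of radii `2 ρ` and `ρ`. The second comes
  -- from the Lipschitz bound `4 K / (2 ρ)` over a distance below `2 ρ`.
  refine ⟨2 ^ Module.finrank ℝ E + 4 * (C₂ * C₁), fun F N hF h => ?_⟩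
  set K : ℝ≥0 := C₂ * (C₁ * N) with hKdef
  have key : ∀ r R : ℝ, 0 < r → r ≤ R →
      (∀ x, ‖flow (R ^ 2) (F - flow (r ^ 2) F) x‖ ≤ K) ∧
      ∀ x x', ‖flow (R ^ 2) (F - flow (r ^ 2) F) x - flow (R ^ 2) (F - flow (r ^ 2) F) x'‖ ≤
        K * (‖x - x'‖ / R) := by
    intro r R hr hrR
    have hT := hF.sub (hF.flow (pow_pos hr 2))
    have h1 := hC₁ r R hr hrR (fun y => ‖(F - flow (r ^ 2) F) y‖ₑ) N
      hT.aestronglyMeasurable.enorm (h.mono fun z hz => hz r hr)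
    exact_mod_cast hC₂ R (hr.trans_le hrR) (F - flow (r ^ 2) F) (C₁ * N) hT.aestronglyMeasurable
      (by exact_mod_cast h1)
  obtain ⟨hb, hL⟩ := norm_flow_sub_flow_le hF K.2 key
  obtain ⟨H, hHm, hHb, hHflow, hHlim, hHL⟩ := exists_flow_limit hF K.2 hb hL
  refine ⟨H, hHm, hHb, hHflow, hHlim, fun x ρ hρ => ?_⟩
  -- The hypothesis holds for almost every centre only, so a good centre `c` within `ρ` of `x` and
  -- the doubled radius are used.
  obtain ⟨c, hc, hcx⟩ := (Measure.dense_of_ae h).exists_dist_lt x hρ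
  have hR : (0 : ℝ) < 2 * ρ := by linarith
  have hsub : Metric.ball x ρ ⊆ Metric.ball c (2 * ρ) := by
    refine Metric.ball_subset_ball' ?_
    linarith
  refine ⟨flow ((2 * ρ) ^ 2) F c - H c, ?_⟩
  have hvol : volume (Metric.ball c (2 * ρ)) =
      (2 ^ Module.finrank ℝ E : ℝ≥0) * volume (Metric.ball x ρ) := by
    rw [volume_ball_eq c hR, volume_ball_eq x hρ, mul_pow, ENNReal.ofReal_mul (by positivity),
      mul_assoc]
    congr 1
    rw [ENNReal.ofReal_pow (by norm_num)]
    simp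
  calc ∫⁻ y in Metric.ball x ρ, ‖(F - H) y - (flow ((2 * ρ) ^ 2) F c - H c)‖ₑ
      ≤ ∫⁻ y in Metric.ball x ρ, (‖F y - flow ((2 * ρ) ^ 2) F y‖ₑ + (4 * K : ℝ≥0)) := by
        refine setLIntegral_mono' measurableSet_ball fun y hy => ?_
        have e : (F - H) y - (flow ((2 * ρ) ^ 2) F c - H c) = (F y - flow ((2 * ρ) ^ 2) F y) +
            ((flow ((2 * ρ) ^ 2) F y - H y) - (flow ((2 * ρ) ^ 2) F c - H c)) := by
          simp only [Pi.sub_apply]; ring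
        rw [e]
        refine (enorm_add_le _ _).trans (add_le_add le_rfl ?_)
        have h1 := hHL ((2 * ρ) ^ 2) (by positivity) y c
        rw [Real.sqrt_sq hR.le] at h1
        have h2 : ‖y - c‖ / (2 * ρ) ≤ 1 := by
          rw [div_le_one hR, ← dist_eq_norm]
          exact (Metric.mem_ball.1 (hsub hy)).le
        have h3 : ‖(flow ((2 * ρ) ^ 2) F y - H y) - (flow ((2 * ρ) ^ 2) F c - H c)‖ ≤
            ((4 * K : ℝ≥0) : ℝ) := by
          refine h1.trans ?_
          push_cast
          exact mul_le_of_le_one_right (mul_nonneg (by norm_num) (NNReal.coe_nonneg _)) h2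
        rw [← ofReal_norm]
        exact ENNReal.ofReal_le_of_le_toReal (by simpa using h3)
    _ = (∫⁻ y in Metric.ball x ρ, ‖F y - flow ((2 * ρ) ^ 2) F y‖ₑ) +
          (4 * K : ℝ≥0) * volume (Metric.ball x ρ) := by
        rw [lintegral_add_right _ measurable_const, setLIntegral_const]
    _ ≤ N * volume (Metric.ball c (2 * ρ)) + (4 * K : ℝ≥0) * volume (Metric.ball x ρ) := by
        gcongr
        exact (lintegral_mono_set hsub).trans (hc _ hR)
    _ = _ := by
        rw [hvol, hKdef]
        push_cast
        ring

end CaloricPart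

/-! ### A square-mean John–Nirenberg inequality -/

section JohnNirenberg

variable {E : Type*} [NormedAddCommGroup E] [InnerProductSpace ℝ E]
  [MeasurableSpace E] [BorelSpace E] [FiniteDimensional ℝ E]

/-- The triangle inequality `‖a - b‖ ≤ ‖φ - a‖ + ‖φ - b‖` averaged over `S`. It compares the
constants attached to different balls. -/
lemma enorm_sub_le_of_mean_le {α G : Type*} [MeasurableSpace α] {μ : Measure α}
    [NormedAddCommGroup G] {φ : α → G} (hφ : AEStronglyMeasurable φ μ) {S : Set α}
    (hS : μ S ≠ 0) (hS' : μ S ≠ ⊤) {a b : G} {A B : ℝ≥0∞}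
    (ha : ∫⁻ y in S, ‖φ y - a‖ₑ ∂μ ≤ A * μ S) (hb : ∫⁻ y in S, ‖φ y - b‖ₑ ∂μ ≤ B * μ S) :
    ‖a - b‖ₑ ≤ A + B := by
  have h1 : ‖a - b‖ₑ * μ S ≤ (A + B) * μ S := by
    calc ‖a - b‖ₑ * μ S = ∫⁻ _ in S, ‖a - b‖ₑ ∂μ := by rw [setLIntegral_const]
      _ ≤ ∫⁻ y in S, (‖φ y - a‖ₑ + ‖φ y - b‖ₑ) ∂μ := by
        refine lintegral_mono fun y => ?_
        have : a - b = (φ y - b) - (φ y - a) := by abel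
        rw [this, add_comm]
        exact enorm_sub_le
      _ = (∫⁻ y in S, ‖φ y - a‖ₑ ∂μ) + ∫⁻ y in S, ‖φ y - b‖ₑ ∂μ := by
        refine lintegral_add_right' _ ?_
        exact (hφ.sub aestronglyMeasurable_const).enorm.restrict
      _ ≤ _ := by rw [add_mul]; gcongr
  exact (ENNReal.mul_le_mul_iff_left hS hS').1 h1

lemma ennreal_add_sq_le (p q : ℝ≥0∞) : (p + q) ^ 2 ≤ 2 * p ^ 2 + 2 * q ^ 2 := by
  have h : 2 * (p * q) ≤ p ^ 2 + q ^ 2 := by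
    wlog hpq : p ≤ q generalizing p q
    · rw [mul_comm p q, add_comm]; exact this q p (le_of_not_ge hpq)
    obtain ⟨c, rfl⟩ := exists_add_of_le hpq
    calc 2 * (p * (p + c)) ≤ 2 * (p * (p + c)) + c ^ 2 := le_self_add
      _ = _ := by ring
  calc (p + q) ^ 2 = p ^ 2 + q ^ 2 + 2 * (p * q) := by ring
    _ ≤ p ^ 2 + q ^ 2 + (p ^ 2 + q ^ 2) := by gcongr
    _ = _ := by ring

lemma volume_closedBall_mul (x y : E) {k : ℝ≥0} {r : ℝ} (hr : 0 ≤ r) :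
    volume (Metric.closedBall x (k * r)) =
      (k : ℝ≥0∞) ^ Module.finrank ℝ E * volume (Metric.closedBall y r) := by
  rw [Measure.addHaar_closedBall _ _ (by positivity), Measure.addHaar_closedBall _ _ hr, mul_pow,
    ENNReal.ofReal_mul (by positivity), mul_assoc, ENNReal.ofReal_pow (by positivity)]
  simp

lemma volume_closedBall_ne_zero (x : E) {r : ℝ} (hr : 0 < r) :
    volume (Metric.closedBall x r) ≠ 0 := (Metric.measure_closedBall_pos _ _ hr).ne'

lemma volume_closedBall_ne_top (x : E) (r : ℝ) :
    volume (Metric.closedBall x r) ≠ ⊤ := measure_closedBall_lt_top.ne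

/-- The self-improving estimate behind the John–Nirenberg inequality. -/
lemma sq_osc_step {φ : E → ℝ} (hφ : AEStronglyMeasurable φ) {a : E → ℝ → ℝ} {B Λ : ℝ≥0}
    (hB0 : 0 < B) (hΛ : 20 ^ Module.finrank ℝ E ≤ Λ)
    (hB : ∀ x r, 0 < r → ∫⁻ y in Metric.closedBall x r, ‖φ y - a x r‖ₑ ≤
      B * volume (Metric.closedBall x r)) {X : ℝ≥0∞}
    (hX : ∀ x r, 0 < r → ∫⁻ y in Metric.closedBall x r, ‖φ y - a x (2 * r)‖ₑ ^ 2 ≤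
      X * volume (Metric.closedBall x r)) (x₀ : E) (r₀ : ℝ) (hr₀ : 0 < r₀) :
    Λ * ∫⁻ y in Metric.closedBall x₀ r₀, ‖φ y - a x₀ (2 * r₀)‖ₑ ^ 2 ≤
      (Λ * ((Λ * B : ℝ≥0) : ℝ≥0∞) ^ 2 + 10 ^ Module.finrank ℝ E *
        (2 * X + 2 * (B + (Λ * B : ℝ≥0)) ^ 2)) * volume (Metric.closedBall x₀ r₀) := by
  set D := Module.finrank ℝ E with hD
  -- The constant belongs to the doubled ball, because balls centred in the ball of radius `r₀` with
  -- radius at most `r₀` stick out of it but stay inside the double.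
  set a₀ := a x₀ (2 * r₀) with ha₀
  set g : E → ℝ≥0∞ := fun y => ‖φ y - a₀‖ₑ with hg
  set lam : ℝ≥0 := Λ * B with hlam
  have hgm : AEMeasurable g := (hφ.sub aestronglyMeasurable_const).enorm
  have hgB : ∫⁻ y in Metric.closedBall x₀ (2 * r₀), g y ≤
      B * (2 ^ D * volume (Metric.closedBall x₀ r₀)) := by
    have := hB x₀ (2 * r₀) (by linarith)
    rwa [show (2 : ℝ) * r₀ = ((2 : ℝ≥0) : ℝ) * r₀ by simp, volume_closedBall_mul x₀ x₀ hr₀.le] at this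
  -- The bad radii at `x`: those for which the mean of `g` exceeds the level `lam`. A
  -- Calderón–Zygmund argument with Vitali balls in place of dyadic cubes follows.
  set S : E → Set ℝ := fun x => {ρ | 0 < ρ ∧ ρ ≤ r₀ ∧
    lam * volume (Metric.closedBall x ρ) < ∫⁻ y in Metric.closedBall x ρ, g y} with hS
  have hsub : ∀ x ∈ Metric.closedBall x₀ r₀, ∀ ρ ≤ r₀,
      Metric.closedBall x ρ ⊆ Metric.closedBall x₀ (2 * r₀) := by
    intro x hx ρ hρ
    refine Metric.closedBall_subset_closedBall' ?_
    have := Metric.mem_closedBall.1 hx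
    linarith
  -- Comparison with the doubled ball loses the volume factor `20 ^ D = (2 · 10) ^ D`, which is why
  -- `Λ` is taken at least that large. Bad radii are therefore below `r₀ / 10`, so that tenfold
  -- enlargements stay admissible.
  have big : ∀ x ∈ Metric.closedBall x₀ r₀, ∀ ρ, r₀ / 10 ≤ ρ → ρ ≤ r₀ → ρ ∉ S x := by
    intro x hx ρ h1 h2 h3
    refine absurd h3.2.2 (not_lt.2 ?_)
    calc ∫⁻ y in Metric.closedBall x ρ, g y ≤ ∫⁻ y in Metric.closedBall x₀ (2 * r₀), g y :=
          lintegral_mono_set (hsub x hx ρ h2)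
      _ ≤ B * (2 ^ D * volume (Metric.closedBall x₀ r₀)) := hgB
      _ ≤ B * (2 ^ D * volume (Metric.closedBall x ((10 : ℝ≥0) * ρ))) := by
          rw [Measure.addHaar_closedBall_center volume x₀ r₀,
            Measure.addHaar_closedBall_center volume x (((10 : ℝ≥0) : ℝ) * ρ)]
          gcongr
          push_cast; linarith
      _ = B * 20 ^ D * volume (Metric.closedBall x ρ) := by
          rw [volume_closedBall_mul x x (by linarith : (0 : ℝ) ≤ ρ)]
          have : (20 : ℝ≥0∞) ^ D = 2 ^ D * ((10 : ℝ≥0) : ℝ≥0∞) ^ D := by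
            rw [← mul_pow]; norm_num
          rw [this]; ring
      _ ≤ _ := by
          gcongr
          rw [hlam, mul_comm]
          exact_mod_cast mul_le_mul_left hΛ B
  -- A bad radius larger than half the supremum: every admissible radius at least twice as large is
  -- good.
  have hex : ∀ x, x ∈ Metric.closedBall x₀ r₀ ∧ (S x).Nonempty → ∃ ρ, ρ ∈ S x ∧ ρ < r₀ / 10 ∧
      ∀ ρ', 2 * ρ ≤ ρ' → ρ' ≤ r₀ → ρ' ∉ S x := by
    rintro x ⟨hx, hne⟩
    have hbdd : BddAbove (S x) := ⟨r₀, fun ρ hρ => hρ.2.1⟩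
    obtain ⟨ρ₁, hρ₁⟩ := id hne
    have hpos : 0 < sSup (S x) := hρ₁.1.trans_le (le_csSup hbdd hρ₁)
    obtain ⟨ρ, hρ, hlt⟩ := exists_lt_of_lt_csSup hne (half_lt_self hpos)
    refine ⟨ρ, hρ, ?_, fun ρ' h1 h2 h3 => ?_⟩
    · by_contra h
      exact big x hx ρ (not_lt.1 h) hρ.2.1 hρ
    · have := le_csSup hbdd h3
      linarith
  choose! ρ hρS hρsmall hρbig using hex
  set t : Set E := {x | x ∈ Metric.closedBall x₀ r₀ ∧ (S x).Nonempty} with ht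
  -- Vitali covering: disjoint bad balls whose fivefold enlargements cover all points having a bad
  -- radius.
  obtain ⟨u, hut, hudisj, hucov⟩ :=
    Vitali.exists_disjoint_subfamily_covering_enlargement_closedBall t id ρ r₀
      (fun x hx => (hρS x hx).2.1) 5 (by norm_num)
  simp only [id] at hudisj hucov
  have hucount : u.Countable := by
    refine hudisj.countable_of_nonempty_interior fun x hx => ?_
    exact ⟨x, Metric.ball_subset_interior_closedBall (Metric.mem_ball_self (hρS x (hut hx)).1)⟩
  -- A point without bad radii has all small-ball means at most `lam`, so Lebesgue differentiation
  -- bounds `g` there.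
  have good : ∀ᵐ y, y ∈ Metric.closedBall x₀ r₀ → ¬ (S y).Nonempty → g y ≤ lam := by
    have hm : AEMeasurable ((Metric.closedBall x₀ (2 * r₀)).indicator g) :=
      hgm.indicator measurableSet_closedBall
    have hfin : ∫⁻ y, (Metric.closedBall x₀ (2 * r₀)).indicator g y ≠ ⊤ := by
      rw [lintegral_indicator measurableSet_closedBall]
      refine (hgB.trans_lt ?_).ne
      exact ENNReal.mul_lt_top ENNReal.coe_lt_top (ENNReal.mul_lt_top (by simp)
        measure_closedBall_lt_top)
    filter_upwards [(Besicovitch.vitaliFamily (volume : Measure E)).ae_tendsto_lintegral_div hm hfin]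
      with y hy hy1 hy2
    have h1 := hy.comp (Besicovitch.tendsto_filterAt volume y)
    rw [Set.indicator_of_mem (Metric.closedBall_subset_closedBall (by linarith) hy1)] at h1
    refine le_of_tendsto h1 ?_
    filter_upwards [Ioc_mem_nhdsGT hr₀] with ρ' hρ'
    simp only [Function.comp]
    have h2 : ρ' ∉ S y := fun h => hy2 ⟨ρ', h⟩
    have h3 : ∫⁻ y in Metric.closedBall y ρ', g y ≤ lam * volume (Metric.closedBall y ρ') := by
      by_contra h; exact h2 ⟨hρ'.1, hρ'.2, not_le.1 h⟩
    rw [setLIntegral_indicator measurableSet_closedBall,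
      Set.inter_eq_right.2 (hsub y hy1 ρ' hρ'.2)]
    exact ENNReal.div_le_of_le_mul h3
  set U : Set E := ⋃ b ∈ u, Metric.closedBall b (5 * ρ b) with hU
  have hUm : MeasurableSet U := .biUnion hucount fun _ _ => measurableSet_closedBall
  have hcover : ∀ y ∈ Metric.closedBall x₀ r₀, (S y).Nonempty → y ∈ U := by
    intro y hy1 hy2
    obtain ⟨b, hb, hyb⟩ := hucov y ⟨hy1, hy2⟩
    exact Set.mem_biUnion hb (hyb (Metric.mem_closedBall_self (hρS y ⟨hy1, hy2⟩).1.le))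
  have int1 : ∫⁻ y in Metric.closedBall x₀ r₀, g y ^ 2 ≤
      (lam : ℝ≥0∞) ^ 2 * volume (Metric.closedBall x₀ r₀) + ∫⁻ y in U, g y ^ 2 := by
    calc _ ≤ ∫⁻ y in Metric.closedBall x₀ r₀, ((lam : ℝ≥0∞) ^ 2 + U.indicator (fun y => g y ^ 2) y) := by
          refine lintegral_mono_ae ?_
          filter_upwards [ae_restrict_of_ae good, ae_restrict_mem measurableSet_closedBall]
            with y hy1 hy2
          by_cases h : (S y).Nonempty
          · rw [Set.indicator_of_mem (hcover y hy2 h)]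
            exact le_add_self
          · exact le_add_right (by gcongr; exact hy1 hy2 h)
      _ = _ := by rw [lintegral_add_left measurable_const, setLIntegral_const]
      _ ≤ _ := by
          refine add_le_add le_rfl ?_
          rw [← lintegral_indicator hUm]
          exact setLIntegral_le_lintegral _ _
  have piece : ∀ b ∈ u, ∫⁻ y in Metric.closedBall b (5 * ρ b), g y ^ 2 ≤
      (2 * X + 2 * (B + (lam : ℝ≥0∞)) ^ 2) * (5 ^ D * volume (Metric.closedBall b (ρ b))) := by
    intro b hb
    have hbt := hut hb
    have hρb := (hρS b hbt).1
    have h10 : 0 < 2 * (5 * ρ b) := by linarith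
    -- The radius `10 ρ` is good by near-maximality of `ρ`, so on that ball `φ` is close in mean
    -- both to its own constant and to `a₀`.
    have hconst : ‖a b (2 * (5 * ρ b)) - a₀‖ₑ ≤ B + lam := by
      refine enorm_sub_le_of_mean_le hφ (volume_closedBall_ne_zero b h10)
        (volume_closedBall_ne_top _ _) (hB b _ h10) ?_
      by_contra h
      exact hρbig b hbt (2 * (5 * ρ b)) (by linarith) (by linarith [hρsmall b hbt])
        ⟨h10, by linarith [hρsmall b hbt], not_le.1 h⟩
    calc _ ≤ ∫⁻ y in Metric.closedBall b (5 * ρ b),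
          (2 * ‖φ y - a b (2 * (5 * ρ b))‖ₑ ^ 2 + 2 * (B + (lam : ℝ≥0∞)) ^ 2) := by
          refine lintegral_mono fun y => ?_
          have h1 : g y ≤ ‖φ y - a b (2 * (5 * ρ b))‖ₑ + ‖a b (2 * (5 * ρ b)) - a₀‖ₑ := by
            have : φ y - a₀ = (φ y - a b (2 * (5 * ρ b))) + (a b (2 * (5 * ρ b)) - a₀) := by ring
            simp only [hg]; rw [this]; exact enorm_add_le _ _
          calc g y ^ 2 ≤ _ := by gcongr
            _ ≤ _ := ennreal_add_sq_le _ _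
            _ ≤ _ := by gcongr
      _ = 2 * (∫⁻ y in Metric.closedBall b (5 * ρ b), ‖φ y - a b (2 * (5 * ρ b))‖ₑ ^ 2) +
          2 * (B + (lam : ℝ≥0∞)) ^ 2 * volume (Metric.closedBall b (5 * ρ b)) := by
          rw [lintegral_add_right _ measurable_const, setLIntegral_const,
            lintegral_const_mul' _ _ (by norm_num)]
      _ ≤ 2 * (X * volume (Metric.closedBall b (5 * ρ b))) +
          2 * (B + (lam : ℝ≥0∞)) ^ 2 * volume (Metric.closedBall b (5 * ρ b)) := by
          gcongr
          exact hX b _ (by linarith)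
      _ = _ := by
          rw [show (5 : ℝ) * ρ b = ((5 : ℝ≥0) : ℝ) * ρ b by simp, volume_closedBall_mul b b hρb.le]
          push_cast
          ring
  -- On the disjoint bad balls the mean of `g` exceeds `lam = Λ B`, while the integral of `g` over
  -- the doubled ball is at most `B` times a volume. Dividing by `B > 0` bounds the total volume of
  -- bad balls by a multiple of `1 / Λ`.
  have sumvol : (Λ : ℝ≥0∞) * ∑' b : u, volume (Metric.closedBall (b : E) (ρ b)) ≤
      2 ^ D * volume (Metric.closedBall x₀ r₀) := by
    have h1 : (B : ℝ≥0∞) * (Λ * ∑' b : u, volume (Metric.closedBall (b : E) (ρ b))) ≤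
        B * (2 ^ D * volume (Metric.closedBall x₀ r₀)) := by
      calc _ = ∑' b : u, (lam : ℝ≥0∞) * volume (Metric.closedBall (b : E) (ρ b)) := by
            rw [ENNReal.tsum_mul_left, hlam]; push_cast; ring
        _ ≤ ∑' b : u, ∫⁻ y in Metric.closedBall (b : E) (ρ b), g y :=
            ENNReal.tsum_le_tsum fun b => (hρS b (hut b.2)).2.2.le
        _ = ∫⁻ y in ⋃ b ∈ u, Metric.closedBall b (ρ b), g y :=
            (lintegral_biUnion hucount (fun _ _ => measurableSet_closedBall) hudisj _).symm
        _ ≤ ∫⁻ y in Metric.closedBall x₀ (2 * r₀), g y := by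
            refine lintegral_mono_set (Set.iUnion₂_subset fun b hb => ?_)
            exact hsub b (hut hb).1 _ (hρS b (hut hb)).2.1
        _ ≤ _ := hgB
    exact (ENNReal.mul_le_mul_iff_right (by exact_mod_cast hB0.ne') ENNReal.coe_ne_top).1 h1
  have int2 : (Λ : ℝ≥0∞) * ∫⁻ y in U, g y ^ 2 ≤
      10 ^ D * (2 * X + 2 * (B + (lam : ℝ≥0∞)) ^ 2) * volume (Metric.closedBall x₀ r₀) := by
    have : Countable u := hucount.to_subtype
    calc _ ≤ (Λ : ℝ≥0∞) * ∑' b : u, ∫⁻ y in Metric.closedBall (b : E) (5 * ρ b), g y ^ 2 := by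
          gcongr
          rw [hU, Set.biUnion_eq_iUnion]
          exact lintegral_iUnion_le _ _
      _ ≤ (Λ : ℝ≥0∞) * ∑' b : u, (2 * X + 2 * (B + (lam : ℝ≥0∞)) ^ 2) *
            (5 ^ D * volume (Metric.closedBall (b : E) (ρ b))) := by
          gcongr with b
          exact piece b b.2
      _ = (2 * X + 2 * (B + (lam : ℝ≥0∞)) ^ 2) * 5 ^ D *
            (Λ * ∑' b : u, volume (Metric.closedBall (b : E) (ρ b))) := by
          rw [ENNReal.tsum_mul_left, ENNReal.tsum_mul_left]; ring
      _ ≤ (2 * X + 2 * (B + (lam : ℝ≥0∞)) ^ 2) * 5 ^ D *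
            (2 ^ D * volume (Metric.closedBall x₀ r₀)) := by gcongr
      _ = _ := by
          have : (10 : ℝ≥0∞) ^ D = 5 ^ D * 2 ^ D := by rw [← mul_pow]; norm_num
          rw [this]; ring
  calc _ ≤ (Λ : ℝ≥0∞) * ((lam : ℝ≥0∞) ^ 2 * volume (Metric.closedBall x₀ r₀) +
        ∫⁻ y in U, g y ^ 2) := by gcongr
    _ = Λ * (lam : ℝ≥0∞) ^ 2 * volume (Metric.closedBall x₀ r₀) +
        Λ * ∫⁻ y in U, g y ^ 2 := by ring
    _ ≤ _ := by
        rw [add_mul]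
        gcongr

/-- Boundedness makes the supremum of the square oscillations finite, so the term containing it in
`sq_osc_step` can be absorbed on the left when `Λ` is large. The resulting constant does not depend
on the bound `M`, which allows truncation later. -/
lemma sq_osc_of_bounded (E : Type*) [NormedAddCommGroup E] [InnerProductSpace ℝ E]
    [MeasurableSpace E] [BorelSpace E] [FiniteDimensional ℝ E] :
    ∃ C : ℝ≥0, ∀ (φ : E → ℝ) (a : E → ℝ → ℝ) (B M : ℝ≥0), AEStronglyMeasurable φ → 0 < B →
      (∀ x, ‖φ x‖ ≤ M) → (∀ x r, ‖a x r‖ ≤ M) →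
      (∀ x r, 0 < r → ∫⁻ y in Metric.closedBall x r, ‖φ y - a x r‖ₑ ≤
        B * volume (Metric.closedBall x r)) →
      ∀ x r, 0 < r → ∫⁻ y in Metric.closedBall x r, ‖φ y - a x (2 * r)‖ₑ ^ 2 ≤
        (C * B ^ 2 : ℝ≥0) * volume (Metric.closedBall x r) := by
  set Λ : ℝ≥0 := 4 * 20 ^ Module.finrank ℝ E with hΛdef
  have hp : (1 : ℝ≥0) ≤ 20 ^ Module.finrank ℝ E := one_le_pow₀ (by norm_num)
  have hΛ : 20 ^ Module.finrank ℝ E ≤ Λ := le_mul_of_one_le_left zero_le (by norm_num)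
  have hΛ2 : 4 * 10 ^ Module.finrank ℝ E ≤ Λ := by
    rw [hΛdef]; gcongr; norm_num
  refine ⟨2 * Λ ^ 2 + (1 + Λ) ^ 2, fun φ a B M hφ hB0 hφM haM hB => ?_⟩
  obtain ⟨s, hs⟩ : ∃ s : ℝ≥0∞, s = ⨆ (x : E) (r : ℝ) (_ : 0 < r),
    (∫⁻ y in Metric.closedBall x r, ‖φ y - a x (2 * r)‖ₑ ^ 2) /
      volume (Metric.closedBall x r) := ⟨_, rfl⟩
  have hX : ∀ x r, 0 < r → ∫⁻ y in Metric.closedBall x r, ‖φ y - a x (2 * r)‖ₑ ^ 2 ≤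
      s * volume (Metric.closedBall x r) := by
    intro x r hr
    rw [← ENNReal.div_le_iff (volume_closedBall_ne_zero x hr) (volume_closedBall_ne_top x r), hs]
    exact le_iSup_of_le x (le_iSup_of_le r (le_iSup_of_le hr le_rfl))
  have hsM : s ≤ ((2 * M) ^ 2 : ℝ≥0) := by
    rw [hs]
    refine iSup_le fun x => iSup_le fun r => iSup_le fun hr => ?_
    refine ENNReal.div_le_of_le_mul ?_
    rw [← setLIntegral_const]
    refine lintegral_mono fun y => ?_
    rw [ENNReal.coe_pow]
    gcongr
    rw [← ofReal_norm]
    refine ENNReal.ofReal_le_of_le_toReal ?_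
    simp only [ENNReal.coe_toReal]
    push_cast
    exact (norm_sub_le _ _).trans (by linarith [hφM y, haM x (2 * r)])
  have hsfin : s ≠ ⊤ := (hsM.trans_lt ENNReal.coe_lt_top).ne
  have hstep : Λ * s ≤ (Λ * ((Λ * B : ℝ≥0) : ℝ≥0∞) ^ 2 + 10 ^ Module.finrank ℝ E *
      (2 * s + 2 * (B + (Λ * B : ℝ≥0)) ^ 2)) := by
    have st := sq_osc_step hφ hB0 hΛ hB hX
    generalize (Λ * ((Λ * B : ℝ≥0) : ℝ≥0∞) ^ 2 + 10 ^ Module.finrank ℝ E *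
      (2 * s + 2 * (B + (Λ * B : ℝ≥0)) ^ 2)) = Y at st ⊢
    rw [hs]
    simp_rw [ENNReal.mul_iSup]
    refine iSup_le fun x => iSup_le fun r => iSup_le fun hr => ?_
    rw [← mul_div_assoc]
    exact ENNReal.div_le_of_le_mul (st x r hr)
  clear hs
  have hfinal : s ≤ ((2 * Λ ^ 2 + (1 + Λ) ^ 2) * B ^ 2 : ℝ≥0) := by
    lift s to ℝ≥0 using hsfin
    norm_cast at hstep ⊢
    have hΛpos : 0 < Λ := lt_of_lt_of_le (by positivity) hΛ
    -- With `10 ^ D ≤ Λ / 4`, the coefficient of `s` on the right is `Λ / 2`, half of that on the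
    -- left.
    have h1 : Λ * s ≤ Λ * (Λ * B) ^ 2 + Λ / 4 * (2 * s + 2 * (B + Λ * B) ^ 2) := by
      refine hstep.trans ?_
      gcongr
      rw [le_div_iff₀ (by norm_num)]
      linarith
    rw [← NNReal.coe_le_coe] at h1 ⊢
    push_cast at h1 ⊢
    have hΛr : (0 : ℝ) < Λ := by exact_mod_cast hΛpos
    have h2 : (Λ : ℝ) * s ≤ Λ * (((2 * Λ ^ 2 + (1 + Λ) ^ 2) * B ^ 2)) := by linarith
    exact le_of_mul_le_mul_left h2 hΛr
  exact fun x r hr => (hX x r hr).trans (by gcongr)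

lemma abs_min_sub_min_le (p q M : ℝ) : |min p M - min q M| ≤ |p - q| := by
  simpa using abs_min_sub_min_le_max p M q M

/-- The square-integrable form of the John–Nirenberg inequality. -/
lemma exists_sq_mean_le (E : Type*) [NormedAddCommGroup E] [InnerProductSpace ℝ E]
    [MeasurableSpace E] [BorelSpace E] [FiniteDimensional ℝ E] :
    ∃ C : ℝ≥0, ∀ (F : E → ℂ) (a : E → ℝ → ℂ) (B : ℝ≥0), AEStronglyMeasurable F → 0 < B →
      (∀ x r, 0 < r → ∫⁻ y in Metric.closedBall x r, ‖F y - a x r‖ₑ ≤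
        B * volume (Metric.closedBall x r)) →
      ∀ x r, 0 < r → ∫⁻ y in Metric.closedBall x r, ‖F y‖ₑ ^ 2 ≤
        ((C * B ^ 2 : ℝ≥0) + 2 * ‖a x (2 * r)‖ₑ ^ 2) * volume (Metric.closedBall x r) := by
  obtain ⟨C, hC⟩ := sq_osc_of_bounded E
  refine ⟨2 * C, fun F a B hF hB0 hB x r hr => ?_⟩
  -- Truncation of `‖F‖` at height `n` is 1-Lipschitz in `F`, so the truncated function with
  -- truncated constants has the same oscillation bound `B`. Monotone convergence then removes `n`.
  have trunc : ∀ n : ℕ, ∫⁻ y in Metric.closedBall x r,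
      ‖min ‖F y‖ (n : ℝ) - min ‖a x (2 * r)‖ (n : ℝ)‖ₑ ^ 2 ≤
        (C * B ^ 2 : ℝ≥0) * volume (Metric.closedBall x r) := by
    intro n
    have hb : ∀ z : ℂ, ‖min ‖z‖ (n : ℝ)‖ ≤ (n : ℝ≥0) := by
      intro z
      rw [Real.norm_of_nonneg (le_min (norm_nonneg _) n.cast_nonneg)]
      simp
    refine hC (fun y => min ‖F y‖ (n : ℝ)) (fun x r => min ‖a x r‖ (n : ℝ)) B n
      (hF.norm.inf aestronglyMeasurable_const) hB0 (fun y => hb _) (fun x r => hb _)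
      (fun x r hr => ?_) x r hr
    refine (lintegral_mono fun y => ?_).trans (hB x r hr)
    rw [← ofReal_norm, ← ofReal_norm]
    refine ENNReal.ofReal_le_ofReal ?_
    rw [Real.norm_eq_abs]
    exact (abs_min_sub_min_le _ _ _).trans (abs_norm_sub_norm_le _ _)
  have bound : ∀ n : ℕ, ∫⁻ y in Metric.closedBall x r, ‖min ‖F y‖ (n : ℝ)‖ₑ ^ 2 ≤
      ((2 * C * B ^ 2 : ℝ≥0) + 2 * ‖a x (2 * r)‖ₑ ^ 2) * volume (Metric.closedBall x r) := by
    intro n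
    set c : ℝ := min ‖a x (2 * r)‖ (n : ℝ) with hc
    have hca : ‖c‖ₑ ≤ ‖a x (2 * r)‖ₑ := by
      rw [← ofReal_norm, ← ofReal_norm]
      refine ENNReal.ofReal_le_ofReal ?_
      rw [Real.norm_of_nonneg (le_min (norm_nonneg _) n.cast_nonneg)]
      exact min_le_left _ _
    calc _ ≤ ∫⁻ y in Metric.closedBall x r,
          (2 * ‖min ‖F y‖ (n : ℝ) - c‖ₑ ^ 2 + 2 * ‖a x (2 * r)‖ₑ ^ 2) := by
          refine lintegral_mono fun y => ?_
          calc ‖min ‖F y‖ (n : ℝ)‖ₑ ^ 2 = ‖(min ‖F y‖ (n : ℝ) - c) + c‖ₑ ^ 2 := by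
                rw [sub_add_cancel]
            _ ≤ (‖min ‖F y‖ (n : ℝ) - c‖ₑ + ‖a x (2 * r)‖ₑ) ^ 2 := by
                gcongr
                exact (enorm_add_le _ _).trans (by gcongr)
            _ ≤ _ := ennreal_add_sq_le _ _
      _ = 2 * (∫⁻ y in Metric.closedBall x r, ‖min ‖F y‖ (n : ℝ) - c‖ₑ ^ 2) +
          2 * ‖a x (2 * r)‖ₑ ^ 2 * volume (Metric.closedBall x r) := by
          rw [lintegral_add_right _ measurable_const, setLIntegral_const,
            lintegral_const_mul' _ _ (by norm_num)]
      _ ≤ 2 * ((C * B ^ 2 : ℝ≥0) * volume (Metric.closedBall x r)) +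
          2 * ‖a x (2 * r)‖ₑ ^ 2 * volume (Metric.closedBall x r) := by
          gcongr
          exact trunc n
      _ = _ := by push_cast; ring
  refine le_of_tendsto' (lintegral_tendsto_of_tendsto_of_monotone (fun n => ?_) ?_ ?_) bound
  · exact ((hF.norm.inf aestronglyMeasurable_const).enorm.pow_const 2).restrict
  · refine Eventually.of_forall fun y m n hmn => ?_
    dsimp only
    gcongr
    rw [← ofReal_norm, ← ofReal_norm]
    refine ENNReal.ofReal_le_ofReal ?_
    rw [Real.norm_of_nonneg (le_min (norm_nonneg _) m.cast_nonneg),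
      Real.norm_of_nonneg (le_min (norm_nonneg _) n.cast_nonneg)]
    gcongr
  · refine Eventually.of_forall fun y => tendsto_const_nhds.congr' ?_
    obtain ⟨n, hn⟩ := exists_nat_ge ‖F y‖
    filter_upwards [eventually_ge_atTop n] with m hm
    have : (n : ℝ) ≤ m := by exact_mod_cast hm
    rw [min_eq_left (hn.trans this), enorm_norm]

end JohnNirenberg

/-! ### Bounded mean oscillation and the heat flow -/

section Oscillation

variable {E : Type*} [NormedAddCommGroup E] [InnerProductSpace ℝ E]
  [MeasurableSpace E] [BorelSpace E] [FiniteDimensional ℝ E]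

lemma volume_closedBall_eq_ball (x : E) {r : ℝ} (hr : 0 < r) :
    volume (Metric.closedBall x r) = volume (Metric.ball x r) := by
  rw [Measure.addHaar_closedBall _ _ hr.le, volume_ball_eq x hr]

lemma volume_ball_mul (x y : E) {k : ℝ≥0} {r : ℝ} (hk : 0 < k) (hr : 0 < r) :
    volume (Metric.ball x (k * r)) =
      (k : ℝ≥0∞) ^ Module.finrank ℝ E * volume (Metric.ball y r) := by
  rw [← volume_closedBall_eq_ball _ (by positivity), ← volume_closedBall_eq_ball _ hr,
    volume_closedBall_mul x y hr.le]

/-- A consistent choice of constants for a function of bounded mean oscillation. -/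
lemma HasOsc.exists_const {F : E → ℂ} {A : ℝ≥0∞} (h : HasOsc F A) :
    ∃ a : E → ℝ → ℂ, ∀ x r, 0 < r → ∫⁻ y in Metric.closedBall x r, ‖F y - a x r‖ₑ ≤
      (2 ^ Module.finrank ℝ E * A) * volume (Metric.closedBall x r) := by
  have : ∀ x r, ∃ a : ℂ, 0 < r → ∫⁻ y in Metric.ball x r, ‖F y - a‖ₑ ≤
      A * volume (Metric.ball x r) := by
    intro x r
    by_cases hr : 0 < r
    · obtain ⟨a, ha⟩ := h x r hr
      exact ⟨a, fun _ => ha⟩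
    · exact ⟨0, fun h => absurd h hr⟩
  choose a ha using this
  refine ⟨fun x r => a x (2 * r), fun x r hr => ?_⟩
  calc _ ≤ ∫⁻ y in Metric.ball x (2 * r), ‖F y - a x (2 * r)‖ₑ :=
        lintegral_mono_set (Metric.closedBall_subset_ball (by linarith))
    _ ≤ A * volume (Metric.ball x (2 * r)) := ha x (2 * r) (by linarith)
    _ = _ := by
        rw [show (2 : ℝ) * r = ((2 : ℝ≥0) : ℝ) * r by simp,
          volume_ball_mul x x (by norm_num) hr, volume_closedBall_eq_ball _ hr]
        push_cast; ring

/-- The logarithmic growth of the constants. -/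
lemma enorm_const_sub_le {F : E → ℂ} (hF : AEStronglyMeasurable F) {a : E → ℝ → ℂ} {B : ℝ≥0∞}
    (h : ∀ x r, 0 < r → ∫⁻ y in Metric.closedBall x r, ‖F y - a x r‖ₑ ≤
      B * volume (Metric.closedBall x r)) (x : E) {r : ℝ} (hr : 0 < r) (k : ℕ) :
    ‖a x (2 ^ k * r) - a x r‖ₑ ≤ k * ((1 + 2 ^ Module.finrank ℝ E) * B) := by
  have step : ∀ r, 0 < r → ‖a x (2 * r) - a x r‖ₑ ≤ (1 + 2 ^ Module.finrank ℝ E) * B := by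
    intro r hr
    have h1 : ∫⁻ y in Metric.closedBall x r, ‖F y - a x (2 * r)‖ₑ ≤
        (2 ^ Module.finrank ℝ E * B) * volume (Metric.closedBall x r) := by
      calc _ ≤ ∫⁻ y in Metric.closedBall x (2 * r), ‖F y - a x (2 * r)‖ₑ :=
            lintegral_mono_set (Metric.closedBall_subset_closedBall (by linarith))
        _ ≤ B * volume (Metric.closedBall x (2 * r)) := h x (2 * r) (by linarith)
        _ = _ := by
            rw [show (2 : ℝ) * r = ((2 : ℝ≥0) : ℝ) * r by simp, volume_closedBall_mul x x hr.le]
            push_cast; ring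
    refine (enorm_sub_le_of_mean_le hF (volume_closedBall_ne_zero x hr)
      (volume_closedBall_ne_top x r) h1 (h x r hr)).trans (le_of_eq (by ring))
  induction k with
  | zero => simp
  | succ k ih =>
    have e : a x (2 ^ (k + 1) * r) - a x r =
        (a x (2 * (2 ^ k * r)) - a x (2 ^ k * r)) + (a x (2 ^ k * r) - a x r) := by
      rw [pow_succ']; ring_nf
    rw [e]
    refine (enorm_add_le _ _).trans ((add_le_add (step _ (by positivity)) ih).trans ?_)
    push_cast
    exact le_of_eq (by ring)

lemma tsum_half_pow_mul_sq_ne_top :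
    ∑' k : ℕ, ENNReal.ofReal ((1 / 2) ^ k) * ((k : ℝ≥0∞) + 1) ^ 2 ≠ ⊤ := by
  have hs : Summable fun k : ℕ => ((1 / 2 : ℝ) ^ k) * ((k : ℝ) + 1) ^ 2 := by
    have h1 := fun j : ℕ => summable_pow_mul_geometric_of_norm_lt_one (R := ℝ) j
      (r := 1 / 2) (by rw [Real.norm_eq_abs, abs_of_pos] <;> norm_num)
    refine ((h1 2).add (((h1 1).mul_left 2).add (h1 0))).congr fun k => ?_
    ring
  have := hs.tsum_ofReal_ne_top
  convert this using 3 with k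
  rw [ENNReal.ofReal_mul (by positivity), ENNReal.ofReal_pow (by positivity),
    ENNReal.ofReal_pow (by positivity), ENNReal.ofReal_add (by positivity) (by positivity)]
  simp

variable (E) in
/-- Integrals of `|F - a|` against the majorant `poly`. -/
lemma exists_lintegral_poly_sub_const_le : ∃ C : ℝ≥0, ∀ (F : E → ℂ) (A : ℝ≥0∞),
    AEStronglyMeasurable F → HasOsc F A → ∀ x R, 0 < R → ∃ a : ℂ,
      ∫⁻ y in Metric.ball x R, ‖F y - a‖ₑ ≤ C * A * volume (Metric.ball x R) ∧
        ∫⁻ y, ENNReal.ofReal (poly R (x - y)) * ‖F y - a‖ₑ ≤ C * A := by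
  set D := Module.finrank ℝ E with hD
  set V := volume (Metric.ball (0 : E) 1) with hV
  set S := ∑' k : ℕ, ENNReal.ofReal ((1 / 2) ^ k) * ((k : ℝ≥0∞) + 1) ^ 2 with hS
  have hSt : S ≠ ⊤ := tsum_half_pow_mul_sq_ne_top
  set c₁ : ℝ≥0∞ := 2 ^ D * (1 + 2 ^ D) with hc₁
  set C₀ : ℝ≥0∞ := 2 ^ D + ENNReal.ofReal (2 ^ (D + 1)) * V * (S * c₁) with hC₀
  have hC₀t : C₀ ≠ ⊤ := by
    have h2 : (2 : ℝ≥0∞) ^ D ≠ ⊤ := by simp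
    have h3 : c₁ ≠ ⊤ := ENNReal.mul_ne_top h2 (ENNReal.add_ne_top.2 ⟨by simp, h2⟩)
    exact ENNReal.add_ne_top.2 ⟨h2, ENNReal.mul_ne_top (ENNReal.mul_ne_top ENNReal.ofReal_ne_top
      measure_ball_lt_top.ne) (ENNReal.mul_ne_top hSt h3)⟩
  refine ⟨C₀.toNNReal, fun F A hF h x R hR => ?_⟩
  rw [ENNReal.coe_toNNReal hC₀t]
  obtain ⟨a, ha⟩ := h.exists_const
  refine ⟨a x R, ?_, ?_⟩
  · calc _ ≤ ∫⁻ y in Metric.closedBall x R, ‖F y - a x R‖ₑ :=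
          lintegral_mono_set Metric.ball_subset_closedBall
      _ ≤ _ := ha x R hR
      _ ≤ _ := by
          rw [volume_closedBall_eq_ball x hR]
          gcongr
          exact le_self_add
  -- The constants drift by a bounded amount per doubling of the radius. Linear growth in `k` would
  -- be enough; the square matches the series needed again for the weighted square integral.
  · have hb : ∀ k : ℕ, ∫⁻ y in Metric.ball x (2 ^ k * R), ‖F y - a x R‖ₑ ≤
        (c₁ * A * ((k : ℝ≥0∞) + 1) ^ 2) * volume (Metric.ball x (2 ^ k * R)) := by
      intro k
      have hkR : 0 < 2 ^ k * R := by positivity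
      calc _ ≤ ∫⁻ y in Metric.closedBall x (2 ^ k * R), ‖F y - a x R‖ₑ :=
            lintegral_mono_set Metric.ball_subset_closedBall
        _ ≤ ∫⁻ y in Metric.closedBall x (2 ^ k * R), (‖F y - a x (2 ^ k * R)‖ₑ +
              k * ((1 + 2 ^ D) * (2 ^ D * A))) := by
            refine lintegral_mono fun y => ?_
            have e : F y - a x R = (F y - a x (2 ^ k * R)) + (a x (2 ^ k * R) - a x R) := by ring
            rw [e]
            exact (enorm_add_le _ _).trans (add_le_add le_rfl (enorm_const_sub_le hF ha x hR k))
        _ ≤ (2 ^ D * A) * volume (Metric.closedBall x (2 ^ k * R)) +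
              k * ((1 + 2 ^ D) * (2 ^ D * A)) * volume (Metric.closedBall x (2 ^ k * R)) := by
            rw [lintegral_add_right _ measurable_const, setLIntegral_const]
            gcongr
            exact ha x _ hkR
        _ ≤ _ := by
            rw [volume_closedBall_eq_ball x hkR, ← add_mul]
            gcongr
            have h1 : (2 : ℝ≥0∞) ^ D * A ≤ c₁ * A := by
              rw [hc₁]; gcongr; exact le_mul_of_one_le_right zero_le le_self_add
            calc 2 ^ D * A + k * ((1 + 2 ^ D) * (2 ^ D * A)) ≤ c₁ * A + k * (c₁ * A) := by
                  refine add_le_add h1 (le_of_eq ?_)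
                  rw [hc₁]; ring
              _ = c₁ * A * ((k : ℝ≥0∞) + 1) := by ring
              _ ≤ _ := by
                  gcongr
                  exact le_self_pow₀ le_add_self (by norm_num)
    refine (lintegral_poly_mul_le hR x (hF.sub aestronglyMeasurable_const).enorm hb).trans ?_
    calc _ = ENNReal.ofReal (2 ^ (D + 1)) * V * (S * c₁) * A := by
          rw [hS, mul_assoc (ENNReal.ofReal (2 ^ (D + 1)) * V), mul_assoc (tsum _),
            ← ENNReal.tsum_mul_right]
          congr 2; ext k; ring
      _ ≤ _ := by gcongr; exact le_add_self

lemma tempered_of_lintegral_poly_lt_top {F : E → ℂ} (hF : AEStronglyMeasurable F)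
    (h : ∫⁻ y, ENNReal.ofReal (poly 1 ((0 : E) - y)) * ‖F y‖ₑ < ⊤) : Tempered F := by
  refine ⟨Module.finrank ℝ E + 1,
    (continuous_inv_one_add_norm_pow _).aestronglyMeasurable.smul hF, ?_⟩
  unfold HasFiniteIntegral
  refine lt_of_le_of_lt (lintegral_mono fun y => le_of_eq ?_) h
  simp only [enorm_smul, poly, one_pow, inv_one, one_mul, zero_sub, norm_neg, div_one]
  rw [Real.enorm_of_nonneg (by positivity)]

lemma HasOsc.tempered {F : E → ℂ} (hF : AEStronglyMeasurable F) {A : ℝ≥0} (h : HasOsc F A) :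
    Tempered F := by
  obtain ⟨C, hC⟩ := exists_lintegral_poly_sub_const_le E
  obtain ⟨a, -, ha⟩ := hC F A hF h 0 1 one_pos
  have h1 : Tempered (F - fun _ => a) :=
    tempered_of_lintegral_poly_lt_top (hF.sub aestronglyMeasurable_const)
      (ha.trans_lt (ENNReal.mul_lt_top ENNReal.coe_lt_top ENNReal.coe_lt_top))
  simpa using h1.add (tempered_const a)

/-- The weighted square integrability of functions of bounded mean oscillation. -/
lemma HasOsc.lintegral_poly_sq_lt_top {F : E → ℂ} (hF : AEStronglyMeasurable F) {A : ℝ≥0}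
    (h : HasOsc F A) : ∫⁻ y, ENNReal.ofReal (poly 1 ((0 : E) - y)) * ‖F y‖ₑ ^ 2 < ⊤ := by
  set D := Module.finrank ℝ E with hD
  obtain ⟨C, hC⟩ := exists_sq_mean_le E
  obtain ⟨a, ha⟩ := h.exists_const
  -- Adding one makes `B` positive, as the square-mean inequality requires.
  set B : ℝ≥0 := 2 ^ D * A + 1 with hB
  have hB' : ∀ x r, 0 < r → ∫⁻ y in Metric.closedBall x r, ‖F y - a x r‖ₑ ≤
      B * volume (Metric.closedBall x r) := by
    intro x r hr
    refine (ha x r hr).trans ?_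
    gcongr
    rw [hB]; push_cast; exact le_self_add
  have hsq := hC F a B hF (by positivity) hB'
  set q : ℝ≥0∞ := ‖a 0 1‖ₑ + (1 + 2 ^ D) * B with hq
  have hqt : q ≠ ⊤ := by
    refine ENNReal.add_ne_top.2 ⟨enorm_ne_top, ENNReal.mul_ne_top ?_ ENNReal.coe_ne_top⟩
    exact ENNReal.add_ne_top.2 ⟨by simp, by simp⟩
  -- The square-mean bound at radius `2 ^ k` involves the constant of the doubled radius, hence `k +
  -- 1` doublings from radius one.
  have hgrow : ∀ k : ℕ, ‖a 0 (2 * (2 ^ k * 1))‖ₑ ≤ 2 * q * ((k : ℝ≥0∞) + 1) := by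
    intro k
    have h1 := enorm_const_sub_le hF hB' 0 one_pos (k + 1)
    rw [pow_succ', mul_assoc] at h1
    have e : a 0 (2 * (2 ^ k * 1)) = (a 0 (2 * (2 ^ k * 1)) - a 0 1) + a 0 1 := by ring
    rw [e]
    refine (enorm_add_le _ _).trans ((add_le_add h1 le_rfl).trans ?_)
    calc ((k + 1 : ℕ) : ℝ≥0∞) * ((1 + 2 ^ D) * B) + ‖a 0 1‖ₑ ≤
          ((k : ℝ≥0∞) + 1) * q + ((k : ℝ≥0∞) + 1) * q := by
          push_cast
          refine add_le_add (by gcongr; exact le_add_self) ?_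
          calc ‖a 0 1‖ₑ ≤ 1 * q := by rw [one_mul]; exact le_self_add
            _ ≤ _ := by gcongr; exact le_add_self
      _ = _ := by ring
  set p : ℝ≥0∞ := (C * B ^ 2 : ℝ≥0) + 2 * (2 * q) ^ 2 with hp
  have hpt : p ≠ ⊤ := ENNReal.add_ne_top.2 ⟨ENNReal.coe_ne_top, ENNReal.mul_ne_top (by simp)
    (ENNReal.pow_ne_top (ENNReal.mul_ne_top (by simp) hqt))⟩
  have hb : ∀ k : ℕ, ∫⁻ y in Metric.ball (0 : E) (2 ^ k * 1), ‖F y‖ₑ ^ 2 ≤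
      (p * ((k : ℝ≥0∞) + 1) ^ 2) * volume (Metric.ball (0 : E) (2 ^ k * 1)) := by
    intro k
    have hk : (0 : ℝ) < 2 ^ k * 1 := by positivity
    calc _ ≤ ∫⁻ y in Metric.closedBall (0 : E) (2 ^ k * 1), ‖F y‖ₑ ^ 2 :=
          lintegral_mono_set Metric.ball_subset_closedBall
      _ ≤ _ := hsq 0 _ hk
      _ ≤ _ := by
          rw [volume_closedBall_eq_ball _ hk]
          gcongr
          calc _ ≤ ((C * B ^ 2 : ℝ≥0) : ℝ≥0∞) * ((k : ℝ≥0∞) + 1) ^ 2 +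
                2 * (2 * q * ((k : ℝ≥0∞) + 1)) ^ 2 := by
                refine add_le_add ?_ (by gcongr; exact hgrow k)
                exact le_mul_of_one_le_right zero_le (one_le_pow₀ le_add_self)
            _ = _ := by rw [hp]; ring
  refine (lintegral_poly_mul_le one_pos 0 (hF.enorm.pow_const 2) hb).trans_lt ?_
  have e : ∑' k : ℕ, ENNReal.ofReal ((1 / 2) ^ k) * (p * ((k : ℝ≥0∞) + 1) ^ 2) =
      p * ∑' k : ℕ, ENNReal.ofReal ((1 / 2) ^ k) * ((k : ℝ≥0∞) + 1) ^ 2 := by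
    rw [← ENNReal.tsum_mul_left]; congr 1; ext k; ring
  rw [e]
  refine ENNReal.mul_lt_top (ENNReal.mul_lt_top ENNReal.ofReal_lt_top measure_ball_lt_top) ?_
  exact ENNReal.mul_lt_top hpt.lt_top tsum_half_pow_mul_sq_ne_top.lt_top

variable (E) in
/-- Functions of bounded mean oscillation are close in the mean to their heat flow. -/
theorem exists_lintegral_sub_flow_le : ∃ C : ℝ≥0, ∀ (F : E → ℂ) (A : ℝ≥0),
    AEStronglyMeasurable F → HasOsc F A → ∀ y r, 0 < r →
      ∫⁻ x in Metric.ball y r, ‖F x - flow (r ^ 2) F x‖ₑ ≤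
        (C * A : ℝ≥0) * volume (Metric.ball y r) := by
  obtain ⟨C₁, hC₁⟩ := exists_lintegral_poly_sub_const_le E
  obtain ⟨C₂, hC₂⟩ := exists_norm_flow_le_of_lintegral_le E
  set D := Module.finrank ℝ E
  refine ⟨C₁ + C₂ * (2 ^ (D + 1) * C₁), fun F A hF h y r hr => ?_⟩
  have hr2 : 0 < r ^ 2 := by positivity
  obtain ⟨a, ha1, ha2⟩ := hC₁ F A hF h y r hr
  have hFT := h.tempered hF
  -- The flow fixes the constant `a`, so only the flow of `F - a` has to be bounded. Points of the
  -- ball are within `r` of `y`, so the majorant centred at `x` is controlled by the one centred at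
  -- `y`.
  have hfl : ∀ x ∈ Metric.ball y r, ‖flow (r ^ 2) F x - a‖ₑ ≤
      (C₂ * (2 ^ (D + 1) * (C₁ * A)) : ℝ≥0) := by
    intro x hx
    have h1 : ∫⁻ z, ENNReal.ofReal (poly r (x - z)) * ‖(F - fun _ => a : E → ℂ) z‖ₑ ≤
        (2 ^ (D + 1) * (C₁ * A) : ℝ≥0) := by
      calc _ ≤ ∫⁻ z, 2 ^ (D + 1) * (ENNReal.ofReal (poly r (y - z)) * ‖F z - a‖ₑ) := by
            refine lintegral_mono fun z => ?_
            rw [← mul_assoc]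
            refine mul_le_mul_left ?_ _
            calc ENNReal.ofReal (poly r (x - z)) ≤
                  ENNReal.ofReal (2 ^ (D + 1) * poly r (y - z)) := by
                  refine ENNReal.ofReal_le_ofReal (poly_le_of_norm_sub_le hr ?_)
                  rw [sub_sub_sub_cancel_right, ← dist_eq_norm]
                  exact (Metric.mem_ball.1 hx).le
              _ = _ := by
                  rw [ENNReal.ofReal_mul (by positivity), ENNReal.ofReal_pow (by positivity)]
                  simp
        _ = 2 ^ (D + 1) * ∫⁻ z, (ENNReal.ofReal (poly r (y - z)) * ‖F z - a‖ₑ) :=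
            lintegral_const_mul' _ _ (by simp)
        _ ≤ _ := by push_cast; gcongr
    have h2 := (hC₂ r hr _ _ (hF.sub aestronglyMeasurable_const) x h1).1
    rw [flow_sub hFT (tempered_const a) hr2, flow_const hr2] at h2
    rw [← ofReal_norm]
    refine ENNReal.ofReal_le_of_le_toReal ?_
    simpa using h2
  calc _ ≤ ∫⁻ x in Metric.ball y r, (‖F x - a‖ₑ + (C₂ * (2 ^ (D + 1) * (C₁ * A)) : ℝ≥0)) := by
        refine setLIntegral_mono' measurableSet_ball fun x hx => ?_
        have e : F x - flow (r ^ 2) F x = (F x - a) - (flow (r ^ 2) F x - a) := by ring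
        rw [e]
        exact enorm_sub_le.trans (add_le_add le_rfl (hfl x hx))
    _ ≤ C₁ * A * volume (Metric.ball y r) +
          (C₂ * (2 ^ (D + 1) * (C₁ * A)) : ℝ≥0) * volume (Metric.ball y r) := by
        rw [lintegral_add_right _ measurable_const, setLIntegral_const]
        gcongr
    _ = _ := by push_cast; ring

/-- A caloric function of bounded mean oscillation is constant. -/
theorem HasOsc.exists_ae_eq_const {F : E → ℂ} (hF : AEStronglyMeasurable F) {A : ℝ≥0}
    (h : HasOsc F A) (hflow : ∀ t, 0 < t → flow t F =ᵐ[volume] F) :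
    ∃ c : ℂ, F =ᵐ[volume] fun _ => c := by
  obtain ⟨C₁, hC₁⟩ := exists_lintegral_poly_sub_const_le E
  obtain ⟨C₂, hC₂⟩ := exists_norm_flow_le_of_lintegral_le E
  have hFT := h.tempered hF
  -- The almost-everywhere identity becomes an identity of flows after one more application of the
  -- flow, which ignores null sets.
  have hG : ∀ t, 0 < t → flow t F = flow 1 F := by
    intro t ht
    have h1 := flow_congr_ae (hflow t ht) 1
    have h2 := flow_congr_ae (hflow 1 one_pos) t
    rw [flow_flow hFT one_pos ht] at h1
    rw [flow_flow hFT ht one_pos, add_comm] at h2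
    rw [← h2, h1]
  refine ⟨flow 1 F 0, (hflow 1 one_pos).symm.trans (Eventually.of_forall fun x => ?_)⟩
  rw [← sub_eq_zero]
  set K : ℝ := C₂ * (C₁ * A : ℝ≥0) * ‖x - 0‖ with hK
  have hlim : Tendsto (fun R : ℝ => K / R) atTop (𝓝 0) :=
    tendsto_const_nhds.div_atTop tendsto_id
  -- A Liouville argument: `F - a` is bounded against `poly R` independently of `R`, so the flow at
  -- time `R²` varies by `O(‖x‖ / R)` between `x` and the origin. That flow does not depend on `R`.
  have hle : ∀ᶠ R : ℝ in atTop, ‖flow 1 F x - flow 1 F 0‖ ≤ K / R := by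
    filter_upwards [eventually_gt_atTop 0, eventually_ge_atTop ‖x - 0‖] with R hR hxR
    have hR2 : 0 < R ^ 2 := by positivity
    obtain ⟨a, -, ha⟩ := hC₁ F A hF h x R hR
    have h1 := (hC₂ R hR (F - fun _ => a) (C₁ * A) (hF.sub aestronglyMeasurable_const) x
      (by exact_mod_cast ha)).2 0 hxR
    rw [flow_sub hFT (tempered_const a) hR2, flow_const hR2, hG _ hR2] at h1
    simp only [Pi.sub_apply, sub_sub_sub_cancel_right] at h1
    rwa [hK, mul_div_assoc]
  exact norm_le_zero_iff.1 (ge_of_tendsto hlim hle)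

lemma HasOsc.congr_ae {F G : E → ℂ} {A : ℝ≥0∞} (h : HasOsc F A) (hFG : F =ᵐ[volume] G) :
    HasOsc G A := by
  intro x r hr
  obtain ⟨a, ha⟩ := h x r hr
  refine ⟨a, le_trans (le_of_eq ?_) ha⟩
  exact lintegral_congr_ae (ae_restrict_of_ae (hFG.mono fun y hy => by simp only [hy]))

end Oscillation

/-! ### Passing between cubes and balls -/

section Cubes

variable {d : ℕ}

lemma ball_subset_cube (x : EuclideanSpace ℝ (Fin d)) (r : ℝ) :
    Metric.ball x r ⊆ cube x (2 * r) := by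
  intro y hy i
  have h1 := PiLp.norm_apply_le (y - x) i
  rw [← dist_eq_norm] at h1
  have h2 := Metric.mem_ball.1 hy
  simp only [PiLp.sub_apply, Real.norm_eq_abs] at h1
  linarith

/-- Bounding the Euclidean norm by the sum of the coordinates avoids square roots; the radius is not
sharp. -/
lemma cube_subset_closedBall (x : EuclideanSpace ℝ (Fin d)) (l : ℝ) :
    cube x l ⊆ Metric.closedBall x (d * (l / 2)) := by
  intro y hy
  have h1 : ∀ i, |y i - x i| ≤ l / 2 := hy
  rw [Metric.mem_closedBall, EuclideanSpace.dist_eq]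
  have h0 : 0 ≤ ∑ i : Fin d, |y i - x i| := Finset.sum_nonneg fun i _ => abs_nonneg _
  calc √(∑ i, dist (y i) (x i) ^ 2) ≤ √((∑ i : Fin d, |y i - x i|) ^ 2) := by
        refine Real.sqrt_le_sqrt ?_
        simp only [Real.dist_eq]
        exact Finset.sum_sq_le_sq_sum_of_nonneg fun i _ => abs_nonneg _
    _ = ∑ i : Fin d, |y i - x i| := Real.sqrt_sq h0
    _ ≤ ∑ _i : Fin d, l / 2 := Finset.sum_le_sum fun i _ => h1 i
    _ = _ := by simp

lemma volume_cube_ne_zero (x : EuclideanSpace ℝ (Fin d)) {l : ℝ} (hl : 0 < l) :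
    volume (cube x l) ≠ 0 := by
  have h := ball_subset_cube x (l / 2)
  rw [mul_div_cancel₀ _ two_ne_zero] at h
  exact ((Metric.measure_ball_pos volume x (half_pos hl)).trans_le (measure_mono h)).ne'

lemma volume_cube_ne_top (x : EuclideanSpace ℝ (Fin d)) (l : ℝ) : volume (cube x l) ≠ ⊤ :=
  ((measure_mono (cube_subset_closedBall x l)).trans_lt measure_closedBall_lt_top).ne

lemma lintegral_cube_le (F : EuclideanSpace ℝ (Fin d) → ℂ) (x : EuclideanSpace ℝ (Fin d)) {l : ℝ}
    (hl : 0 < l) :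
    ∫⁻ y in cube x l, ‖F y - ⨍ z in cube x l, F z‖ₑ ≤ bmoNorm F * volume (cube x l) := by
  have h : (volume (cube x l))⁻¹ * ∫⁻ y in cube x l, ‖F y - ⨍ z in cube x l, F z‖ₑ ≤ bmoNorm F :=
    le_iSup_of_le x (le_iSup_of_le l (le_iSup_of_le hl le_rfl))
  rwa [mul_comm, ← div_eq_mul_inv,
    ENNReal.div_le_iff (volume_cube_ne_zero x hl) (volume_cube_ne_top x l)] at h

variable (d) in
lemma exists_hasOsc_bmoNorm : ∃ C : ℝ≥0, ∀ F : EuclideanSpace ℝ (Fin d) → ℂ,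
    HasOsc F (C * bmoNorm F) := by
  -- The cube of side `2 r` lies in the ball of radius `d r`, whose volume is `d ^ d` times that of
  -- the ball of radius `r`.
  refine ⟨(d : ℝ≥0) ^ d, fun F x r hr => ⟨⨍ z in cube x (2 * r), F z, ?_⟩⟩
  calc _ ≤ ∫⁻ y in cube x (2 * r), ‖F y - ⨍ z in cube x (2 * r), F z‖ₑ :=
        lintegral_mono_set (ball_subset_cube x r)
    _ ≤ bmoNorm F * volume (cube x (2 * r)) := lintegral_cube_le F x (by linarith)
    _ ≤ bmoNorm F * volume (Metric.closedBall x (((d : ℝ≥0) : ℝ) * r)) := by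
        gcongr
        have := cube_subset_closedBall x (2 * r)
        rwa [mul_div_cancel_left₀ _ (two_ne_zero)] at this
    _ = _ := by
        rw [volume_closedBall_mul x x hr.le, volume_closedBall_eq_ball x hr,
          finrank_euclideanSpace_fin]
        push_cast; ring

variable (d) in
lemma exists_bmoNorm_le : ∃ C : ℝ≥0, ∀ (F : EuclideanSpace ℝ (Fin d) → ℂ) (A : ℝ≥0∞),
    LocallyIntegrable F → HasOsc F A → bmoNorm F ≤ C * A := by
  -- The factor `2` comes from replacing the constant `a` by the mean. The power is the volume ratio
  -- between a ball of radius `(d + 1) l` containing the cube and the ball of radius `l / 2` inside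
  -- it.
  refine ⟨2 * (2 * (d + 1)) ^ d, fun F A hF h => ?_⟩
  refine iSup_le fun x => iSup_le fun l => iSup_le fun hl => ?_
  set Q := cube x l with hQ
  have hQ0 := volume_cube_ne_zero x hl
  have hQt := volume_cube_ne_top x l
  rw [mul_comm, ← div_eq_mul_inv, ENNReal.div_le_iff hQ0 hQt]
  have hr : 0 < ((d : ℝ) + 1) * l := by positivity
  obtain ⟨a, ha⟩ := h x (((d : ℝ) + 1) * l) hr
  have hsub : Q ⊆ Metric.ball x (((d : ℝ) + 1) * l) := by
    refine (cube_subset_closedBall x l).trans (Metric.closedBall_subset_ball ?_)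
    nlinarith [(Nat.cast_nonneg d : (0 : ℝ) ≤ d)]
  -- Without integrability the average in `bmoNorm` would be the default value zero rather than the
  -- mean.
  have hint : IntegrableOn F Q := by
    refine (hF.integrableOn_isCompact (isCompact_closedBall x (d * (l / 2)))).mono_set ?_
    exact cube_subset_closedBall x l
  have havg : ‖(⨍ z in Q, F z) - a‖ₑ * volume Q ≤ ∫⁻ y in Q, ‖F y - a‖ₑ := by
    have e : (⨍ z in Q, F z) - a = (volume.real Q)⁻¹ • ∫ y in Q, (F y - a) := by
      rw [integral_sub hint (integrableOn_const hQt), setIntegral_const, setAverage_eq, smul_sub,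
        smul_smul, inv_mul_cancel₀, one_smul]
      exact (ENNReal.toReal_pos hQ0 hQt).ne'
    rw [e, enorm_smul]
    have e2 : ‖(volume.real Q)⁻¹‖ₑ = (volume Q)⁻¹ := by
      rw [Real.enorm_of_nonneg (by positivity), Measure.real, ENNReal.ofReal_inv_of_pos
        (ENNReal.toReal_pos hQ0 hQt), ENNReal.ofReal_toReal hQt]
    rw [e2, mul_right_comm, ENNReal.inv_mul_cancel hQ0 hQt, one_mul]
    exact enorm_integral_le_lintegral_enorm _
  calc ∫⁻ y in Q, ‖F y - ⨍ z in Q, F z‖ₑ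
      ≤ ∫⁻ y in Q, (‖F y - a‖ₑ + ‖(⨍ z in Q, F z) - a‖ₑ) := by
        refine lintegral_mono fun y => ?_
        have e : F y - ⨍ z in Q, F z = (F y - a) - ((⨍ z in Q, F z) - a) := by ring
        rw [e]; exact enorm_sub_le
    _ = (∫⁻ y in Q, ‖F y - a‖ₑ) + ‖(⨍ z in Q, F z) - a‖ₑ * volume Q := by
        rw [lintegral_add_right _ measurable_const, setLIntegral_const]
    _ ≤ (∫⁻ y in Q, ‖F y - a‖ₑ) + ∫⁻ y in Q, ‖F y - a‖ₑ := by gcongr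
    _ = 2 * ∫⁻ y in Q, ‖F y - a‖ₑ := by ring
    _ ≤ 2 * (A * volume (Metric.ball x (((d : ℝ) + 1) * l))) := by
        gcongr
        exact (lintegral_mono_set hsub).trans ha
    _ = 2 * (A * ((2 * ((d : ℝ≥0∞) + 1)) ^ d * volume (Metric.ball x (l / 2)))) := by
        have : ((d : ℝ) + 1) * l = ((2 * (d + 1) : ℝ≥0) : ℝ) * (l / 2) := by push_cast; ring
        rw [this, volume_ball_mul x x (by positivity) (half_pos hl), finrank_euclideanSpace_fin]
        push_cast; rfl
    _ ≤ 2 * (A * ((2 * ((d : ℝ≥0∞) + 1)) ^ d * volume Q)) := by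
        gcongr
        have := ball_subset_cube x (l / 2)
        rwa [mul_div_cancel₀ _ two_ne_zero] at this
    _ = _ := by push_cast; ring

lemma MemBMO.exists_hasOsc {F : EuclideanSpace ℝ (Fin d) → ℂ} (h : MemBMO F) :
    ∃ A : ℝ≥0, HasOsc F A := by
  obtain ⟨C, hC⟩ := exists_hasOsc_bmoNorm d
  refine ⟨C * (bmoNorm F).toNNReal, ?_⟩
  push_cast
  rw [ENNReal.coe_toNNReal h.2.ne]
  exact hC F

lemma HasOsc.memBMO {F : EuclideanSpace ℝ (Fin d) → ℂ} {A : ℝ≥0} (hF : LocallyIntegrable F)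
    (h : HasOsc F A) : MemBMO F := by
  obtain ⟨C, hC⟩ := exists_bmoNorm_le d
  exact ⟨hF, (hC F A hF h).trans_lt (ENNReal.mul_lt_top ENNReal.coe_lt_top ENNReal.coe_lt_top)⟩

end Cubes

/-! ### Limits in the square mean -/

section SquareLimits

variable {α : Type*} [MeasurableSpace α] {μ : Measure α}

lemma tendsto_eLpNorm_two_of_dominated {ι : Type*} {l : Filter ι} [l.IsCountablyGenerated]
    {f : ι → α → ℂ} {b : α → ℝ} (hb : MemLp b 2 μ) (hm : ∀ᶠ i in l, Measurable (f i))
    (hle : ∀ᶠ i in l, ∀ᵐ x ∂μ, ‖f i x‖ ≤ b x)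
    (hlim : ∀ᵐ x ∂μ, Tendsto (fun i => f i x) l (𝓝 0)) :
    Tendsto (fun i => eLpNorm (f i) 2 μ) l (𝓝 0) := by
  have h1 : Tendsto (fun i => ∫⁻ x, ‖f i x‖ₑ ^ (2 : ℝ) ∂μ) l (𝓝 (∫⁻ _, 0 ∂μ)) := by
    refine tendsto_lintegral_filter_of_dominated_convergence (fun x => ‖b x‖ₑ ^ (2 : ℝ))
      (hm.mono fun i hi => hi.enorm.pow_const _) ?_ ?_ ?_
    · filter_upwards [hle] with i hi
      filter_upwards [hi] with x hx
      gcongr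
      rw [← ofReal_norm, ← ofReal_norm]
      exact ENNReal.ofReal_le_ofReal (hx.trans (le_abs_self _))
    · have := hb.2
      rw [eLpNorm_lt_top_iff_lintegral_rpow_enorm_lt_top (by norm_num) (by norm_num)] at this
      simpa using this.ne
    · filter_upwards [hlim] with x hx
      have := (ENNReal.continuous_rpow_const (y := (2 : ℝ))).tendsto ‖(0 : ℂ)‖ₑ |>.comp hx.enorm
      simpa [Function.comp_def] using this
  rw [lintegral_zero] at h1
  have h2 := (ENNReal.continuous_rpow_const (y := (1 / 2 : ℝ))).tendsto 0 |>.comp h1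
  simp only [Function.comp_def] at h2
  rw [ENNReal.zero_rpow_of_pos (by norm_num)] at h2
  refine h2.congr fun i => ?_
  rw [eLpNorm_eq_lintegral_rpow_enorm_toReal (by norm_num) (by norm_num)]
  simp

lemma tendsto_integral_mul_of_tendsto_eLpNorm {ι : Type*} {l : Filter ι} {a b : α → ℂ}
    {f : ι → α → ℂ} (ha : MemLp a 2 μ) (hb : MemLp b 2 μ) (hf : ∀ i, MemLp (f i) 2 μ)
    (h : Tendsto (fun i => eLpNorm (f i - b) 2 μ) l (𝓝 0)) :
    Tendsto (fun i => ∫ x, a x * f i x ∂μ) l (𝓝 (∫ x, a x * b x ∂μ)) := by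
  rw [tendsto_iff_edist_tendsto_0]
  have h1 : Tendsto (fun i => eLpNorm a 2 μ * eLpNorm (f i - b) 2 μ) l (𝓝 0) := by
    have := ENNReal.Tendsto.const_mul (a := eLpNorm a 2 μ) h (Or.inr ha.2.ne)
    simpa using this
  refine tendsto_of_tendsto_of_tendsto_of_le_of_le tendsto_const_nhds h1 (fun _ => zero_le)
    fun i => ?_
  have e : (∫ x, a x * f i x ∂μ) - ∫ x, a x * b x ∂μ = ∫ x, (a • (f i - b)) x ∂μ := by
    refine (integral_sub (ha.integrable_mul (hf i)) (ha.integrable_mul hb)).symm.trans ?_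
    congr 1; ext x
    simp only [Pi.smul_apply', Pi.sub_apply, Pi.mul_apply, smul_eq_mul]; ring
  rw [edist_eq_enorm_sub, e]
  refine (enorm_integral_le_lintegral_enorm _).trans ?_
  rw [← eLpNorm_one_eq_lintegral_enorm]
  exact eLpNorm_smul_le_mul_eLpNorm ((hf i).sub hb).1 ha.1

end SquareLimits

/-! ### The heat flow of smooth compactly supported data -/

section SmoothFlow

variable {E : Type*} [NormedAddCommGroup E] [InnerProductSpace ℝ E]
  [MeasurableSpace E] [BorelSpace E] [FiniteDimensional ℝ E]

lemma memLp_two_inv_one_add_norm_pow (C : ℝ) :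
    MemLp (fun x : E => C * ((1 + ‖x‖) ^ (Module.finrank ℝ E + 1))⁻¹) 2 := by
  have hc : Continuous fun x : E => C * ((1 + ‖x‖) ^ (Module.finrank ℝ E + 1))⁻¹ :=
    continuous_const.mul (continuous_inv_one_add_norm_pow _)
  rw [memLp_two_iff_integrable_sq hc.aestronglyMeasurable]
  refine (integrable_inv_one_add_norm_pow.const_mul (C ^ 2)).mono' (hc.pow 2).aestronglyMeasurable
    (Eventually.of_forall fun x => ?_)
  rw [Real.norm_of_nonneg (sq_nonneg _), mul_pow]
  gcongr
  refine pow_le_of_le_one (by positivity) (inv_le_one_of_one_le₀ ?_) (by norm_num)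
  exact one_le_pow₀ (by linarith [norm_nonneg x])

lemma flow_eq_integral_sub (t : ℝ) (G : E → ℂ) (x : E) :
    flow t G x = ∫ z, heat t z • G (x - z) := by
  rw [flow, ← integral_sub_left_eq_self (fun z => heat t z • G (x - z)) volume x]
  simp

/-- Rescaling moves the time from the kernel into the argument of `G`, so that limits and
derivatives in `t` follow by dominated convergence against a fixed Gaussian. -/
lemma flow_eq_integral_scaled {t : ℝ} (ht : 0 < t) (G : E → ℂ) (x : E) :
    flow t G x = ∫ z, heat 1 z • G (x - √t • z) := by
  have hs : 0 < √t := Real.sqrt_pos.2 ht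
  have h := Measure.integral_comp_smul (volume : Measure E)
    (fun w => heat 1 ((√t)⁻¹ • w) • G (x - w)) (√t)
  simp only [smul_smul, inv_mul_cancel₀ hs.ne', one_smul] at h
  rw [h, flow_eq_integral_sub, abs_of_pos (by positivity), ← integral_smul]
  congr 1; ext w
  nth_rewrite 1 [← Real.sq_sqrt ht.le]
  rw [heat_sq hs, smul_smul]

lemma flow_eq_convolution (t : ℝ) (G : E → ℂ) :
    flow t G = convolution (heat t) G (ContinuousLinearMap.lsmul ℝ ℝ) volume := by
  ext x
  rw [flow_eq_integral_sub, convolution_def]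
  rfl

lemma exists_norm_le_inv_pow {G : E → ℂ} (hG : Continuous G) (hc : HasCompactSupport G) (m : ℕ) :
    ∃ C : ℝ, 0 ≤ C ∧ ∀ x, ‖G x‖ ≤ C * ((1 + ‖x‖) ^ m)⁻¹ := by
  have h1 : Continuous fun x : E => (1 + ‖x‖) ^ m • G x := by fun_prop
  have h2 : HasCompactSupport fun x : E => (1 + ‖x‖) ^ m • G x :=
    hc.mono fun x hx h => hx (by simp [h])
  obtain ⟨C, hC⟩ := h1.bounded_above_of_compact_support h2
  refine ⟨C, (norm_nonneg _).trans (hC 0), fun x => ?_⟩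
  have := hC x
  rw [norm_smul, Real.norm_of_nonneg (by positivity)] at this
  rwa [← div_eq_mul_inv, le_div_iff₀' (by positivity)]

/-- The decay of `G` survives because `1 + ‖x‖ ≤ (1 + √T) (1 + ‖z‖) (1 + ‖x - √t z‖)` and the
Gaussian has all moments. Uniformity in `t ≤ T` provides the dominating functions for the later
limits in the square mean. -/
lemma exists_norm_flow_le_inv_pow {G : E → ℂ} (hG : Continuous G) (hc : HasCompactSupport G)
    (T : ℝ) (m : ℕ) :
    ∃ C : ℝ, 0 ≤ C ∧ ∀ t, 0 < t → t ≤ T → ∀ x, ‖flow t G x‖ ≤ C * ((1 + ‖x‖) ^ m)⁻¹ := by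
  obtain ⟨C, hC, h⟩ := exists_norm_le_inv_pow hG hc m
  have hI := integrable_heat_mul_pow (E := E) one_pos m
  refine ⟨C * (1 + √T) ^ m * ∫ z : E, heat 1 z * (1 + ‖z‖) ^ m, ?_, fun t ht htT x => ?_⟩
  · refine mul_nonneg (by positivity) (integral_nonneg fun z => ?_)
    exact mul_nonneg (heat_pos one_pos _).le (by positivity)
  rw [flow_eq_integral_scaled ht, mul_right_comm, ← integral_const_mul]
  refine norm_integral_le_of_norm_le (hI.const_mul _) (Eventually.of_forall fun z => ?_)
  rw [norm_smul, Real.norm_of_nonneg (heat_pos one_pos _).le]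
  have h1 := h (x - √t • z)
  have h2 : 1 + ‖x‖ ≤ (1 + √T) * (1 + ‖z‖) * (1 + ‖x - √t • z‖) := by
    have h3 : ‖x‖ ≤ ‖x - √t • z‖ + √T * ‖z‖ := by
      calc ‖x‖ = ‖(x - √t • z) + √t • z‖ := by rw [sub_add_cancel]
        _ ≤ ‖x - √t • z‖ + ‖√t • z‖ := norm_add_le _ _
        _ ≤ _ := by
          rw [norm_smul, Real.norm_of_nonneg (Real.sqrt_nonneg _)]
          gcongr
    have h4 : 0 ≤ √T := Real.sqrt_nonneg _
    have h5 := norm_nonneg z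
    have h6 := norm_nonneg (x - √t • z)
    nlinarith [mul_nonneg h4 h5, mul_nonneg h4 h6, mul_nonneg h5 h6,
      mul_nonneg (mul_nonneg h4 h5) h6]
  have h3 : ((1 + ‖x - √t • z‖) ^ m)⁻¹ ≤
      (1 + √T) ^ m * (1 + ‖z‖) ^ m * ((1 + ‖x‖) ^ m)⁻¹ := by
    rw [← div_eq_mul_inv _ ((1 + ‖x‖) ^ m), le_div_iff₀ (by positivity),
      inv_mul_le_iff₀ (by positivity)]
    calc (1 + ‖x‖) ^ m ≤ ((1 + √T) * (1 + ‖z‖) * (1 + ‖x - √t • z‖)) ^ m := by gcongr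
      _ = _ := by rw [mul_pow, mul_pow]; ring
  calc heat 1 z * ‖G (x - √t • z)‖ ≤ heat 1 z * (C * ((1 + √T) ^ m * (1 + ‖z‖) ^ m *
        ((1 + ‖x‖) ^ m)⁻¹)) := by
        have := (heat_pos one_pos z).le
        gcongr
        exact h1.trans (by gcongr)
    _ = _ := by ring

lemma tendsto_flow_zero {G : E → ℂ} (hG : Continuous G) (hc : HasCompactSupport G) (x : E) :
    Tendsto (fun t => flow t G x) (𝓝[>] 0) (𝓝 (G x)) := by
  obtain ⟨C, hC⟩ := hG.bounded_above_of_compact_support hc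
  have h1 : Tendsto (fun t : ℝ => ∫ z : E, heat 1 z • G (x - √t • z)) (𝓝[>] 0)
      (𝓝 (∫ z : E, heat 1 z • G x)) := by
    refine tendsto_integral_filter_of_dominated_convergence (fun z : E => heat 1 z * C) ?_ ?_
      ((integrable_heat one_pos).mul_const C) ?_
    · refine Eventually.of_forall fun t => Continuous.aestronglyMeasurable ?_
      have h2 : Continuous fun z : E => x - √t • z := by fun_prop
      exact (continuous_heat 1).smul (hG.comp h2)
    · refine Eventually.of_forall fun t => Eventually.of_forall fun z => ?_
      rw [norm_smul, Real.norm_of_nonneg (heat_pos one_pos _).le]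
      have := (heat_pos one_pos z).le
      gcongr
      exact hC _
    · refine Eventually.of_forall fun z => ?_
      have : Continuous fun t : ℝ => heat 1 z • G (x - √t • z) := by
        have h2 : Continuous fun t : ℝ => x - √t • z := by fun_prop
        exact (hG.comp h2).const_smul (heat 1 z)
      have h := (this.tendsto 0).mono_left (nhdsWithin_le_nhds (s := Set.Ioi 0))
      simpa using h
  rw [integral_smul_const, integral_heat one_pos, one_smul] at h1
  refine h1.congr' ?_
  filter_upwards [self_mem_nhdsWithin] with t ht
  rw [flow_eq_integral_scaled ht]

lemma contDiff_flow {G : E → ℂ} (hG : ContDiff ℝ ∞ G) (hc : HasCompactSupport G) (t : ℝ) : ContDiff ℝ ∞ (flow t G) := by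
  rw [flow_eq_convolution]
  exact hc.contDiff_convolution_right _ (continuous_heat t).locallyIntegrable hG

lemma fderiv_flow {G : E → ℂ} (hG : ContDiff ℝ ∞ G) (hc : HasCompactSupport G) (t : ℝ)
    (x v : E) :
    fderiv ℝ (flow t G) x v = flow t (fun y => fderiv ℝ G y v) x := by
  have h := hc.hasFDerivAt_convolution_right (ContinuousLinearMap.lsmul ℝ ℝ)
    (continuous_heat t).locallyIntegrable (μ := volume) (hG.of_le (by norm_cast)) x
  rw [← flow_eq_convolution] at h
  rw [h.fderiv, convolution_precompR_apply _ (continuous_heat t).locallyIntegrable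
    (hc.fderiv ℝ) (hG.continuous_fderiv (by simp)), flow_eq_convolution]

end SmoothFlow

/-! ### The heat equation -/

section TimeDerivative

variable {d : ℕ}

/-- The Laplacian. -/
def lap (G : EuclideanSpace ℝ (Fin d) → ℂ) : EuclideanSpace ℝ (Fin d) → ℂ :=
  fun x => ∑ i, partialDeriv i (partialDeriv i G) x

lemma contDiff_partialDeriv {G : EuclideanSpace ℝ (Fin d) → ℂ} (hG : ContDiff ℝ ∞ G) (i : Fin d) :
    ContDiff ℝ ∞ (partialDeriv i G) :=
  (hG.fderiv_right (m := ∞) (by simp)).clm_apply contDiff_const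

lemma hasCompactSupport_partialDeriv {G : EuclideanSpace ℝ (Fin d) → ℂ} (hc : HasCompactSupport G)
    (i : Fin d) : HasCompactSupport (partialDeriv i G) :=
  hc.fderiv_apply ℝ _

lemma contDiff_lap {G : EuclideanSpace ℝ (Fin d) → ℂ} (hG : ContDiff ℝ ∞ G) :
    ContDiff ℝ ∞ (lap G) :=
  ContDiff.sum fun i _ => contDiff_partialDeriv (contDiff_partialDeriv hG i) i

lemma hasCompactSupport_lap {G : EuclideanSpace ℝ (Fin d) → ℂ} (hc : HasCompactSupport G) :
    HasCompactSupport (lap G) := by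
  refine HasCompactSupport.of_support_subset_isCompact (K := tsupport G) hc fun x hx => ?_
  by_contra h
  refine hx (Finset.sum_eq_zero fun i _ => ?_)
  have h1 : x ∉ tsupport (partialDeriv i (partialDeriv i G)) := fun h2 => h
    (((tsupport_fderiv_apply_subset ℝ _).trans (tsupport_fderiv_apply_subset ℝ _)) h2)
  exact image_eq_zero_of_notMem_tsupport h1

lemma partialDeriv_flow {G : EuclideanSpace ℝ (Fin d) → ℂ} (hG : ContDiff ℝ ∞ G)
    (hc : HasCompactSupport G) (t : ℝ) (i : Fin d) :
    partialDeriv i (flow t G) = flow t (partialDeriv i G) := by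
  ext x
  exact fderiv_flow hG hc t x _

lemma fderiv_heat_one (z : EuclideanSpace ℝ (Fin d)) (i : Fin d) :
    fderiv ℝ (heat 1) z (EuclideanSpace.single i 1) = -(z i / 2) * heat 1 z := by
  have h1 := (hasStrictFDerivAt_norm_sq z).hasFDerivAt
  have h2 : HasFDerivAt (heat 1 : EuclideanSpace ℝ (Fin d) → ℝ) _ z :=
    ((h1.const_mul (-(1 / (4 * 1)))).exp).const_mul _
  rw [h2.fderiv]
  simp only [smul_apply, innerSL_apply_apply, smul_eq_mul, heat,
    EuclideanSpace.inner_single_right]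
  simp
  ring

lemma eq_sum_smul_single (z : EuclideanSpace ℝ (Fin d)) :
    z = ∑ i, z i • EuclideanSpace.single i (1 : ℝ) := by
  have := (EuclideanSpace.basisFun (Fin d) ℝ).sum_repr z
  simpa using this.symm

/-- Integration by parts, from `∂ᵢ (heat 1) = -(zᵢ / 2) heat 1`. -/
lemma integral_coord_mul_heat {g : EuclideanSpace ℝ (Fin d) → ℂ} (hg : ContDiff ℝ ∞ g)
    (hc : HasCompactSupport g) (s : ℝ) (x : EuclideanSpace ℝ (Fin d)) (i : Fin d) :
    ∫ z, heat 1 z • (z i • g (x - s • z)) =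
      -(2 * s) • ∫ z, heat 1 z • partialDeriv i g (x - s • z) := by
  obtain ⟨C, hC⟩ := hg.continuous.bounded_above_of_compact_support hc
  obtain ⟨C', hC'⟩ := (contDiff_partialDeriv hg i).continuous.bounded_above_of_compact_support
    (hasCompactSupport_partialDeriv hc i)
  have hC0 : 0 ≤ C := (norm_nonneg _).trans (hC 0)
  have hlin : Continuous fun z : EuclideanSpace ℝ (Fin d) => x - s • z := by fun_prop
  set k : EuclideanSpace ℝ (Fin d) → ℂ := fun z => g (x - s • z) with hk
  have hkc : Continuous k := hg.continuous.comp hlin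
  have hkd : ∀ z, HasFDerivAt k ((fderiv ℝ g (x - s • z)).comp
      (-(s • ContinuousLinearMap.id ℝ (EuclideanSpace ℝ (Fin d))))) z := by
    intro z
    have h1 : HasFDerivAt g (fderiv ℝ g (x - s • z)) (x - s • z) :=
      (hg.differentiable (by simp) _).hasFDerivAt
    have h2 : HasFDerivAt (fun z : EuclideanSpace ℝ (Fin d) => x - s • z)
        (-(s • ContinuousLinearMap.id ℝ (EuclideanSpace ℝ (Fin d)))) z :=
      ((hasFDerivAt_id z).const_smul s).const_sub x
    exact h1.comp z h2
  have hk' : ∀ z, fderiv ℝ k z (EuclideanSpace.single i 1) = -s • partialDeriv i g (x - s • z) := by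
    intro z
    rw [(hkd z).fderiv]
    simp [partialDeriv]
  have hI0 : Integrable fun z => heat 1 z • k z := by
    refine ((integrable_heat one_pos).mul_const C).mono'
      ((continuous_heat 1).smul hkc).aestronglyMeasurable (Eventually.of_forall fun z => ?_)
    rw [norm_smul, Real.norm_of_nonneg (heat_pos one_pos _).le]
    have := (heat_pos one_pos z).le
    gcongr
    exact hC _
  have hI1 : Integrable fun z => heat 1 z • partialDeriv i g (x - s • z) := by
    refine ((integrable_heat one_pos).mul_const C').mono'
      ((continuous_heat 1).smul ((contDiff_partialDeriv hg i).continuous.comp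
        hlin)).aestronglyMeasurable (Eventually.of_forall fun z => ?_)
    rw [norm_smul, Real.norm_of_nonneg (heat_pos one_pos _).le]
    have := (heat_pos one_pos z).le
    gcongr
    exact hC' _
  have hcoord : Continuous fun z : EuclideanSpace ℝ (Fin d) => -(z i / 2) * heat 1 z :=
    Continuous.mul (by fun_prop) (continuous_heat 1)
  have hI2 : Integrable fun z => (-(z i / 2) * heat 1 z) • k z := by
    refine ((integrable_heat_mul_pow one_pos 1).mul_const C).mono'
      (hcoord.smul hkc).aestronglyMeasurable (Eventually.of_forall fun z => ?_)
    rw [norm_smul, norm_mul, Real.norm_of_nonneg (heat_pos one_pos _).le, mul_comm ‖_‖ (heat 1 z)]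
    have := (heat_pos one_pos z).le
    have h3 : ‖-(z i / 2)‖ ≤ (1 + ‖z‖) ^ 1 := by
      rw [norm_neg, norm_div, pow_one, Real.norm_two]
      have := PiLp.norm_apply_le z i
      linarith [norm_nonneg (z i), norm_nonneg z]
    gcongr
    exact hC _
  have ibp := integral_smul_fderiv_eq_neg_fderiv_smul_of_integrable (μ := volume)
    (f := (heat 1 : EuclideanSpace ℝ (Fin d) → ℝ)) (g := k) (v := EuclideanSpace.single i 1)
    (by simp_rw [fderiv_heat_one]; exact hI2)
    (by simp_rw [hk', smul_comm (heat 1 _) (-s)]; exact hI1.smul (-s))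
    hI0 (fun z _ => by
      have h1 := (hasStrictFDerivAt_norm_sq z).hasFDerivAt
      exact (((h1.const_mul (-(1 / (4 * 1)))).exp).const_mul _).differentiableAt)
    (fun z _ => (hkd z).differentiableAt)
  simp_rw [fderiv_heat_one, hk', smul_comm (heat 1 _) (-s)] at ibp
  rw [integral_smul] at ibp
  have e : ∀ z : EuclideanSpace ℝ (Fin d), heat 1 z • (z i • g (x - s • z)) =
      (-2 : ℝ) • ((-(z i / 2) * heat 1 z) • k z) := by
    intro z
    rw [hk, smul_smul, smul_smul]
    congr 1; ring
  simp_rw [e]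
  rw [integral_smul, ← neg_neg (∫ z, (-(z i / 2) * heat 1 z) • k z), ← ibp, smul_neg, smul_smul, ← neg_smul]
  congr 1; ring

/-- Differentiating the rescaled formula in time produces `-(1 / (2 √t)) ∑ zᵢ ∂ᵢ G` under the
Gaussian. By `integral_coord_mul_heat` each `zᵢ` becomes a second derivative with factor `-2 √t`,
and the factors cancel. -/
lemma hasDerivAt_flow {G : EuclideanSpace ℝ (Fin d) → ℂ} (hG : ContDiff ℝ ∞ G)
    (hc : HasCompactSupport G) {t : ℝ} (ht : 0 < t) (x : EuclideanSpace ℝ (Fin d)) :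
    HasDerivAt (fun s => flow s G x) (flow t (lap G) x) t := by
  have hGd : Continuous (fderiv ℝ G) := hG.continuous_fderiv (by simp)
  obtain ⟨C, hC⟩ := hGd.bounded_above_of_compact_support (hc.fderiv ℝ)
  obtain ⟨C₀, hC₀⟩ := hG.continuous.bounded_above_of_compact_support hc
  have hC0 : 0 ≤ C := (norm_nonneg _).trans (hC 0)
  have hlin : ∀ s : ℝ, Continuous fun z : EuclideanSpace ℝ (Fin d) => x - √s • z :=
    fun s => by fun_prop
  have key := hasDerivAt_integral_of_dominated_loc_of_deriv_le (𝕜 := ℝ) (μ := volume)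
    (F := fun s (z : EuclideanSpace ℝ (Fin d)) => heat 1 z • G (x - √s • z))
    (F' := fun s z => heat 1 z • fderiv ℝ G (x - √s • z) (-((1 / (2 * √s)) • z)))
    (bound := fun z => (1 / (2 * √(t / 2)) * C) * (heat 1 z * (1 + ‖z‖) ^ 1)) (x₀ := t)
    -- Times beyond `t / 2` only, where the factor `1 / (2 √s)` stays bounded.
    (s := Set.Ioi (t / 2)) (Ioi_mem_nhds (by linarith))
    (Eventually.of_forall fun s =>
      ((continuous_heat 1).smul (hG.continuous.comp (hlin s))).aestronglyMeasurable)
    (by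
      refine ((integrable_heat one_pos).mul_const C₀).mono'
        ((continuous_heat 1).smul (hG.continuous.comp (hlin t))).aestronglyMeasurable
        (Eventually.of_forall fun z => ?_)
      rw [norm_smul, Real.norm_of_nonneg (heat_pos one_pos _).le]
      have := (heat_pos one_pos z).le
      gcongr
      exact hC₀ _)
    (by
      have h1 : Continuous fun z => fderiv ℝ G (x - √t • z) (-((1 / (2 * √t)) • z)) :=
        (hGd.comp (hlin t)).clm_apply (by fun_prop)
      exact ((continuous_heat 1).smul h1).aestronglyMeasurable)
    (Eventually.of_forall fun z s hs => by
      have hs' : t / 2 < s := hs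
      rw [norm_smul, Real.norm_of_nonneg (heat_pos one_pos _).le]
      have h0 := (heat_pos one_pos z).le
      have h1 : 0 < √(t / 2) := Real.sqrt_pos.2 (by linarith)
      have h2 : √(t / 2) ≤ √s := Real.sqrt_le_sqrt hs'.le
      calc heat 1 z * ‖fderiv ℝ G (x - √s • z) (-((1 / (2 * √s)) • z))‖ ≤
            heat 1 z * (C * (1 / (2 * √(t / 2)) * (1 + ‖z‖) ^ 1)) := by
            gcongr
            refine (ContinuousLinearMap.le_opNorm _ _).trans ?_
            gcongr
            · exact hC _
            · rw [norm_neg, norm_smul, Real.norm_of_nonneg (by positivity)]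
              gcongr
              linarith
        _ = _ := by ring)
    ((integrable_heat_mul_pow one_pos 1).const_mul _)
    (Eventually.of_forall fun z s hs => by
      have hs0 : 0 < s := lt_trans (by linarith) (Set.mem_Ioi.1 hs)
      have h1 : HasFDerivAt G (fderiv ℝ G (x - √s • z)) (x - √s • z) :=
        (hG.differentiable (by simp) _).hasFDerivAt
      have h2 : HasDerivAt (fun s : ℝ => x - √s • z) (-((1 / (2 * √s)) • z)) s :=
        ((Real.hasDerivAt_sqrt hs0.ne').smul_const z).const_sub x
      exact (h1.comp_hasDerivAt s h2).const_smul (heat 1 z))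
  have h1 := key.2
  have e : ∫ z, heat 1 z • fderiv ℝ G (x - √t • z) (-((1 / (2 * √t)) • z)) =
      flow t (lap G) x := by
    have hs : 0 < √t := Real.sqrt_pos.2 ht
    have e1 : ∀ z : EuclideanSpace ℝ (Fin d),
        heat 1 z • fderiv ℝ G (x - √t • z) (-((1 / (2 * √t)) • z)) =
          ∑ i, (-(1 / (2 * √t))) • (heat 1 z • (z i • partialDeriv i G (x - √t • z))) := by
      intro z
      rw [← neg_smul, map_smul, smul_comm, ← Finset.smul_sum, ← Finset.smul_sum]
      congr 2
      nth_rewrite 2 [eq_sum_smul_single z]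
      rw [map_sum]
      simp [partialDeriv]
    have hint : ∀ (m : ℕ) (c : EuclideanSpace ℝ (Fin d) → ℝ) (g : EuclideanSpace ℝ (Fin d) → ℂ),
        Continuous c → (∀ z, ‖c z‖ ≤ (1 + ‖z‖) ^ m) → Continuous g → HasCompactSupport g →
        Integrable fun z => heat 1 z • (c z • g (x - √t • z)) := by
      intro m c g hcc hcm hg hgc
      obtain ⟨C', hC'⟩ := hg.bounded_above_of_compact_support hgc
      refine ((integrable_heat_mul_pow one_pos m).mul_const C').mono'
        ((continuous_heat 1).smul (hcc.smul (hg.comp (hlin t)))).aestronglyMeasurable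
        (Eventually.of_forall fun z => ?_)
      rw [norm_smul, norm_smul, Real.norm_of_nonneg (heat_pos one_pos _).le, ← mul_assoc]
      have := (heat_pos one_pos z).le
      gcongr
      · exact hcm z
      · exact hC' _
    simp_rw [e1]
    have hint1 : ∀ i, Integrable fun z : EuclideanSpace ℝ (Fin d) =>
        (-(1 / (2 * √t))) • (heat 1 z • (z i • partialDeriv i G (x - √t • z))) := fun i =>
      (hint 1 (fun z => z i) _ (by fun_prop) (fun z => by
        rw [pow_one]; linarith [PiLp.norm_apply_le z i]) (contDiff_partialDeriv hG i).continuous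
        (hasCompactSupport_partialDeriv hc i)).smul (-(1 / (2 * √t)))
    rw [integral_finsetSum _ fun i _ => hint1 i]
    rw [flow_eq_integral_scaled ht]
    simp only [lap, Finset.smul_sum]
    rw [integral_finsetSum _ fun i _ => by
      have := hint 0 (fun _ => 1) _ continuous_const (fun z => by simp)
        (contDiff_partialDeriv (contDiff_partialDeriv hG i) i).continuous
        (hasCompactSupport_partialDeriv (hasCompactSupport_partialDeriv hc i) i)
      simpa only [one_smul] using this]
    refine Finset.sum_congr rfl fun i _ => ?_
    rw [integral_smul, integral_coord_mul_heat (contDiff_partialDeriv hG i)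
      (hasCompactSupport_partialDeriv hc i), smul_smul]
    have : -(1 / (2 * √t)) * -(2 * √t) = 1 := by field_simp
    rw [this, one_smul]
  rw [e] at h1
  refine h1.congr_of_eventuallyEq ?_
  filter_upwards [lt_mem_nhds ht] with s hs
  exact flow_eq_integral_scaled hs G x

end TimeDerivative

/-! ### Reflection, extensions with parity and the method of images -/

section Reflection

variable {n : ℕ}

lemma reflect_apply (x : EuclideanSpace ℝ (Fin (n + 1))) (i : Fin (n + 1)) :
    reflect x i = if i = Fin.last n then -(x (Fin.last n)) else x i := by
  simp [reflect, Function.update_apply]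

@[simp] lemma reflect_last (x : EuclideanSpace ℝ (Fin (n + 1))) :
    reflect x (Fin.last n) = -(x (Fin.last n)) := by
  simp [reflect_apply]

@[simp] lemma reflect_reflect (x : EuclideanSpace ℝ (Fin (n + 1))) : reflect (reflect x) = x := by
  ext i
  simp only [reflect_apply]
  by_cases h : i = Fin.last n <;> simp [h]

/-- The reflection as a linear isometry. -/
def reflectIso (n : ℕ) :
    EuclideanSpace ℝ (Fin (n + 1)) ≃ₗᵢ[ℝ] EuclideanSpace ℝ (Fin (n + 1)) :=
  LinearIsometryEquiv.piLpCongrRight 2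
    fun i => if i = Fin.last n then LinearIsometryEquiv.neg ℝ else LinearIsometryEquiv.refl ℝ ℝ

lemma reflectIso_apply (x : EuclideanSpace ℝ (Fin (n + 1))) : reflectIso n x = reflect x := by
  ext i
  rw [reflect_apply]
  simp only [reflectIso, LinearIsometryEquiv.piLpCongrRight_apply]
  by_cases h : i = Fin.last n
  · subst h; simp
  · simp [h]

lemma coe_reflectIso : ⇑(reflectIso n) = reflect := funext reflectIso_apply

lemma measurePreserving_reflect :
    MeasurePreserving (reflect : EuclideanSpace ℝ (Fin (n + 1)) → _) volume volume := by
  rw [← coe_reflectIso]; exact (reflectIso n).measurePreserving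

lemma measurableEmbedding_reflect :
    MeasurableEmbedding (reflect : EuclideanSpace ℝ (Fin (n + 1)) → _) := by
  rw [← coe_reflectIso]; exact (reflectIso n).toHomeomorph.measurableEmbedding

lemma continuous_reflect : Continuous (reflect : EuclideanSpace ℝ (Fin (n + 1)) → _) := by
  rw [← coe_reflectIso]; exact (reflectIso n).continuous

lemma norm_reflect (x : EuclideanSpace ℝ (Fin (n + 1))) : ‖reflect x‖ = ‖x‖ := by
  rw [← reflectIso_apply]; exact (reflectIso n).norm_map x

lemma reflect_sub (x y : EuclideanSpace ℝ (Fin (n + 1))) :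
    reflect (x - y) = reflect x - reflect y := by
  simp only [← reflectIso_apply, map_sub]

lemma reflect_zero : reflect (0 : EuclideanSpace ℝ (Fin (n + 1))) = 0 := by
  simp only [← reflectIso_apply, map_zero]

lemma dist_reflect (x y : EuclideanSpace ℝ (Fin (n + 1))) :
    dist (reflect x) (reflect y) = dist x y := by
  rw [dist_eq_norm, ← reflect_sub, norm_reflect, dist_eq_norm]

/-- Only the last coordinate matters: `(xₙ - yₙ)² ≤ (xₙ + yₙ)²` for positive `xₙ` and `yₙ`. It
bounds the image term of the kernel by the direct one and compares balls with reflected centres. -/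
lemma norm_sub_le_norm_sub_reflect {x y : EuclideanSpace ℝ (Fin (n + 1))}
    (hx : x ∈ halfSpace n) (hy : y ∈ halfSpace n) : ‖x - y‖ ≤ ‖x - reflect y‖ := by
  have hx' : 0 < x (Fin.last n) := hx
  have hy' : 0 < y (Fin.last n) := hy
  rw [EuclideanSpace.norm_eq, EuclideanSpace.norm_eq]
  refine Real.sqrt_le_sqrt (Finset.sum_le_sum fun i _ => ?_)
  simp only [PiLp.sub_apply, reflect_apply, Real.norm_eq_abs, sq_abs]
  by_cases h : i = Fin.last n
  · subst h; simp only [if_true]; nlinarith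
  · simp [h]

lemma isOpen_halfSpace : IsOpen (halfSpace n) :=
  isOpen_lt continuous_const (by fun_prop)

lemma measurableSet_halfSpace : MeasurableSet (halfSpace n) := isOpen_halfSpace.measurableSet

/-- The extension of a function on the half space with parity `σ`. -/
def symExt (σ : ℝ) (f : EuclideanSpace ℝ (Fin (n + 1)) → ℂ) :
    EuclideanSpace ℝ (Fin (n + 1)) → ℂ :=
  fun x => zeroExt f x + σ • zeroExt f (reflect x)

lemma zeroExt_eq_indicator (f : EuclideanSpace ℝ (Fin (n + 1)) → ℂ) :
    zeroExt f = (halfSpace n).indicator f := by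
  ext x
  by_cases h : x ∈ halfSpace n
  · rw [Set.indicator_of_mem h]
    exact if_pos h
  · rw [Set.indicator_of_notMem h]
    exact if_neg h

lemma symExt_one (f : EuclideanSpace ℝ (Fin (n + 1)) → ℂ) : symExt 1 f = evenExt f := by
  ext x
  rcases lt_trichotomy (x (Fin.last n)) 0 with h | h | h
  · simp [symExt, zeroExt, evenExt, h, h.not_gt]
  · simp [symExt, zeroExt, evenExt, h]
  · simp [symExt, zeroExt, evenExt, h, h.not_gt]

lemma symExt_neg_one (f : EuclideanSpace ℝ (Fin (n + 1)) → ℂ) : symExt (-1) f = oddExt f := by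
  ext x
  rcases lt_trichotomy (x (Fin.last n)) 0 with h | h | h
  · simp [symExt, zeroExt, oddExt, h, h.not_gt]
  · simp [symExt, zeroExt, oddExt, h]
  · simp [symExt, zeroExt, oddExt, h, h.not_gt]

lemma symExt_of_mem {σ : ℝ} {f : EuclideanSpace ℝ (Fin (n + 1)) → ℂ}
    {x : EuclideanSpace ℝ (Fin (n + 1))} (hx : x ∈ halfSpace n) : symExt σ f x = f x := by
  have h : 0 < x (Fin.last n) := hx
  simp [symExt, zeroExt, h, h.not_gt]

lemma symExt_reflect {σ : ℝ} (hσ : σ * σ = 1) (f : EuclideanSpace ℝ (Fin (n + 1)) → ℂ)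
    (x : EuclideanSpace ℝ (Fin (n + 1))) : symExt σ f (reflect x) = σ • symExt σ f x := by
  simp only [symExt, reflect_reflect, smul_add, smul_smul, hσ, one_smul]
  rw [add_comm]

lemma Tempered.indicator {F : EuclideanSpace ℝ (Fin (n + 1)) → ℂ} (hF : Tempered F)
    {S : Set (EuclideanSpace ℝ (Fin (n + 1)))} (hS : MeasurableSet S) :
    Tempered (S.indicator F) := by
  obtain ⟨m, hm⟩ := hF
  refine ⟨m, (hm.indicator hS).congr (Eventually.of_forall fun y => ?_)⟩
  by_cases h : y ∈ S <;> simp [h]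

lemma Tempered.comp_reflect {F : EuclideanSpace ℝ (Fin (n + 1)) → ℂ} (hF : Tempered F) :
    Tempered (fun x => F (reflect x)) := by
  obtain ⟨m, hm⟩ := hF
  refine ⟨m, ?_⟩
  have := measurePreserving_reflect.integrable_comp_of_integrable hm
  simpa only [Function.comp_def, norm_reflect] using this

lemma Tempered.const_smul {E : Type*} [NormedAddCommGroup E] [InnerProductSpace ℝ E]
    [MeasurableSpace E] [BorelSpace E] [FiniteDimensional ℝ E] {F : E → ℂ} (hF : Tempered F)
    (c : ℝ) : Tempered (c • F) := by
  obtain ⟨m, hm⟩ := hF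
  refine ⟨m, (hm.smul c).congr (Eventually.of_forall fun y => ?_)⟩
  simp only [Pi.smul_apply]
  rw [smul_comm]

lemma flow_smul {E : Type*} [NormedAddCommGroup E] [InnerProductSpace ℝ E]
    [MeasurableSpace E] [BorelSpace E] [FiniteDimensional ℝ E] (c : ℝ) (t : ℝ) (F : E → ℂ) :
    flow t (c • F) = c • flow t F := by
  ext x
  simp only [flow, Pi.smul_apply]
  rw [← integral_smul]
  congr 1; ext y
  rw [smul_comm]

lemma flow_comp_reflect (t : ℝ) (F : EuclideanSpace ℝ (Fin (n + 1)) → ℂ)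
    (x : EuclideanSpace ℝ (Fin (n + 1))) :
    flow t (fun y => F (reflect y)) x = flow t F (reflect x) := by
  unfold flow
  rw [← measurePreserving_reflect.integral_comp measurableEmbedding_reflect
    (fun y => heat t (reflect x - y) • F y)]
  congr 1; ext y
  simp only [heat, ← reflect_sub, norm_reflect]

lemma flow_symExt_reflect {σ : ℝ} (hσ : σ * σ = 1) (t : ℝ)
    (f : EuclideanSpace ℝ (Fin (n + 1)) → ℂ) (x : EuclideanSpace ℝ (Fin (n + 1))) :
    flow t (symExt σ f) (reflect x) = σ • flow t (symExt σ f) x := by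
  rw [← flow_comp_reflect]
  have : (fun y => symExt σ f (reflect y)) = σ • symExt σ f := funext fun y => symExt_reflect hσ f y
  rw [this, flow_smul, Pi.smul_apply]

/-- The reflected Gauss–Weierstrass kernel. -/
def reflKernel (σ t : ℝ) (x y : EuclideanSpace ℝ (Fin (n + 1))) : ℝ :=
  heat t (x - y) + σ * heat t (x - reflect y)

lemma zeroExt_eq_indicator_symExt (σ : ℝ) (f : EuclideanSpace ℝ (Fin (n + 1)) → ℂ) :
    zeroExt f = (halfSpace n).indicator (symExt σ f) := by
  rw [zeroExt_eq_indicator]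
  exact Set.indicator_congr fun x hx => (symExt_of_mem hx).symm

/-- The method of images: the part of the free flow coming from the lower half space is folded onto
the upper one by reflection and becomes the image term of the kernel. -/
lemma kernelOp_reflKernel {σ : ℝ} {f : EuclideanSpace ℝ (Fin (n + 1)) → ℂ}
    (hF : Tempered (symExt σ f)) {t : ℝ} (ht : 0 < t) :
    kernelOp (halfSpace n) (reflKernel σ) t f = flow t (symExt σ f) := by
  have hz : Tempered (zeroExt f) := by
    rw [zeroExt_eq_indicator_symExt σ]; exact hF.indicator measurableSet_halfSpace
  ext x
  have e0 : symExt σ f = zeroExt f + σ • fun y => zeroExt f (reflect y) := rfl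
  rw [e0, flow_add hz (hz.comp_reflect.const_smul σ) ht, flow_smul, Pi.add_apply, Pi.smul_apply,
    flow_comp_reflect]
  have e1 : flow t (zeroExt f) (reflect x) = ∫ y, heat t (x - reflect y) • zeroExt f y := by
    unfold flow
    congr 1; ext y
    congr 1
    have : reflect x - y = reflect (x - reflect y) := by rw [reflect_sub, reflect_reflect]
    simp only [heat, this, norm_reflect]
  have hint2 : Integrable fun y => heat t (x - reflect y) • zeroExt f y := by
    refine (hz.integrable_heat ht (reflect x)).congr (Eventually.of_forall fun y => ?_)
    have : reflect x - y = reflect (x - reflect y) := by rw [reflect_sub, reflect_reflect]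
    simp only [heat, this, norm_reflect]
  have hint3 : Integrable fun y => σ • (heat t (x - reflect y) • zeroExt f y) := hint2.smul σ
  rw [e1, flow, ← integral_smul, ← integral_add (hz.integrable_heat ht x) hint3, kernelOp,
    ← integral_indicator measurableSet_halfSpace]
  congr 1; ext y
  rw [zeroExt_eq_indicator]
  by_cases hy : y ∈ halfSpace n
  · simp only [Set.indicator_of_mem hy, reflKernel, Complex.real_smul]
    push_cast; ring
  · simp [Set.indicator_of_notMem hy]

lemma IsTest.zeroExt_eq {f : EuclideanSpace ℝ (Fin (n + 1)) → ℂ} (hf : IsTest (halfSpace n) f) :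
    zeroExt f = f := by
  rw [zeroExt_eq_indicator]
  refine Set.indicator_eq_self.2 ((subset_tsupport f).trans hf.2.2)

/-- A test function vanishes near the boundary, so it equals its zero extension and the reflected
copy glues smoothly with either sign. -/
lemma IsTest.contDiff_symExt {f : EuclideanSpace ℝ (Fin (n + 1)) → ℂ}
    (hf : IsTest (halfSpace n) f) (σ : ℝ) : ContDiff ℝ ∞ (symExt σ f) := by
  unfold symExt
  rw [hf.zeroExt_eq]
  have : ContDiff ℝ ∞ fun x => f (reflect x) := by
    simp_rw [← reflectIso_apply]
    exact hf.1.comp (reflectIso n).contDiff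
  exact hf.1.add (this.const_smul σ)

lemma IsTest.hasCompactSupport_symExt {f : EuclideanSpace ℝ (Fin (n + 1)) → ℂ}
    (hf : IsTest (halfSpace n) f) (σ : ℝ) : HasCompactSupport (symExt σ f) := by
  unfold symExt
  rw [hf.zeroExt_eq]
  have h : HasCompactSupport fun x => f (reflect x) := by
    simp_rw [← reflectIso_apply]
    exact hf.2.1.comp_homeomorph (reflectIso n).toHomeomorph
  exact hf.2.1.add (h.mono fun x hx h0 => hx (by simp [h0]))

end Reflection

/-! ### Cutoff functions exhausting the half space -/

section Cutoff

variable {n : ℕ}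

/-- Decay at infinity, fast enough for square integrability. -/
def Decays {d : ℕ} (ψ : EuclideanSpace ℝ (Fin d) → ℂ) : Prop :=
  ∃ C : ℝ, 0 ≤ C ∧ ∀ x, ‖ψ x‖ ≤
    C * ((1 + ‖x‖) ^ (Module.finrank ℝ (EuclideanSpace ℝ (Fin d)) + 1))⁻¹

lemma Decays.memLp {d : ℕ} {ψ : EuclideanSpace ℝ (Fin d) → ℂ} (h : Decays ψ) (hc : Continuous ψ)
    (Ω : Set (EuclideanSpace ℝ (Fin d))) : MemLp ψ 2 (volume.restrict Ω) := by
  obtain ⟨C, hC, h⟩ := h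
  refine MemLp.restrict Ω ((memLp_two_inv_one_add_norm_pow C).mono hc.aestronglyMeasurable
    (Eventually.of_forall fun x => (h x).trans (le_abs_self _)))

lemma Decays.conj {d : ℕ} {ψ : EuclideanSpace ℝ (Fin d) → ℂ} (h : Decays ψ) :
    Decays (fun x => conj (ψ x)) := by
  obtain ⟨C, hC, h⟩ := h
  exact ⟨C, hC, fun x => by simpa using h x⟩

/-- A smooth bump equal to one on the unit ball. -/
def unitBump (n : ℕ) : ContDiffBump (0 : EuclideanSpace ℝ (Fin (n + 1))) :=
  ⟨1, 2, one_pos, one_lt_two⟩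

/-- Cutoff functions exhausting the half space. -/
def cutoff (k : ℕ) (x : EuclideanSpace ℝ (Fin (n + 1))) : ℝ :=
  unitBump n (((k : ℝ) + 1)⁻¹ • x) * Real.smoothTransition (((k : ℝ) + 1) * x (Fin.last n) - 1)

lemma contDiff_cutoff (k : ℕ) : ContDiff ℝ ∞ (cutoff k : EuclideanSpace ℝ (Fin (n + 1)) → ℝ) := by
  have h : ContDiff ℝ ∞ fun x : EuclideanSpace ℝ (Fin (n + 1)) => ((k : ℝ) + 1)⁻¹ • x :=
    contDiff_id.const_smul _
  refine ContDiff.mul ((unitBump n).contDiff.comp h) ?_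
  refine Real.smoothTransition.contDiff.comp (ContDiff.sub (contDiff_const.mul ?_) contDiff_const)
  exact contDiff_piLp_apply 2

lemma cutoff_nonneg (k : ℕ) (x : EuclideanSpace ℝ (Fin (n + 1))) : 0 ≤ cutoff k x :=
  mul_nonneg (unitBump n).nonneg (Real.smoothTransition.nonneg _)

lemma cutoff_le_one (k : ℕ) (x : EuclideanSpace ℝ (Fin (n + 1))) : cutoff k x ≤ 1 :=
  mul_le_one₀ (unitBump n).le_one (Real.smoothTransition.nonneg _)
    (Real.smoothTransition.le_one _)

lemma support_cutoff_subset (k : ℕ) :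
    Function.support (cutoff k : EuclideanSpace ℝ (Fin (n + 1)) → ℝ) ⊆
      Metric.closedBall 0 (2 * ((k : ℝ) + 1)) ∩ {x | 1 ≤ ((k : ℝ) + 1) * x (Fin.last n)} := by
  intro x hx
  have hk : (0 : ℝ) < (k : ℝ) + 1 := by positivity
  constructor
  · by_contra h
    refine hx ?_
    have : unitBump n (((k : ℝ) + 1)⁻¹ • x) = 0 := by
      refine (unitBump n).zero_of_le_dist ?_
      rw [dist_zero_right, norm_smul, Real.norm_of_nonneg (by positivity), inv_mul_eq_div,
        le_div_iff₀ hk]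
      rw [Metric.mem_closedBall, dist_zero_right] at h
      exact (not_le.1 h).le
    simp [cutoff, this]
  · by_contra h
    refine hx ?_
    have : Real.smoothTransition (((k : ℝ) + 1) * x (Fin.last n) - 1) = 0 :=
      Real.smoothTransition.zero_of_nonpos (by
        have h' : ((k : ℝ) + 1) * x (Fin.last n) < 1 := not_le.1 h
        linarith)
    simp [cutoff, this]

lemma eventually_cutoff_eq_one {x : EuclideanSpace ℝ (Fin (n + 1))} (hx : x ∈ halfSpace n) :
    ∀ᶠ k : ℕ in atTop, cutoff k =ᶠ[𝓝 x] fun _ => 1 := by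
  have hx' : 0 < x (Fin.last n) := hx
  obtain ⟨N, hN⟩ := exists_nat_gt (max ‖x‖ (2 / x (Fin.last n)))
  filter_upwards [eventually_ge_atTop N] with k hk
  have hk' : max ‖x‖ (2 / x (Fin.last n)) < (k : ℝ) + 1 := by
    have : (N : ℝ) ≤ k := by exact_mod_cast hk
    linarith
  have h1 : ‖x‖ < (k : ℝ) + 1 := (le_max_left _ _).trans_lt hk'
  have h2 : 2 < ((k : ℝ) + 1) * x (Fin.last n) := by
    have := (le_max_right _ _).trans_lt hk'
    rwa [div_lt_iff₀ hx'] at this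
  have o1 : IsOpen {y : EuclideanSpace ℝ (Fin (n + 1)) | ‖y‖ < (k : ℝ) + 1} :=
    isOpen_lt continuous_norm continuous_const
  have o2 : IsOpen {y : EuclideanSpace ℝ (Fin (n + 1)) | 2 < ((k : ℝ) + 1) * y (Fin.last n)} :=
    isOpen_lt continuous_const (by fun_prop)
  filter_upwards [o1.mem_nhds h1, o2.mem_nhds h2] with y hy1 hy2
  have hk0 : (0 : ℝ) < (k : ℝ) + 1 := by positivity
  have hy1' : ‖y‖ < (k : ℝ) + 1 := hy1
  have hy2' : 2 < ((k : ℝ) + 1) * y (Fin.last n) := hy2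
  unfold cutoff
  rw [(unitBump n).one_of_mem_closedBall, Real.smoothTransition.one_of_one_le (by linarith),
    one_mul]
  rw [mem_closedBall_zero_iff, norm_smul, Real.norm_of_nonneg (by positivity), inv_mul_eq_div]
  exact (div_le_one hk0).2 hy1'.le

lemma deriv_smoothTransition_eq_zero {s : ℝ} (hs : s ∉ Set.Icc (0 : ℝ) 1) :
    deriv Real.smoothTransition s = 0 := by
  rcases lt_or_ge s 0 with h | h
  · have : Real.smoothTransition =ᶠ[𝓝 s] fun _ => 0 := by
      filter_upwards [gt_mem_nhds h] with r hr
      exact Real.smoothTransition.zero_of_nonpos hr.le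
    rw [this.deriv_eq, deriv_const]
  · have h1 : 1 < s := by
      by_contra h2
      exact hs ⟨h, not_lt.1 h2⟩
    have : Real.smoothTransition =ᶠ[𝓝 s] fun _ => 1 := by
      filter_upwards [lt_mem_nhds h1] with r hr
      exact Real.smoothTransition.one_of_one_le hr.le
    rw [this.deriv_eq, deriv_const]

-- The boundary factor has slope of order `k + 1`, but only in the layer where `(k + 1) xₙ` lies
-- between `1` and `2`; there `k + 1 ≤ 2 / xₙ`. Tangential derivatives, and all derivatives where
-- `xₙ > 2`, see only the harmless factor `unitBump`.
variable (n) in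
lemma exists_fderiv_cutoff_le : ∃ C : ℝ, 0 ≤ C ∧ ∀ (k : ℕ) (i : Fin (n + 1))
    (x : EuclideanSpace ℝ (Fin (n + 1))), x ∈ halfSpace n →
      ((i ≠ Fin.last n ∨ 2 < x (Fin.last n)) →
        |fderiv ℝ (cutoff k) x (EuclideanSpace.single i 1)| ≤ C) ∧
      |fderiv ℝ (cutoff k) x (EuclideanSpace.single i 1)| ≤ C * (1 + (x (Fin.last n))⁻¹) := by
  have hbc : Continuous (fderiv ℝ (unitBump n)) :=
    ((unitBump n).contDiff (n := 1)).continuous_fderiv (by simp)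
  obtain ⟨C₁, hC₁⟩ := hbc.bounded_above_of_compact_support
    ((unitBump n).hasCompactSupport.fderiv ℝ)
  have htc : Continuous (deriv Real.smoothTransition) :=
    (Real.smoothTransition.contDiff (n := 1)).continuous_deriv le_rfl
  obtain ⟨C₂, hC₂⟩ := htc.bounded_above_of_compact_support
    (HasCompactSupport.intro (isCompact_Icc (a := (0 : ℝ)) (b := 1))
      fun s hs => deriv_smoothTransition_eq_zero hs)
  have hC₁0 : 0 ≤ C₁ := (norm_nonneg _).trans (hC₁ 0)
  have hC₂0 : 0 ≤ C₂ := (norm_nonneg _).trans (hC₂ 0)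
  refine ⟨C₁ + 2 * C₂, by positivity, fun k i x hx => ?_⟩
  have hx' : 0 < x (Fin.last n) := hx
  have hk0 : (0 : ℝ) < (k : ℝ) + 1 := by positivity
  set K : ℝ := (k : ℝ) + 1 with hK
  set s : ℝ := K * x (Fin.last n) - 1 with hs
  have d1 : HasFDerivAt (fun y => unitBump n (K⁻¹ • y))
      ((fderiv ℝ (unitBump n) (K⁻¹ • x)).comp
        (K⁻¹ • ContinuousLinearMap.id ℝ (EuclideanSpace ℝ (Fin (n + 1))))) x := by
    have h1 : HasFDerivAt (unitBump n) (fderiv ℝ (unitBump n) (K⁻¹ • x)) (K⁻¹ • x) :=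
      (((unitBump n).contDiff (n := 1)).differentiable (by simp) _).hasFDerivAt
    have h2 : HasFDerivAt (fun y : EuclideanSpace ℝ (Fin (n + 1)) => K⁻¹ • y)
        (K⁻¹ • ContinuousLinearMap.id ℝ (EuclideanSpace ℝ (Fin (n + 1)))) x :=
      (hasFDerivAt_id x).const_smul K⁻¹
    exact h1.comp x h2
  have d2 : HasFDerivAt (fun y : EuclideanSpace ℝ (Fin (n + 1)) =>
      Real.smoothTransition (K * y (Fin.last n) - 1))
      (deriv Real.smoothTransition s • (K • (EuclideanSpace.proj (Fin.last n) : EuclideanSpace ℝ (Fin (n + 1)) →L[ℝ] ℝ))) x := by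
    have h1 : HasDerivAt Real.smoothTransition (deriv Real.smoothTransition s) s :=
      ((Real.smoothTransition.contDiff (n := 1)).differentiable (by simp) _).hasDerivAt
    have h2 : HasFDerivAt (fun y : EuclideanSpace ℝ (Fin (n + 1)) => K * y (Fin.last n) - 1)
        (K • (EuclideanSpace.proj (Fin.last n) : EuclideanSpace ℝ (Fin (n + 1)) →L[ℝ] ℝ)) x :=
      ((EuclideanSpace.proj (Fin.last n) :
        EuclideanSpace ℝ (Fin (n + 1)) →L[ℝ] ℝ).hasFDerivAt.const_mul K).sub_const 1
    exact h1.comp_hasFDerivAt x h2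
  have e : fderiv ℝ (cutoff k) x (EuclideanSpace.single i 1) =
      unitBump n (K⁻¹ • x) * (deriv Real.smoothTransition s *
        (K * (EuclideanSpace.single i (1 : ℝ) : EuclideanSpace ℝ (Fin (n + 1))) (Fin.last n))) +
      Real.smoothTransition s * (K⁻¹ * fderiv ℝ (unitBump n) (K⁻¹ • x)
        (EuclideanSpace.single i 1)) := by
    have h : HasFDerivAt (cutoff k) _ x := d1.mul d2
    rw [h.fderiv]
    simp [hs]
    exact Or.inl rfl
  have b1 : |Real.smoothTransition s * (K⁻¹ * fderiv ℝ (unitBump n) (K⁻¹ • x)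
        (EuclideanSpace.single i 1))| ≤ C₁ := by
    rw [abs_mul, abs_mul, abs_of_nonneg (Real.smoothTransition.nonneg _),
      abs_of_pos (inv_pos.2 hk0)]
    have h1 : |fderiv ℝ (unitBump n) (K⁻¹ • x) (EuclideanSpace.single i 1)| ≤ C₁ := by
      rw [← Real.norm_eq_abs]
      refine (ContinuousLinearMap.le_opNorm _ _).trans ?_
      simpa using hC₁ (K⁻¹ • x)
    have h2 : K⁻¹ ≤ 1 := inv_le_one_of_one_le₀ (by rw [hK]; linarith [(k.cast_nonneg : (0 : ℝ) ≤ k)])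
    calc _ ≤ 1 * (1 * C₁) := by
          gcongr
          exact Real.smoothTransition.le_one _
      _ = C₁ := by ring
  have b2 : |unitBump n (K⁻¹ • x) * (deriv Real.smoothTransition s *
        (K * (EuclideanSpace.single i (1 : ℝ) : EuclideanSpace ℝ (Fin (n + 1))) (Fin.last n)))| ≤
      2 * C₂ * (x (Fin.last n))⁻¹ := by
    by_cases hs1 : s ∈ Set.Icc (0 : ℝ) 1
    · have h1 : K ≤ 2 * (x (Fin.last n))⁻¹ := by
        rw [← div_eq_mul_inv, le_div_iff₀ hx']
        linarith [hs1.2]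
      rw [abs_mul, abs_mul, abs_mul, abs_of_nonneg (unitBump n).nonneg, abs_of_pos hk0]
      have h2 : |(EuclideanSpace.single i (1 : ℝ) : EuclideanSpace ℝ (Fin (n + 1))) (Fin.last n)|
          ≤ 1 := by
        rw [PiLp.single_apply]; split_ifs <;> simp
      calc _ ≤ 1 * (C₂ * (2 * (x (Fin.last n))⁻¹ * 1)) := by
            gcongr
            · exact (unitBump n).le_one
            · exact hC₂ s
        _ = _ := by ring
    · rw [deriv_smoothTransition_eq_zero hs1]
      simp only [zero_mul, mul_zero, abs_zero]
      positivity
  rw [e]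
  constructor
  · intro h
    have h0 : unitBump n (K⁻¹ • x) * (deriv Real.smoothTransition s *
        (K * (EuclideanSpace.single i (1 : ℝ) : EuclideanSpace ℝ (Fin (n + 1))) (Fin.last n))) = 0 := by
      rcases h with h | h
      · rw [PiLp.single_apply, if_neg (fun h' => h h'.symm)]; simp
      · rw [deriv_smoothTransition_eq_zero]
        · simp
        · intro h'
          have : 1 ≤ K := by rw [hK]; linarith [(k.cast_nonneg : (0 : ℝ) ≤ k)]
          nlinarith [h'.2]
    rw [h0, zero_add]
    linarith
  · refine (abs_add_le _ _).trans ?_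
    have : 0 < (x (Fin.last n))⁻¹ := inv_pos.2 hx'
    nlinarith [mul_nonneg hC₁0 this.le]

end Cutoff

/-! ### Membership in the Sobolev spaces and integration by parts -/

section Approximation

variable {n : ℕ}

/-- Mean value inequality along the vertical segment from the boundary. Linear vanishing compensates
the factor `1 / xₙ` in the derivative of the cutoff; the power of `3` accounts for moving by at most
`2`. -/
lemma norm_le_last_mul {ψ : EuclideanSpace ℝ (Fin (n + 1)) → ℂ} (hψ : ContDiff ℝ ∞ ψ)
    (h0 : ∀ x, x (Fin.last n) = 0 → ψ x = 0) (hd : Decays (partialDeriv (Fin.last n) ψ)) :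
    ∃ C : ℝ, 0 ≤ C ∧ ∀ x ∈ halfSpace n, x (Fin.last n) ≤ 2 → ‖ψ x‖ ≤ x (Fin.last n) *
      (C * ((1 + ‖x‖) ^ (Module.finrank ℝ (EuclideanSpace ℝ (Fin (n + 1))) + 1))⁻¹) := by
  obtain ⟨C, hC, hd⟩ := hd
  set D := Module.finrank ℝ (EuclideanSpace ℝ (Fin (n + 1))) + 1
  refine ⟨C * 3 ^ D, by positivity, fun x hx hx2 => ?_⟩
  have hx0 : 0 < x (Fin.last n) := hx
  set e : EuclideanSpace ℝ (Fin (n + 1)) := EuclideanSpace.single (Fin.last n) 1 with he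
  set γ : ℝ → EuclideanSpace ℝ (Fin (n + 1)) := fun s => x + (s - x (Fin.last n)) • e with hγ
  have hγd : ∀ s, HasDerivAt γ e s := fun s => by
    have : HasDerivAt γ ((1 : ℝ) • e) s :=
      (((hasDerivAt_id s).sub_const (x (Fin.last n))).smul_const e).const_add x
    rwa [one_smul] at this
  have hd' : ∀ s, HasDerivAt (fun s => ψ (γ s)) (partialDeriv (Fin.last n) ψ (γ s)) s := fun s =>
    ((hψ.differentiable (by simp)) (γ s)).hasFDerivAt.comp_hasDerivAt s (hγd s)
  have hb : ∀ s ∈ Set.Icc 0 (x (Fin.last n)), ‖partialDeriv (Fin.last n) ψ (γ s)‖ ≤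
      C * 3 ^ D * ((1 + ‖x‖) ^ D)⁻¹ := by
    intro s hs
    refine (hd _).trans ?_
    have h1 : ‖x‖ ≤ ‖γ s‖ + 2 := by
      have : x = γ s - (s - x (Fin.last n)) • e := by simp [hγ]
      have h2 : ‖(s - x (Fin.last n)) • e‖ ≤ 2 := by
        rw [norm_smul, he, PiLp.norm_single, norm_one, mul_one, Real.norm_eq_abs, abs_le]
        constructor <;> linarith [hs.1, hs.2]
      calc ‖x‖ = ‖γ s - (s - x (Fin.last n)) • e‖ := by rw [← this]
        _ ≤ _ := (norm_sub_le _ _).trans (by gcongr)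
    rw [mul_assoc]
    gcongr
    rw [← div_eq_mul_inv, le_div_iff₀ (by positivity), inv_mul_le_iff₀ (by positivity), mul_comm,
      ← mul_pow]
    gcongr
    nlinarith [norm_nonneg (γ s)]
  have := (convex_Icc 0 (x (Fin.last n))).norm_image_sub_le_of_norm_hasDerivWithin_le
    (fun s _ => (hd' s).hasDerivWithinAt) hb (Set.left_mem_Icc.2 hx0.le) (Set.right_mem_Icc.2 hx0.le)
  have hz : ψ (γ 0) = 0 := h0 _ (by simp [hγ, he])
  have hg : γ (x (Fin.last n)) = x := by simp [hγ]
  simp only at this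
  rw [hz, hg, sub_zero, sub_zero, Real.norm_of_nonneg hx0.le, mul_comm] at this
  exact this

lemma isTest_cutoff_smul {ψ : EuclideanSpace ℝ (Fin (n + 1)) → ℂ} (hψ : ContDiff ℝ ∞ ψ) (k : ℕ) :
    IsTest (halfSpace n) (fun x => cutoff k x • ψ x) := by
  have hk : (0 : ℝ) < (k : ℝ) + 1 := by positivity
  have hcl : IsClosed {x : EuclideanSpace ℝ (Fin (n + 1)) | 1 ≤ ((k : ℝ) + 1) * x (Fin.last n)} :=
    isClosed_le continuous_const (by fun_prop)
  have hK : IsCompact (Metric.closedBall (0 : EuclideanSpace ℝ (Fin (n + 1))) (2 * ((k : ℝ) + 1)) ∩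
      {x | 1 ≤ ((k : ℝ) + 1) * x (Fin.last n)}) := (isCompact_closedBall _ _).inter_right hcl
  have hs : Function.support (fun x => cutoff k x • ψ x) ⊆
      Metric.closedBall (0 : EuclideanSpace ℝ (Fin (n + 1))) (2 * ((k : ℝ) + 1)) ∩
      {x | 1 ≤ ((k : ℝ) + 1) * x (Fin.last n)} :=
    (Function.support_smul_subset_left _ _).trans (support_cutoff_subset k)
  refine ⟨(contDiff_cutoff k).smul hψ, HasCompactSupport.of_support_subset_isCompact hK hs, ?_⟩
  refine (closure_minimal hs hK.isClosed).trans fun x hx => ?_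
  have h1 : 1 ≤ ((k : ℝ) + 1) * x (Fin.last n) := hx.2
  have : 0 < x (Fin.last n) := by
    by_contra h
    nlinarith [not_lt.1 h]
  exact this

lemma tendsto_eLpNorm_cutoff_smul_sub {ψ : EuclideanSpace ℝ (Fin (n + 1)) → ℂ}
    (hψ : Continuous ψ) (hd : Decays ψ) :
    Tendsto (fun k : ℕ => eLpNorm ((fun x => cutoff k x • ψ x) - ψ) 2
      (volume.restrict (halfSpace n))) atTop (𝓝 0) := by
  obtain ⟨C, hC, hd⟩ := hd
  refine tendsto_eLpNorm_two_of_dominated ((memLp_two_inv_one_add_norm_pow C).restrict _)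
    (Eventually.of_forall fun k => ?_) (Eventually.of_forall fun k => ae_of_all _ fun x => ?_) ?_
  · exact (((contDiff_cutoff k).continuous.smul hψ).sub hψ).measurable
  · refine le_trans ?_ (hd x)
    have : cutoff k x • ψ x - ψ x = (cutoff k x - 1) • ψ x := by rw [sub_smul, one_smul]
    rw [Pi.sub_apply, this, norm_smul]
    refine mul_le_of_le_one_left (norm_nonneg _) ?_
    rw [Real.norm_eq_abs, abs_le]
    constructor <;> linarith [cutoff_nonneg k x, cutoff_le_one k x]
  · filter_upwards [ae_restrict_mem measurableSet_halfSpace] with x hx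
    refine tendsto_const_nhds.congr' ?_
    filter_upwards [eventually_cutoff_eq_one hx] with k hk
    simp [hk.self_of_nhds]

lemma partialDeriv_cutoff_smul {ψ : EuclideanSpace ℝ (Fin (n + 1)) → ℂ} (hψ : ContDiff ℝ ∞ ψ)
    (k : ℕ) (i : Fin (n + 1)) (x : EuclideanSpace ℝ (Fin (n + 1))) :
    partialDeriv i (fun x => cutoff k x • ψ x) x = cutoff k x • partialDeriv i ψ x +
      fderiv ℝ (cutoff k) x (EuclideanSpace.single i 1) • ψ x := by
  have h1 := ((contDiff_cutoff (n := n) k).differentiable (by simp) x).hasFDerivAt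
  have h2 := (hψ.differentiable (by simp) x).hasFDerivAt
  unfold partialDeriv
  have h : HasFDerivAt (fun x => cutoff k x • ψ x) _ x := h1.smul h2
  rw [h.fderiv]
  simp

/-- The term in which the derivative falls on the cutoff is dominated uniformly in `k`, either
because the direction is tangential or because `ψ` vanishes linearly at the boundary. At each point
of the half space it is eventually zero, so dominated convergence applies. -/
lemma tendsto_eLpNorm_partialDeriv_cutoff_smul_sub {ψ : EuclideanSpace ℝ (Fin (n + 1)) → ℂ}
    (hψ : ContDiff ℝ ∞ ψ) (hd : Decays ψ) (i : Fin (n + 1)) (hdi : Decays (partialDeriv i ψ))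
    (hi : i ≠ Fin.last n ∨ ∀ x, x (Fin.last n) = 0 → ψ x = 0) :
    Tendsto (fun k : ℕ => eLpNorm (partialDeriv i (fun x => cutoff k x • ψ x) - partialDeriv i ψ) 2
      (volume.restrict (halfSpace n))) atTop (𝓝 0) := by
  obtain ⟨A, hA, hcut⟩ := exists_fderiv_cutoff_le n
  set D := Module.finrank ℝ (EuclideanSpace ℝ (Fin (n + 1))) + 1 with hD
  obtain ⟨B, hB, hbd⟩ : ∃ B : ℝ, 0 ≤ B ∧ ∀ (k : ℕ), ∀ x ∈ halfSpace n,
      ‖fderiv ℝ (cutoff k) x (EuclideanSpace.single i 1) • ψ x‖ ≤ B * ((1 + ‖x‖) ^ D)⁻¹ := by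
    obtain ⟨C, hC, hd⟩ := hd
    by_cases hil : i = Fin.last n
    · have h0 := hi.resolve_left (not_not.2 hil)
      subst hil
      obtain ⟨C', hC', hb⟩ := norm_le_last_mul hψ h0 hdi
      refine ⟨A * C + 3 * A * C', by positivity, fun k x hx => ?_⟩
      have hx0 : 0 < x (Fin.last n) := hx
      have hw : 0 < ((1 + ‖x‖) ^ D)⁻¹ := by positivity
      rw [norm_smul, Real.norm_eq_abs]
      rcases le_or_gt (x (Fin.last n)) 2 with h2 | h2
      · calc _ ≤ (A * (1 + (x (Fin.last n))⁻¹)) * (x (Fin.last n) *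
              (C' * ((1 + ‖x‖) ^ D)⁻¹)) := by
              gcongr
              · exact (hcut k _ x hx).2
              · exact hb x hx h2
          _ = A * (x (Fin.last n) + 1) * (C' * ((1 + ‖x‖) ^ D)⁻¹) := by
              field_simp
          _ ≤ A * (2 + 1) * (C' * ((1 + ‖x‖) ^ D)⁻¹) := by gcongr
          _ ≤ _ := by nlinarith [mul_nonneg (mul_nonneg hA hC) hw.le]
      · calc _ ≤ A * (C * ((1 + ‖x‖) ^ D)⁻¹) := by
              gcongr
              · exact (hcut k _ x hx).1 (Or.inr h2)
              · exact hd x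
          _ ≤ _ := by nlinarith [mul_nonneg (mul_nonneg hA hC') hw.le]
    · refine ⟨A * C, by positivity, fun k x hx => ?_⟩
      rw [norm_smul, Real.norm_eq_abs, mul_assoc]
      gcongr
      · exact (hcut k _ x hx).1 (Or.inl hil)
      · exact hd x
  obtain ⟨C, hC, hdi⟩ := hdi
  refine tendsto_eLpNorm_two_of_dominated ((memLp_two_inv_one_add_norm_pow (C + B)).restrict _)
    (Eventually.of_forall fun k => ?_) (Eventually.of_forall fun k => ?_) ?_
  · exact ((contDiff_partialDeriv ((contDiff_cutoff k).smul hψ) i).continuous.sub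
      (contDiff_partialDeriv hψ i).continuous).measurable
  · filter_upwards [ae_restrict_mem measurableSet_halfSpace] with x hx
    rw [Pi.sub_apply, partialDeriv_cutoff_smul hψ]
    have : cutoff k x • partialDeriv i ψ x +
        fderiv ℝ (cutoff k) x (EuclideanSpace.single i 1) • ψ x - partialDeriv i ψ x =
        (cutoff k x - 1) • partialDeriv i ψ x +
          fderiv ℝ (cutoff k) x (EuclideanSpace.single i 1) • ψ x := by
      rw [sub_smul, one_smul]; abel
    rw [this, add_mul]
    refine (norm_add_le _ _).trans (add_le_add ?_ (hbd k x hx))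
    refine le_trans ?_ (hdi x)
    rw [norm_smul]
    refine mul_le_of_le_one_left (norm_nonneg _) ?_
    rw [Real.norm_eq_abs, abs_le]
    constructor <;> linarith [cutoff_nonneg k x, cutoff_le_one k x]
  · filter_upwards [ae_restrict_mem measurableSet_halfSpace] with x hx
    refine tendsto_const_nhds.congr' ?_
    filter_upwards [eventually_cutoff_eq_one hx] with k hk
    rw [Pi.sub_apply, partialDeriv_cutoff_smul hψ, hk.fderiv_eq, hk.self_of_nhds]
    simp

lemma W120_of_decays {ψ : EuclideanSpace ℝ (Fin (n + 1)) → ℂ} (hψ : ContDiff ℝ ∞ ψ)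
    (hd : Decays ψ) (hdi : ∀ i, Decays (partialDeriv i ψ))
    (h0 : ∀ x, x (Fin.last n) = 0 → ψ x = 0) :
    W120 (halfSpace n) ψ (fun i => partialDeriv i ψ) :=
  ⟨hd.memLp hψ.continuous _, fun i => (hdi i).memLp (contDiff_partialDeriv hψ i).continuous _,
    fun k x => cutoff k x • ψ x, fun k => isTest_cutoff_smul hψ k,
    tendsto_eLpNorm_cutoff_smul_sub hψ.continuous hd, fun i =>
      tendsto_eLpNorm_partialDeriv_cutoff_smul_sub hψ hd i (hdi i) (Or.inr h0)⟩

lemma IsTest.partialDeriv {d : ℕ} {Ω : Set (EuclideanSpace ℝ (Fin d))}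
    {φ : EuclideanSpace ℝ (Fin d) → ℂ} (h : IsTest Ω φ) (i : Fin d) :
    IsTest Ω (partialDeriv i φ) :=
  ⟨contDiff_partialDeriv h.1 i, hasCompactSupport_partialDeriv h.2.1 i,
    (tsupport_fderiv_apply_subset ℝ _).trans h.2.2⟩

lemma IsTest.memLp {d : ℕ} {Ω : Set (EuclideanSpace ℝ (Fin d))}
    {φ : EuclideanSpace ℝ (Fin d) → ℂ} (h : IsTest Ω φ) : MemLp φ 2 (volume.restrict Ω) :=
  (h.1.continuous.memLp_of_hasCompactSupport h.2.1).restrict _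

lemma IsTest.setIntegral_mul {d : ℕ} {Ω : Set (EuclideanSpace ℝ (Fin d))}
    {φ : EuclideanSpace ℝ (Fin d) → ℂ} (h : IsTest Ω φ) (ψ : EuclideanSpace ℝ (Fin d) → ℂ) :
    ∫ x in Ω, ψ x * φ x = ∫ x, ψ x * φ x := by
  refine setIntegral_eq_integral_of_forall_compl_eq_zero fun x hx => ?_
  have : φ x = 0 := by
    by_contra h0
    exact hx (h.2.2 (subset_tsupport φ h0))
  rw [this, mul_zero]

lemma IsTest.integral_mul_partialDeriv {d : ℕ} {Ω : Set (EuclideanSpace ℝ (Fin d))}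
    {φ ψ : EuclideanSpace ℝ (Fin d) → ℂ} (h : IsTest Ω φ) (hψ : ContDiff ℝ ∞ ψ) (i : Fin d) :
    ∫ x in Ω, ψ x * HalfSpaceBMO.partialDeriv i φ x =
      -∫ x in Ω, HalfSpaceBMO.partialDeriv i ψ x * φ x := by
  rw [(h.partialDeriv i).setIntegral_mul, h.setIntegral_mul]
  have hi := h.partialDeriv i
  refine integral_mul_fderiv_eq_neg_fderiv_mul_of_integrable ?_ ?_ ?_ ?_ ?_
  · exact Continuous.integrable_of_hasCompactSupport
      ((contDiff_partialDeriv hψ i).continuous.mul h.1.continuous) h.2.1.mul_left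
  · exact Continuous.integrable_of_hasCompactSupport
      (hψ.continuous.mul hi.1.continuous) hi.2.1.mul_left
  · exact Continuous.integrable_of_hasCompactSupport
      (hψ.continuous.mul h.1.continuous) h.2.1.mul_left
  · exact fun x _ => hψ.differentiable (by simp) x
  · exact fun x _ => h.1.differentiable (by simp) x

lemma W12_of_decays {ψ : EuclideanSpace ℝ (Fin (n + 1)) → ℂ} (hψ : ContDiff ℝ ∞ ψ)
    (hd : Decays ψ) (hdi : ∀ i, Decays (partialDeriv i ψ)) :
    W12 (halfSpace n) ψ (fun i => partialDeriv i ψ) :=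
  ⟨hd.memLp hψ.continuous _, fun i => (hdi i).memLp (contDiff_partialDeriv hψ i).continuous _,
    fun _ hφ i => hφ.integral_mul_partialDeriv hψ i⟩

/-- No boundary term appears, whatever the boundary values of `b`, since `v` is a limit of test
functions for which the formula is classical. -/
lemma W120.integral_mul {v : EuclideanSpace ℝ (Fin (n + 1)) → ℂ}
    {H : Fin (n + 1) → EuclideanSpace ℝ (Fin (n + 1)) → ℂ} (hv : W120 (halfSpace n) v H)
    {b : EuclideanSpace ℝ (Fin (n + 1)) → ℂ} (hb : ContDiff ℝ ∞ b) (hd : Decays b)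
    (i : Fin (n + 1)) (hdi : Decays (partialDeriv i b)) :
    ∫ x in halfSpace n, b x * H i x = -∫ x in halfSpace n, partialDeriv i b x * v x := by
  obtain ⟨hv2, hH2, φ, hφ, h0, h1⟩ := hv
  have t1 := tendsto_integral_mul_of_tendsto_eLpNorm (hd.memLp hb.continuous (halfSpace n)) (hH2 i)
    (fun k => ((hφ k).partialDeriv i).memLp) (h1 i)
  have t2 := tendsto_integral_mul_of_tendsto_eLpNorm
    (hdi.memLp (contDiff_partialDeriv hb i).continuous (halfSpace n)) hv2
    (fun k => (hφ k).memLp) h0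
  refine tendsto_nhds_unique t1 (t2.neg.congr fun k => ?_)
  exact ((hφ k).integral_mul_partialDeriv hb i).symm

/-- Here `b` rather than `v` is approximated, by its cutoffs, which are admissible in the weak
formulation. In the normal direction this needs `b = 0` on the boundary: with `b` the normal
derivative of the flow, this is the Neumann condition. -/
lemma W12.integral_mul {v : EuclideanSpace ℝ (Fin (n + 1)) → ℂ}
    {H : Fin (n + 1) → EuclideanSpace ℝ (Fin (n + 1)) → ℂ} (hv : W12 (halfSpace n) v H)
    {b : EuclideanSpace ℝ (Fin (n + 1)) → ℂ} (hb : ContDiff ℝ ∞ b) (hd : Decays b)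
    (i : Fin (n + 1)) (hdi : Decays (partialDeriv i b))
    (hi : i ≠ Fin.last n ∨ ∀ x, x (Fin.last n) = 0 → b x = 0) :
    ∫ x in halfSpace n, b x * H i x = -∫ x in halfSpace n, partialDeriv i b x * v x := by
  obtain ⟨hv2, hH2, hw⟩ := hv
  have hφ := isTest_cutoff_smul (n := n) hb
  have t1 := tendsto_integral_mul_of_tendsto_eLpNorm (hH2 i) (hd.memLp hb.continuous (halfSpace n))
    (fun k => (hφ k).memLp) (tendsto_eLpNorm_cutoff_smul_sub hb.continuous hd)
  have t2 := tendsto_integral_mul_of_tendsto_eLpNorm hv2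
    (hdi.memLp (contDiff_partialDeriv hb i).continuous (halfSpace n))
    (fun k => ((hφ k).partialDeriv i).memLp)
    (tendsto_eLpNorm_partialDeriv_cutoff_smul_sub hb hd i hdi hi)
  have := tendsto_nhds_unique t1 (t2.neg.congr fun k => by rw [hw _ (hφ k) i, neg_neg])
  calc _ = ∫ x in halfSpace n, H i x * b x := by simp_rw [mul_comm]
    _ = _ := by rw [this]; simp_rw [mul_comm]

lemma partialDeriv_conj {d : ℕ} {ψ : EuclideanSpace ℝ (Fin d) → ℂ} (hψ : ContDiff ℝ ∞ ψ)
    (i : Fin d) (x : EuclideanSpace ℝ (Fin d)) :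
    partialDeriv i (fun y => conj (ψ y)) x = conj (partialDeriv i ψ x) := by
  have h := (hψ.differentiable (by simp) x).hasFDerivAt
  have h2 : HasFDerivAt (fun y => conj (ψ y))
      ((Complex.conjCLE : ℂ →L[ℝ] ℂ).comp (fderiv ℝ ψ x)) x :=
    (Complex.conjCLE : ℂ →L[ℝ] ℂ).hasFDerivAt.comp x h
  unfold partialDeriv
  rw [h2.fderiv]
  simp

end Approximation

/-! ### The reflected Gaussians are heat kernels -/

section HeatKernel

variable {n : ℕ}

lemma tempered_of_hasCompactSupport {E : Type*} [NormedAddCommGroup E] [InnerProductSpace ℝ E]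
    [MeasurableSpace E] [BorelSpace E] [FiniteDimensional ℝ E] {G : E → ℂ} (hG : Continuous G)
    (hc : HasCompactSupport G) : Tempered G :=
  ⟨0, by simpa using hG.integrable_of_hasCompactSupport hc⟩

lemma lap_flow {d : ℕ} {G : EuclideanSpace ℝ (Fin d) → ℂ} (hG : ContDiff ℝ ∞ G)
    (hc : HasCompactSupport G) {t : ℝ} (ht : 0 < t) : lap (flow t G) = flow t (lap G) := by
  ext x
  have h1 : ∀ i, partialDeriv i (partialDeriv i (flow t G)) =
      flow t (partialDeriv i (partialDeriv i G)) := fun i => by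
    rw [partialDeriv_flow hG hc, partialDeriv_flow (contDiff_partialDeriv hG i)
      (hasCompactSupport_partialDeriv hc i)]
  simp only [lap, h1]
  simp only [flow, lap, Finset.smul_sum]
  rw [integral_finsetSum]
  intro i _
  exact (tempered_of_hasCompactSupport
    (contDiff_partialDeriv (contDiff_partialDeriv hG i) i).continuous
    (hasCompactSupport_partialDeriv (hasCompactSupport_partialDeriv hc i) i)).integrable_heat ht x

lemma decays_flow {d : ℕ} {G : EuclideanSpace ℝ (Fin d) → ℂ} (hG : Continuous G)
    (hc : HasCompactSupport G) {t : ℝ} (ht : 0 < t) : Decays (flow t G) := by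
  obtain ⟨C, hC, h⟩ := exists_norm_flow_le_inv_pow hG hc t
    (Module.finrank ℝ (EuclideanSpace ℝ (Fin d)) + 1)
  exact ⟨C, hC, h t ht le_rfl⟩

lemma setIntegral_mul_conj {d : ℕ} (Ω : Set (EuclideanSpace ℝ (Fin d)))
    (a b : EuclideanSpace ℝ (Fin d) → ℂ) :
    ∫ x in Ω, a x * conj (b x) = conj (∫ x in Ω, conj (a x) * b x) := by
  rw [← integral_conj]
  simp

/-- It reduces the form identity to Green's formula in each coordinate separately, in the order of
conjugation used by the integration by parts lemmas. -/
lemma laplaceGraph_of_integral_mul {d : ℕ} {Ω : Set (EuclideanSpace ℝ (Fin d))}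
    {V : (EuclideanSpace ℝ (Fin d) → ℂ) → (Fin d → EuclideanSpace ℝ (Fin d) → ℂ) → Prop}
    {u : EuclideanSpace ℝ (Fin d) → ℂ}
    (hd : ∀ i, MemLp (partialDeriv i (partialDeriv i u)) 2 (volume.restrict Ω))
    (hV : V u (fun i => partialDeriv i u)) (hL : ∀ v H, V v H → MemLp v 2 (volume.restrict Ω))
    (hi : ∀ v H, V v H → ∀ i, ∫ x in Ω, conj (partialDeriv i u x) * H i x =
      -∫ x in Ω, conj (partialDeriv i (partialDeriv i u) x) * v x) :
    LaplaceGraph Ω V u (-lap u) := by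
  refine ⟨MemLp.neg (memLp_finsetSum _ fun i _ => hd i), _, hV, fun v H hv => ?_⟩
  have h1 : ∀ i, Integrable (fun x => partialDeriv i (partialDeriv i u) x * conj (v x))
      (volume.restrict Ω) := fun i => (hd i).integrable_mul (hL v H hv).star
  have h2 : ∀ i, ∫ x in Ω, partialDeriv i u x * conj (H i x) =
      -∫ x in Ω, partialDeriv i (partialDeriv i u) x * conj (v x) := fun i => by
    rw [setIntegral_mul_conj, hi v H hv i, map_neg, setIntegral_mul_conj]
  simp_rw [h2]
  rw [Finset.sum_neg_distrib, ← integral_finsetSum _ fun i _ => h1 i, ← integral_neg]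
  congr 1; ext x
  simp only [lap, Pi.neg_apply, neg_mul, Finset.sum_mul]

variable {σ : ℝ} {f : EuclideanSpace ℝ (Fin (n + 1)) → ℂ}

lemma reflect_eq_self {x : EuclideanSpace ℝ (Fin (n + 1))} (hx : x (Fin.last n) = 0) :
    reflect x = x := by
  ext i
  rw [reflect_apply]
  split_ifs with h
  · subst h; rw [hx, neg_zero]
  · rfl

lemma reflect_single_last (a : ℝ) :
    reflect (EuclideanSpace.single (Fin.last n) a) = -EuclideanSpace.single (Fin.last n) a := by
  ext i
  rw [reflect_apply]
  split_ifs with h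
  · subst h; simp
  · simp [h]

/-- By the chain rule at a point fixed by the reflection, the normal derivative equals its own
negative. -/
lemma partialDeriv_last_eq_zero {u : EuclideanSpace ℝ (Fin (n + 1)) → ℂ} (hu : ContDiff ℝ ∞ u)
    (he : ∀ x, u (reflect x) = u x) {x : EuclideanSpace ℝ (Fin (n + 1))}
    (hx : x (Fin.last n) = 0) : partialDeriv (Fin.last n) u x = 0 := by
  have h1 : HasFDerivAt u (fderiv ℝ u x) x := (hu.differentiable (by simp) x).hasFDerivAt
  have h2 : HasFDerivAt (fun y => u (reflectIso n y))
      ((fderiv ℝ u x).comp ((reflectIso n : EuclideanSpace ℝ (Fin (n + 1)) →L[ℝ] _))) x := by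
    have h3 : HasFDerivAt u (fderiv ℝ u x) (reflectIso n x) := by
      rw [reflectIso_apply, reflect_eq_self hx]; exact h1
    exact h3.comp x (reflectIso n).toContinuousLinearEquiv.hasFDerivAt
  have h4 : (fun y => u (reflectIso n y)) = u := funext fun y => by rw [reflectIso_apply, he]
  rw [h4] at h2
  have h5 := congrArg (fun L => L (EuclideanSpace.single (Fin.last n) 1)) (h1.unique h2)
  have h6 : reflectIso n (EuclideanSpace.single (Fin.last n) (1 : ℝ)) =
      -EuclideanSpace.single (Fin.last n) 1 := by rw [reflectIso_apply, reflect_single_last]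
  simp only [ContinuousLinearMap.comp_apply] at h5
  change _ = fderiv ℝ u x (reflectIso n (EuclideanSpace.single (Fin.last n) (1 : ℝ))) at h5
  rw [h6, map_neg] at h5
  exact self_eq_neg.1 h5

/-- The flow keeps the odd parity, so it vanishes on the boundary and lies in the Dirichlet form
domain. -/
lemma laplaceGraph_dirichlet_flow (hf : IsTest (halfSpace n) f) {t : ℝ} (ht : 0 < t) :
    LaplaceGraph (halfSpace n) (W120 (halfSpace n)) (flow t (symExt (-1) f))
      (-lap (flow t (symExt (-1) f))) := by
  have hG := hf.contDiff_symExt (-1)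
  have hc := hf.hasCompactSupport_symExt (-1)
  have hu := contDiff_flow hG hc t
  have d1 : ∀ i, Decays (partialDeriv i (flow t (symExt (-1) f))) := fun i => by
    rw [partialDeriv_flow hG hc]
    exact decays_flow (contDiff_partialDeriv hG i).continuous
      (hasCompactSupport_partialDeriv hc i) ht
  have d2 : ∀ i, Decays (partialDeriv i (partialDeriv i (flow t (symExt (-1) f)))) := fun i => by
    rw [partialDeriv_flow hG hc, partialDeriv_flow (contDiff_partialDeriv hG i)
      (hasCompactSupport_partialDeriv hc i)]
    exact decays_flow (contDiff_partialDeriv (contDiff_partialDeriv hG i) i).continuous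
      (hasCompactSupport_partialDeriv (hasCompactSupport_partialDeriv hc i) i) ht
  have hp := fun i => contDiff_partialDeriv hu i
  refine laplaceGraph_of_integral_mul
    (fun i => (d2 i).memLp (contDiff_partialDeriv (hp i) i).continuous _)
    (W120_of_decays hu (decays_flow hG.continuous hc ht) d1 fun x hx => ?_) (fun v H hv => hv.1)
    fun v H hv i => ?_
  · have h := flow_symExt_reflect (σ := -1) (by norm_num) t f x
    rw [reflect_eq_self hx, neg_one_smul] at h
    exact self_eq_neg.1 h
  · have hb : ContDiff ℝ ∞ fun x => conj (partialDeriv i (flow t (symExt (-1) f)) x) :=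
      (Complex.conjCLE : ℂ →L[ℝ] ℂ).contDiff.comp (hp i)
    have e := partialDeriv_conj (hp i) i
    have := hv.integral_mul hb (d1 i).conj i (by rw [funext e]; exact (d2 i).conj)
    simpa only [e] using this

/-- The flow keeps the even parity, so its normal derivative vanishes on the boundary, which is what
Green's formula against an arbitrary element of `W12` requires. -/
lemma laplaceGraph_neumann_flow (hf : IsTest (halfSpace n) f) {t : ℝ} (ht : 0 < t) :
    LaplaceGraph (halfSpace n) (W12 (halfSpace n)) (flow t (symExt 1 f))
      (-lap (flow t (symExt 1 f))) := by
  have hG := hf.contDiff_symExt 1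
  have hc := hf.hasCompactSupport_symExt 1
  have hu := contDiff_flow hG hc t
  have d1 : ∀ i, Decays (partialDeriv i (flow t (symExt 1 f))) := fun i => by
    rw [partialDeriv_flow hG hc]
    exact decays_flow (contDiff_partialDeriv hG i).continuous
      (hasCompactSupport_partialDeriv hc i) ht
  have d2 : ∀ i, Decays (partialDeriv i (partialDeriv i (flow t (symExt 1 f)))) := fun i => by
    rw [partialDeriv_flow hG hc, partialDeriv_flow (contDiff_partialDeriv hG i)
      (hasCompactSupport_partialDeriv hc i)]
    exact decays_flow (contDiff_partialDeriv (contDiff_partialDeriv hG i) i).continuous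
      (hasCompactSupport_partialDeriv (hasCompactSupport_partialDeriv hc i) i) ht
  have hp := fun i => contDiff_partialDeriv hu i
  refine laplaceGraph_of_integral_mul
    (fun i => (d2 i).memLp (contDiff_partialDeriv (hp i) i).continuous _)
    (W12_of_decays hu (decays_flow hG.continuous hc ht) d1) (fun v H hv => hv.1)
    fun v H hv i => ?_
  have hb : ContDiff ℝ ∞ fun x => conj (partialDeriv i (flow t (symExt 1 f)) x) :=
    (Complex.conjCLE : ℂ →L[ℝ] ℂ).contDiff.comp (hp i)
  have e := partialDeriv_conj (hp i) i
  have := hv.integral_mul hb (d1 i).conj i (by rw [funext e]; exact (d2 i).conj) (by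
    refine or_iff_not_imp_left.2 fun hi x hx => ?_
    rw [not_not.1 hi, partialDeriv_last_eq_zero hu (fun y => ?_) hx, map_zero]
    have h := flow_symExt_reflect (σ := 1) (by norm_num) t f y
    rwa [one_smul] at h)
  simpa only [e] using this

lemma tendsto_eLpNorm_flow_sub {d : ℕ} (Ω : Set (EuclideanSpace ℝ (Fin d)))
    {G : EuclideanSpace ℝ (Fin d) → ℂ} (hG : Continuous G) (hc : HasCompactSupport G)
    (hm : ∀ t, Measurable (flow t G)) :
    Tendsto (fun t => eLpNorm (flow t G - G) 2 (volume.restrict Ω)) (𝓝[>] 0) (𝓝 0) := by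
  set D := Module.finrank ℝ (EuclideanSpace ℝ (Fin d)) + 1
  obtain ⟨C, hC, h⟩ := exists_norm_flow_le_inv_pow hG hc 1 D
  obtain ⟨C', hC', h'⟩ := exists_norm_le_inv_pow hG hc D
  refine tendsto_eLpNorm_two_of_dominated ((memLp_two_inv_one_add_norm_pow (C + C')).restrict _)
    (Eventually.of_forall fun t => (hm t).sub hG.measurable) ?_ (ae_of_all _ fun x => ?_)
  · filter_upwards [Ioc_mem_nhdsGT one_pos] with t ht
    refine ae_of_all _ fun x => ?_
    rw [Pi.sub_apply, add_mul]
    exact (norm_sub_le _ _).trans (add_le_add (h t ht.1 ht.2 x) (h' x))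
  · have := (tendsto_flow_zero hG hc x).sub_const (G x)
    rwa [sub_self] at this

/-- Pointwise convergence is the heat equation. By the mean value inequality the difference
quotients are dominated by a bound for the flow of `lap G` that is uniform on times in `(0, 2 t]`.
-/
lemma tendsto_eLpNorm_slope_flow {d : ℕ} (Ω : Set (EuclideanSpace ℝ (Fin d)))
    {G : EuclideanSpace ℝ (Fin d) → ℂ} (hG : ContDiff ℝ ∞ G) (hc : HasCompactSupport G)
    {t : ℝ} (ht : 0 < t) :
    Tendsto (fun h : ℝ => eLpNorm (fun x => (h : ℂ)⁻¹ * (flow (t + h) G x - flow t G x) +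
      (-lap (flow t G)) x) 2 (volume.restrict Ω)) (𝓝[≠] 0) (𝓝 0) := by
  set D := Module.finrank ℝ (EuclideanSpace ℝ (Fin d)) + 1
  obtain ⟨C, hC, hb⟩ := exists_norm_flow_le_inv_pow (contDiff_lap hG).continuous
    (hasCompactSupport_lap hc) (2 * t) D
  rw [lap_flow hG hc ht]
  have hm : ∀ s, Continuous (flow s G) := fun s => (contDiff_flow hG hc s).continuous
  have hml : Continuous (flow t (lap G)) :=
    (contDiff_flow (contDiff_lap hG) (hasCompactSupport_lap hc) t).continuous
  refine tendsto_eLpNorm_two_of_dominated ((memLp_two_inv_one_add_norm_pow (C + C)).restrict _)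
    (Eventually.of_forall fun h => ?_) ?_ (ae_of_all _ fun x => ?_)
  · exact ((continuous_const.mul ((hm _).sub (hm _))).add hml.neg).measurable
  · have : Set.Ioo (-t) t ∈ 𝓝[≠] (0 : ℝ) :=
      mem_nhdsWithin_of_mem_nhds (Ioo_mem_nhds (by linarith) ht)
    filter_upwards [this, self_mem_nhdsWithin] with h hh hne
    refine ae_of_all _ fun x => ?_
    rw [Pi.neg_apply, add_mul]
    refine (norm_add_le _ _).trans (add_le_add ?_ ?_)
    · have key := (convex_Ioc 0 (2 * t)).norm_image_sub_le_of_norm_hasDerivWithin_le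
        (f := fun s => flow s G x) (f' := fun s => flow s (lap G) x) (x := t) (y := t + h)
        (fun s hs => (hasDerivAt_flow hG hc hs.1 x).hasDerivWithinAt)
        (fun s hs => hb s hs.1 hs.2 x) ⟨ht, by linarith⟩ ⟨by linarith [hh.1], by linarith [hh.2]⟩
      have hne' : 0 < ‖h‖ := norm_pos_iff.2 hne
      rw [norm_mul, norm_inv, Complex.norm_real, inv_mul_le_iff₀ hne', mul_comm]
      simp only [add_sub_cancel_left] at key
      exact key
    · rw [norm_neg]
      exact hb t ht (by linarith) x
  · have h1 := (hasDerivAt_flow hG hc ht x).tendsto_slope_zero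
    have h2 := h1.sub_const (flow t (lap G) x)
    rw [sub_self] at h2
    refine h2.congr fun h => ?_
    rw [Complex.real_smul, Complex.ofReal_inv, Pi.neg_apply, sub_eq_add_neg]

lemma abs_reflKernel_le (hσ : |σ| ≤ 1) {t : ℝ} (ht : 0 < t)
    {x y : EuclideanSpace ℝ (Fin (n + 1))} (hx : x ∈ halfSpace n) (hy : y ∈ halfSpace n) :
    |reflKernel σ t x y| ≤ 2 * (4 * Real.pi) ^ (-(((n + 1 : ℕ) : ℝ) / 2)) /
      t ^ (((n + 1 : ℕ) : ℝ) / 2) * Real.exp (-(1 / 4) * ‖x - y‖ ^ 2 / t) := by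
  have h1 : heat t (x - reflect y) ≤ heat t (x - y) := by
    unfold heat
    gcongr ?_ * Real.exp ?_
    have := norm_sub_le_norm_sub_reflect hx hy
    have h3 : ‖x - y‖ ^ 2 ≤ ‖x - reflect y‖ ^ 2 := by gcongr
    have h4 : 0 < 1 / (4 * t) := by positivity
    nlinarith
  have h2 : heat t (x - y) = (4 * Real.pi) ^ (-(((n + 1 : ℕ) : ℝ) / 2)) /
      t ^ (((n + 1 : ℕ) : ℝ) / 2) * Real.exp (-(1 / 4) * ‖x - y‖ ^ 2 / t) := by
    unfold heat
    rw [finrank_euclideanSpace_fin, Real.mul_rpow (by positivity) ht.le, Real.rpow_neg ht.le,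
      div_eq_mul_inv]
    congr 2
    field_simp
  calc |reflKernel σ t x y| ≤ |heat t (x - y)| + |σ * heat t (x - reflect y)| := abs_add_le _ _
    _ ≤ heat t (x - y) + heat t (x - y) := by
        rw [abs_mul, abs_of_pos (heat_pos ht _), abs_of_pos (heat_pos ht _)]
        gcongr
        calc _ ≤ 1 * heat t (x - y) := by
              gcongr
              exact (heat_pos ht _).le
          _ = _ := one_mul _
    _ = _ := by rw [h2]; ring

lemma isHeatKernel_reflKernel (hσ : |σ| ≤ 1)
    {V : (EuclideanSpace ℝ (Fin (n + 1)) → ℂ) →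
      (Fin (n + 1) → EuclideanSpace ℝ (Fin (n + 1)) → ℂ) → Prop}
    (hV : ∀ f, IsTest (halfSpace n) f → ∀ t, 0 < t →
      LaplaceGraph (halfSpace n) V (flow t (symExt σ f)) (-lap (flow t (symExt σ f)))) :
    IsHeatKernel (halfSpace n) V (reflKernel σ) := by
  refine ⟨fun t ht => ?_, ⟨2 * (4 * Real.pi) ^ (-(((n + 1 : ℕ) : ℝ) / 2)), 1 / 4, by positivity,
    by norm_num, fun t ht x hx y hy => abs_reflKernel_le hσ ht hx hy⟩, fun f hf => ?_⟩
  · have h1 : Continuous fun p : EuclideanSpace ℝ (Fin (n + 1)) × EuclideanSpace ℝ (Fin (n + 1)) =>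
        heat t (p.1 - p.2) := (continuous_heat t).comp (continuous_fst.sub continuous_snd)
    have h2 : Continuous fun p : EuclideanSpace ℝ (Fin (n + 1)) × EuclideanSpace ℝ (Fin (n + 1)) =>
        heat t (p.1 - reflect p.2) :=
      (continuous_heat t).comp (continuous_fst.sub (continuous_reflect.comp continuous_snd))
    exact (h1.add (continuous_const.mul h2)).measurable
  · have hG := hf.contDiff_symExt σ
    have hc := hf.hasCompactSupport_symExt σ
    have key : ∀ t, 0 < t → kernelOp (halfSpace n) (reflKernel σ) t f = flow t (symExt σ f) :=
      fun t ht => kernelOp_reflKernel (tempered_of_hasCompactSupport hG.continuous hc) ht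
    refine ⟨fun t ht => ⟨_, by simp only [key t ht]; exact hV f hf t ht, ?_⟩, ?_⟩
    -- The kernel formula is available at positive times only, hence the restriction to `|h| < t`.
    · refine (tendsto_eLpNorm_slope_flow (halfSpace n) hG hc ht).congr' ?_
      have : Set.Ioo (-t) t ∈ 𝓝[≠] (0 : ℝ) :=
        mem_nhdsWithin_of_mem_nhds (Ioo_mem_nhds (by linarith) ht)
      filter_upwards [this] with h hh
      simp only [key t ht, key (t + h) (by linarith [hh.1])]
    · refine (tendsto_eLpNorm_flow_sub (halfSpace n) hG.continuous hc
        fun t => (contDiff_flow hG hc t).continuous.measurable).congr' ?_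
      filter_upwards [self_mem_nhdsWithin] with t ht
      rw [key t ht]
      refine eLpNorm_congr_ae ?_
      filter_upwards [ae_restrict_mem measurableSet_halfSpace] with x hx
      simp only [Pi.sub_apply, symExt_of_mem hx]

variable (n) in
lemma isHeatKernel_dirichlet :
    IsHeatKernel (halfSpace n) (W120 (halfSpace n)) (reflKernel (-1)) :=
  isHeatKernel_reflKernel (by simp) fun _ hf _ ht => laplaceGraph_dirichlet_flow hf ht

variable (n) in
lemma isHeatKernel_neumann : IsHeatKernel (halfSpace n) (W12 (halfSpace n)) (reflKernel 1) :=
  isHeatKernel_reflKernel (by simp) fun _ hf _ ht => laplaceGraph_neumann_flow hf ht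

end HeatKernel

/-! ### Uniqueness of the semigroup and of its kernel -/

section Uniqueness

variable {d : ℕ} {Ω : Set (EuclideanSpace ℝ (Fin d))}
  {V : (EuclideanSpace ℝ (Fin d) → ℂ) → (Fin d → EuclideanSpace ℝ (Fin d) → ℂ) → Prop}

/-- Properties of a form domain used in the uniqueness proof. -/
structure IsFormDomain (Ω : Set (EuclideanSpace ℝ (Fin d)))
    (V : (EuclideanSpace ℝ (Fin d) → ℂ) → (Fin d → EuclideanSpace ℝ (Fin d) → ℂ) → Prop) :
    Prop where
  memLp : ∀ u G, V u G → MemLp u 2 (volume.restrict Ω)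
  sub : ∀ u G v H, V u G → V v H → V (u - v) (G - H)

lemma isFormDomain_W12 : IsFormDomain Ω (W12 Ω) := by
  refine ⟨fun u G h => h.1, fun u G v H hu hv => ⟨hu.1.sub hv.1, fun i => (hu.2.1 i).sub (hv.2.1 i),
    fun φ hφ i => ?_⟩⟩
  have h1 : Integrable (fun x => u x * partialDeriv i φ x) (volume.restrict Ω) :=
    hu.1.integrable_mul (hφ.partialDeriv i).memLp
  have h2 : Integrable (fun x => v x * partialDeriv i φ x) (volume.restrict Ω) :=
    hv.1.integrable_mul (hφ.partialDeriv i).memLp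
  have h3 : Integrable (fun x => G i x * φ x) (volume.restrict Ω) :=
    (hu.2.1 i).integrable_mul hφ.memLp
  have h4 : Integrable (fun x => H i x * φ x) (volume.restrict Ω) :=
    (hv.2.1 i).integrable_mul hφ.memLp
  simp only [Pi.sub_apply, sub_mul]
  rw [integral_sub h1 h2, integral_sub h3 h4, hu.2.2 φ hφ i, hv.2.2 φ hφ i]
  ring

lemma IsTest.sub {φ ψ : EuclideanSpace ℝ (Fin d) → ℂ} (hφ : IsTest Ω φ) (hψ : IsTest Ω ψ) :
    IsTest Ω (φ - ψ) :=
  ⟨hφ.1.sub hψ.1, hφ.2.1.sub hψ.2.1, (tsupport_sub φ ψ).trans (Set.union_subset hφ.2.2 hψ.2.2)⟩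

lemma partialDeriv_sub {φ ψ : EuclideanSpace ℝ (Fin d) → ℂ} (hφ : ContDiff ℝ ∞ φ)
    (hψ : ContDiff ℝ ∞ ψ) (i : Fin d) :
    partialDeriv i (φ - ψ) = partialDeriv i φ - partialDeriv i ψ := by
  ext x
  unfold partialDeriv
  rw [fderiv_sub (hφ.differentiable (by simp) x) (hψ.differentiable (by simp) x)]
  rfl

lemma tendsto_eLpNorm_sub_sub {ι α : Type*} [MeasurableSpace α] {μ : Measure α} {l : Filter ι}
    {f g : ι → α → ℂ} {a b : α → ℂ} (hf : ∀ i, AEStronglyMeasurable (f i) μ)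
    (hg : ∀ i, AEStronglyMeasurable (g i) μ) (ha : AEStronglyMeasurable a μ)
    (hb : AEStronglyMeasurable b μ)
    (h1 : Tendsto (fun i => eLpNorm (f i - a) 2 μ) l (𝓝 0))
    (h2 : Tendsto (fun i => eLpNorm (g i - b) 2 μ) l (𝓝 0)) :
    Tendsto (fun i => eLpNorm ((f i - g i) - (a - b)) 2 μ) l (𝓝 0) := by
  have h3 := h1.add h2
  rw [add_zero] at h3
  refine tendsto_of_tendsto_of_tendsto_of_le_of_le tendsto_const_nhds h3 (fun _ => zero_le)
    fun i => ?_
  have : f i - g i - (a - b) = (f i - a) - (g i - b) := by abel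
  rw [this]
  exact eLpNorm_sub_le ((hf i).sub ha) ((hg i).sub hb) (by norm_num)

lemma isFormDomain_W120 : IsFormDomain Ω (W120 Ω) := by
  refine ⟨fun u G h => h.1, fun u G v H hu hv => ⟨hu.1.sub hv.1,
    fun i => (hu.2.1 i).sub (hv.2.1 i), ?_⟩⟩
  obtain ⟨hu2, hG2, φ, hφ, hφu, hφG⟩ := hu
  obtain ⟨hv2, hH2, ψ, hψ, hψv, hψH⟩ := hv
  refine ⟨fun k => φ k - ψ k, fun k => (hφ k).sub (hψ k),
    tendsto_eLpNorm_sub_sub (fun k => (hφ k).memLp.1) (fun k => (hψ k).memLp.1) hu2.1 hv2.1 hφu hψv,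
    fun i => ?_⟩
  simp only [partialDeriv_sub (hφ _).1 (hψ _).1]
  exact tendsto_eLpNorm_sub_sub (fun k => ((hφ k).partialDeriv i).memLp.1)
    (fun k => ((hψ k).partialDeriv i).memLp.1) (hG2 i).1 (hH2 i).1 (hφG i) (hψH i)

lemma LaplaceGraph.sub (hV : IsFormDomain Ω V)
    (hV2 : ∀ u G, V u G → ∀ i, MemLp (G i) 2 (volume.restrict Ω))
    {u v g h : EuclideanSpace ℝ (Fin d) → ℂ} (hu : LaplaceGraph Ω V u g)
    (hv : LaplaceGraph Ω V v h) : LaplaceGraph Ω V (u - v) (g - h) := by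
  obtain ⟨hg, G, huG, hu⟩ := hu
  obtain ⟨hh, H, hvH, hv⟩ := hv
  refine ⟨hg.sub hh, G - H, hV.sub _ _ _ _ huG hvH, fun z K hz => ?_⟩
  have hK := hV2 z K hz
  have hz2 := hV.memLp z K hz
  have i1 : ∀ i, Integrable (fun x => G i x * conj (K i x)) (volume.restrict Ω) := fun i =>
    (hV2 u G huG i).integrable_mul (hK i).star
  have i2 : ∀ i, Integrable (fun x => H i x * conj (K i x)) (volume.restrict Ω) := fun i =>
    (hV2 v H hvH i).integrable_mul (hK i).star
  have i3 : Integrable (fun x => g x * conj (z x)) (volume.restrict Ω) := hg.integrable_mul hz2.star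
  have i4 : Integrable (fun x => h x * conj (z x)) (volume.restrict Ω) := hh.integrable_mul hz2.star
  simp only [Pi.sub_apply, sub_mul]
  rw [integral_sub i3 i4, ← hu z K hz, ← hv z K hz, ← Finset.sum_sub_distrib]
  exact Finset.sum_congr rfl fun i _ => integral_sub (i1 i) (i2 i)

/-- Testing the form identity with `u` itself gives the integral of the squared gradient. -/
lemma LaplaceGraph.integral_nonneg {u g : EuclideanSpace ℝ (Fin d) → ℂ}
    (hV : IsFormDomain Ω V) (hu : LaplaceGraph Ω V u g) :
    0 ≤ ∫ x in Ω, (conj (u x) * g x).re := by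
  obtain ⟨hg, G, huG, h⟩ := hu
  have i1 : Integrable (fun x => g x * conj (u x)) (volume.restrict Ω) :=
    hg.integrable_mul (hV.memLp u G huG).star
  have h1 := congrArg Complex.re (h u G huG)
  have h2 : ∫ x in Ω, (conj (u x) * g x).re = (∫ x in Ω, g x * conj (u x)).re := by
    have := integral_re i1
    simp only [RCLike.re_to_complex] at this
    rw [← this]
    simp_rw [mul_comm]
  rw [h2, ← h1, Complex.re_sum]
  refine Finset.sum_nonneg fun i _ => ?_
  have h3 : ∀ x, G i x * conj (G i x) = ((‖G i x‖ ^ 2 : ℝ) : ℂ) := fun x => by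
    rw [Complex.mul_conj, Complex.normSq_eq_norm_sq]
  simp_rw [h3]
  rw [integral_complex_ofReal, Complex.ofReal_re]
  exact MeasureTheory.integral_nonneg fun x => by positivity

/-- It turns convergence of `eLpNorm` into a derivative in the Hilbert space of square-integrable
classes. At nonpositive times the curve has the irrelevant value zero. -/
lemma IsHeatOrbit.exists_lp (hV : IsFormDomain Ω V) {f : EuclideanSpace ℝ (Fin d) → ℂ}
    {u : ℝ → EuclideanSpace ℝ (Fin d) → ℂ} (hf : MemLp f 2 (volume.restrict Ω))
    (hu : IsHeatOrbit Ω V f u) :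
    ∃ U : ℝ → Lp ℂ 2 (volume.restrict Ω), (∀ t, 0 < t → U t =ᵐ[volume.restrict Ω] u t) ∧
      (∀ t, 0 < t → ∃ g, ∃ hg : LaplaceGraph Ω V (u t) g, HasDerivAt U (-hg.1.toLp g) t) ∧
      Tendsto U (𝓝[>] 0) (𝓝 (hf.toLp f)) := by
  classical
  obtain ⟨hu1, hu0⟩ := hu
  have hm : ∀ t, 0 < t → MemLp (u t) 2 (volume.restrict Ω) := fun t ht => by
    obtain ⟨g, ⟨-, G, hG, -⟩, -⟩ := hu1 t ht
    exact hV.memLp _ _ hG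
  set U : ℝ → Lp ℂ 2 (volume.restrict Ω) := fun t =>
    if h : 0 < t then (hm t h).toLp (u t) else 0 with hU
  have hUt : ∀ t (ht : 0 < t), U t = (hm t ht).toLp (u t) := fun t ht => by simp [hU, ht]
  refine ⟨U, fun t ht => ?_, fun t ht => ?_, ?_⟩
  · rw [hUt t ht]; exact (hm t ht).coeFn_toLp
  · obtain ⟨g, hg, hlim⟩ := hu1 t ht
    refine ⟨g, hg, ?_⟩
    rw [hasDerivAt_iff_tendsto_slope_zero, tendsto_iff_edist_tendsto_0]
    refine hlim.congr' ?_
    have : Set.Ioo (-t) t ∈ 𝓝[≠] (0 : ℝ) :=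
      mem_nhdsWithin_of_mem_nhds (Ioo_mem_nhds (by linarith) ht)
    filter_upwards [this] with h hh
    have hth : 0 < t + h := by linarith [hh.1]
    rw [hUt t ht, hUt (t + h) hth, ← MemLp.toLp_sub, ← MemLp.toLp_const_smul, ← MemLp.toLp_neg,
      Lp.edist_toLp_toLp]
    congr 1
    ext x
    simp
  · rw [tendsto_iff_edist_tendsto_0]
    refine hu0.congr' ?_
    filter_upwards [self_mem_nhdsWithin] with t ht
    rw [hUt t ht, Lp.edist_toLp_toLp]

/-- Energy method: the squared distance of two orbits has nonpositive derivative by positivity of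
the form, and it tends to zero as time tends to zero from above. -/
lemma IsHeatOrbit.ae_eq (hV : IsFormDomain Ω V)
    (hV2 : ∀ u G, V u G → ∀ i, MemLp (G i) 2 (volume.restrict Ω))
    {f : EuclideanSpace ℝ (Fin d) → ℂ} {u v : ℝ → EuclideanSpace ℝ (Fin d) → ℂ}
    (hf : MemLp f 2 (volume.restrict Ω)) (hu : IsHeatOrbit Ω V f u) (hv : IsHeatOrbit Ω V f v)
    {t : ℝ} (ht : 0 < t) : u t =ᵐ[volume.restrict Ω] v t := by
  obtain ⟨U, hU, hU', hU0⟩ := hu.exists_lp hV hf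
  obtain ⟨W, hW, hW', hW0⟩ := hv.exists_lp hV hf
  have hd : ∀ s, 0 < s → ∃ D ≤ 0, HasDerivAt (fun s => ‖U s - W s‖ ^ 2) D s := by
    intro s hs
    obtain ⟨g, hg, hgU⟩ := hU' s hs
    obtain ⟨h, hh, hhW⟩ := hW' s hs
    refine ⟨_, ?_, (hgU.sub hhW).norm_sq⟩
    have hpos := (hg.sub hV hV2 hh).integral_nonneg hV
    have e : inner ℝ (U s - W s) (-hg.1.toLp g - -hh.1.toLp h) =
        -∫ x in Ω, (conj ((u s - v s) x) * (g - h) x).re := by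
      rw [L2.inner_def, ← integral_neg]
      refine integral_congr_ae ?_
      filter_upwards [Lp.coeFn_sub (U s) (W s), Lp.coeFn_sub (-hg.1.toLp g) (-hh.1.toLp h),
        Lp.coeFn_neg (hg.1.toLp g), Lp.coeFn_neg (hh.1.toLp h), hg.1.coeFn_toLp, hh.1.coeFn_toLp,
        hU s hs, hW s hs] with x h1 h2 h3 h4 h5 h6 h7 h8
      rw [h1, h2]
      simp only [Pi.sub_apply, Pi.neg_apply, h3, h4, h5, h6, h7, h8]
      rw [Complex.inner]
      rw [← Complex.neg_re]
      congr 1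
      ring
    have e' := e ▸ neg_nonpos.2 hpos
    have : (2 : ℝ) * inner ℝ (U s - W s) (-hg.1.toLp g - -hh.1.toLp h) ≤ 0 := by
      rw [e]; linarith
    exact this
  have hanti : AntitoneOn (fun s => ‖U s - W s‖ ^ 2) (Set.Ioi 0) := by
    refine antitoneOn_of_deriv_nonpos (convex_Ioi 0) (fun s hs => ?_) (fun s hs => ?_)
      fun s hs => ?_
    · obtain ⟨D, -, h⟩ := hd s hs
      exact h.continuousAt.continuousWithinAt
    · rw [interior_Ioi] at hs
      obtain ⟨D, -, h⟩ := hd s hs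
      exact h.differentiableAt.differentiableWithinAt
    · rw [interior_Ioi] at hs
      obtain ⟨D, hD, h⟩ := hd s hs
      rwa [h.deriv]
  have hlim : Tendsto (fun s => ‖U s - W s‖ ^ 2) (𝓝[>] 0) (𝓝 0) := by
    have := ((hU0.sub hW0).norm).pow 2
    simpa using this
  have hle : ‖U t - W t‖ ^ 2 ≤ 0 := by
    refine ge_of_tendsto hlim ?_
    filter_upwards [Ioc_mem_nhdsGT ht] with s hs
    exact hanti hs.1 ht hs.2
  have h0 : U t = W t := by
    rw [← sub_eq_zero, ← norm_eq_zero]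
    exact pow_eq_zero_iff (two_ne_zero) |>.1 (le_antisymm hle (by positivity))
  filter_upwards [hU t ht, hW t ht] with x h1 h2
  rw [← h1, ← h2, h0]

/-- Test functions form a subset of a separable space of integrable classes. A countable family is
needed to choose one null set of points `x` that serves all test functions. -/
lemma exists_countable_dense_test (Ω : Set (EuclideanSpace ℝ (Fin d))) :
    ∃ T : Set (EuclideanSpace ℝ (Fin d) → ℂ), T.Countable ∧ (∀ φ ∈ T, IsTest Ω φ) ∧
      ∀ φ, IsTest Ω φ → ∀ ε : ℝ, 0 < ε → ∃ ψ ∈ T, ∫ x in Ω, ‖φ x - ψ x‖ < ε := by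
  have hint : ∀ φ, IsTest Ω φ → Integrable φ (volume.restrict Ω) := fun φ h =>
    (h.1.continuous.integrable_of_hasCompactSupport h.2.1).restrict
  have : Fact ((1 : ℝ≥0∞) ≠ ⊤) := ⟨ENNReal.one_ne_top⟩
  set S : Set (Lp ℂ 1 (volume.restrict Ω)) := {w | ∃ φ, ∃ h : IsTest Ω φ, (hint φ h).toL1 φ = w}
  obtain ⟨T₀, hT₀S, hT₀c, hT₀d⟩ := (TopologicalSpace.IsSeparable.of_separableSpace S).exists_countable_dense_subset
  choose! φ hφ hφw using fun w (hw : w ∈ T₀) => hT₀S hw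
  refine ⟨φ '' T₀, hT₀c.image φ, ?_, fun ψ hψ ε hε => ?_⟩
  · rintro _ ⟨w, hw, rfl⟩; exact hφ w hw
  · have hmem : (hint ψ hψ).toL1 ψ ∈ closure T₀ := hT₀d ⟨ψ, hψ, rfl⟩
    obtain ⟨w, hw, hd⟩ := Metric.mem_closure_iff.1 hmem ε hε
    refine ⟨φ w, ⟨w, hw, rfl⟩, ?_⟩
    rw [← hφw w hw, dist_eq_norm, ← Integrable.toL1_sub, L1.norm_eq_integral_norm] at hd
    refine lt_of_eq_of_lt (integral_congr_ae ?_) hd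
    filter_upwards [((hint ψ hψ).sub (hint _ (hφ w hw))).coeFn_toL1] with x h1
    rw [h1, Pi.sub_apply]

/-- The exceptional null set in the hypothesis depends on `φ`. A countable dense family gives a
common one, boundedness of `D x` extends the vanishing to every test function, and the fundamental
lemma of the calculus of variations concludes. -/
lemma ae_eq_zero_of_kernel {D : EuclideanSpace ℝ (Fin d) → EuclideanSpace ℝ (Fin d) → ℝ}
    (hΩ : IsOpen Ω) (hm : Measurable (Function.uncurry D)) {M : ℝ}
    (hM : ∀ x ∈ Ω, ∀ y ∈ Ω, |D x y| ≤ M)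
    (h : ∀ φ, IsTest Ω φ → ∀ᵐ x ∂volume.restrict Ω, ∫ y in Ω, (D x y : ℂ) * φ y = 0) :
    ∀ᵐ x ∂volume.restrict Ω, ∀ᵐ y ∂volume.restrict Ω, D x y = 0 := by
  obtain ⟨T, hTc, hT, hTd⟩ := exists_countable_dense_test Ω
  have h1 : ∀ᵐ x ∂volume.restrict Ω, ∀ φ ∈ T, ∫ y in Ω, (D x y : ℂ) * φ y = 0 :=
    (ae_ball_iff hTc).2 fun φ hφ => h φ (hT φ hφ)
  filter_upwards [h1, ae_restrict_mem hΩ.measurableSet] with x hx hxΩ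
  have hDm : Measurable (D x) := hm.comp measurable_prodMk_left
  have hDmC : AEStronglyMeasurable (fun y => (D x y : ℂ)) (volume.restrict Ω) :=
    (Complex.measurable_ofReal.comp hDm).aestronglyMeasurable
  have hM0 : 0 ≤ M := (abs_nonneg _).trans (hM x hxΩ x hxΩ)
  have hint : ∀ φ, Integrable φ (volume.restrict Ω) →
      Integrable (fun y => (D x y : ℂ) * φ y) (volume.restrict Ω) := fun φ hφ =>
    hφ.bdd_mul hDmC (c := M) (by
      filter_upwards [ae_restrict_mem hΩ.measurableSet] with y hy
      rw [Complex.norm_real]; exact hM x hxΩ y hy)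
  have hti : ∀ φ, IsTest Ω φ → Integrable φ (volume.restrict Ω) := fun φ h =>
    (h.1.continuous.integrable_of_hasCompactSupport h.2.1).restrict
  have hall : ∀ φ, IsTest Ω φ → ∫ y in Ω, (D x y : ℂ) * φ y = 0 := by
    intro φ hφ
    rw [← norm_le_zero_iff]
    refine le_of_forall_pos_le_add fun ε hε => ?_
    obtain ⟨ψ, hψ, hlt⟩ := hTd φ hφ (ε / (M + 1)) (by positivity)
    have e : ∫ y in Ω, (D x y : ℂ) * φ y = ∫ y in Ω, (D x y : ℂ) * (φ y - ψ y) := by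
      simp_rw [mul_sub]
      rw [integral_sub (hint φ (hti φ hφ)) (hint ψ (hti ψ (hT ψ hψ))), hx ψ hψ, sub_zero]
    rw [e, zero_add]
    calc ‖∫ y in Ω, (D x y : ℂ) * (φ y - ψ y)‖ ≤ ∫ y in Ω, M * ‖φ y - ψ y‖ := by
          refine norm_integral_le_of_norm_le (((hti φ hφ).sub (hti ψ (hT ψ hψ))).norm.const_mul M) ?_
          filter_upwards [ae_restrict_mem hΩ.measurableSet] with y hy
          rw [norm_mul, Complex.norm_real]
          gcongr
          exact hM x hxΩ y hy
      _ = M * ∫ y in Ω, ‖φ y - ψ y‖ := integral_const_mul _ _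
      _ ≤ (M + 1) * (ε / (M + 1)) := by
          gcongr
          linarith
      _ = ε := by field_simp
  have hloc : LocallyIntegrableOn (D x) Ω := by
    refine (locallyIntegrableOn_iff hΩ.isLocallyClosed).2 fun K hK hKc => ?_
    refine Measure.integrableOn_of_bounded (M := M) hKc.measure_lt_top.ne
      hDm.aestronglyMeasurable ?_
    filter_upwards [ae_restrict_mem hKc.measurableSet] with y hy
    exact hM x hxΩ y (hK hy)
  rw [ae_restrict_iff' hΩ.measurableSet]
  refine hΩ.ae_eq_zero_of_integral_contDiff_smul_eq_zero hloc fun g hg hgc hgs => ?_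
  have htest : IsTest Ω (fun y => (g y : ℂ)) := by
    refine ⟨Complex.ofRealCLM.contDiff.comp hg, hgc.comp_left (g := Complex.ofReal) rfl, ?_⟩
    exact (closure_mono (fun y hy => by simpa using hy)).trans hgs
  have h2 := hall _ htest
  rw [htest.setIntegral_mul] at h2
  have h3 : ∀ y, (D x y : ℂ) * (g y : ℂ) = ((g y • D x y : ℝ) : ℂ) := fun y => by
    simp [mul_comm]
  simp_rw [h3] at h2
  rw [integral_complex_ofReal] at h2
  exact_mod_cast h2

/-- Both kernels produce orbits of each test function, and orbits are unique, so the difference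
kernel annihilates all test functions. -/
lemma IsHeatKernel.ae_eq (hΩ : IsOpen Ω) (hV : IsFormDomain Ω V)
    (hV2 : ∀ u G, V u G → ∀ i, MemLp (G i) 2 (volume.restrict Ω))
    {p q : ℝ → EuclideanSpace ℝ (Fin d) → EuclideanSpace ℝ (Fin d) → ℝ}
    (hp : IsHeatKernel Ω V p) (hq : IsHeatKernel Ω V q) {t : ℝ} (ht : 0 < t) :
    ∀ᵐ x ∂volume.restrict Ω, p t x =ᵐ[volume.restrict Ω] q t x := by
  obtain ⟨hpm, ⟨C, c, hC, hc, hpb⟩, hpo⟩ := hp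
  obtain ⟨hqm, ⟨C', c', hC', hc', hqb⟩, hqo⟩ := hq
  have hb : ∀ {p : ℝ → EuclideanSpace ℝ (Fin d) → EuclideanSpace ℝ (Fin d) → ℝ} {C c : ℝ},
      0 < C → 0 < c → (∀ t, 0 < t → ∀ x ∈ Ω, ∀ y ∈ Ω,
        |p t x y| ≤ C / t ^ ((d : ℝ) / 2) * Real.exp (-c * ‖x - y‖ ^ 2 / t)) →
      ∀ x ∈ Ω, ∀ y ∈ Ω, |p t x y| ≤ C / t ^ ((d : ℝ) / 2) := by
    intro p C c hC hc h x hx y hy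
    refine (h t ht x hx y hy).trans (mul_le_of_le_one_right (by positivity) ?_)
    rw [Real.exp_le_one_iff]
    refine div_nonpos_of_nonpos_of_nonneg ?_ ht.le
    nlinarith [sq_nonneg ‖x - y‖]
  have hpb' := hb hC hc hpb
  have hqb' := hb hC' hc' hqb
  have key := ae_eq_zero_of_kernel (D := fun x y => p t x y - q t x y) hΩ
    ((hpm t ht).sub (hqm t ht)) (M := C / t ^ ((d : ℝ) / 2) + C' / t ^ ((d : ℝ) / 2))
    (fun x hx y hy => (abs_sub _ _).trans (add_le_add (hpb' x hx y hy) (hqb' x hx y hy))) ?_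
  · filter_upwards [key] with x hx
    filter_upwards [hx] with y hy
    exact sub_eq_zero.1 hy
  · intro φ hφ
    have h1 := (hpo φ hφ).ae_eq hV hV2 hφ.memLp (hqo φ hφ) ht
    have hti : Integrable φ (volume.restrict Ω) :=
      (hφ.1.continuous.integrable_of_hasCompactSupport hφ.2.1).restrict
    filter_upwards [h1, ae_restrict_mem hΩ.measurableSet] with x hx hxΩ
    have hi : ∀ {p : EuclideanSpace ℝ (Fin d) → EuclideanSpace ℝ (Fin d) → ℝ} {M : ℝ},
        Measurable (Function.uncurry p) → (∀ x ∈ Ω, ∀ y ∈ Ω, |p x y| ≤ M) →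
        Integrable (fun y => (p x y : ℂ) * φ y) (volume.restrict Ω) := by
      intro p M hm hM
      refine hti.bdd_mul (c := M)
        (Complex.measurable_ofReal.comp (hm.comp measurable_prodMk_left)).aestronglyMeasurable ?_
      filter_upwards [ae_restrict_mem hΩ.measurableSet] with y hy
      rw [Complex.norm_real]; exact hM x hxΩ y hy
    simp only [Complex.ofReal_sub, sub_mul]
    rw [integral_sub (hi (hpm t ht) hpb') (hi (hqm t ht) hqb'), sub_eq_zero]
    exact hx

/-- The kernel `heatKernel` is a choice among all heat kernels: an explicit kernel `p` shows that
the choice is a genuine one, and uniqueness identifies the two. -/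
lemma heatOp_ae_eq (hΩ : IsOpen Ω) (hV : IsFormDomain Ω V)
    (hV2 : ∀ u G, V u G → ∀ i, MemLp (G i) 2 (volume.restrict Ω))
    {p : ℝ → EuclideanSpace ℝ (Fin d) → EuclideanSpace ℝ (Fin d) → ℝ}
    (hp : IsHeatKernel Ω V p) {t : ℝ} (ht : 0 < t) (f : EuclideanSpace ℝ (Fin d) → ℂ) :
    heatOp Ω V t f =ᵐ[volume.restrict Ω] kernelOp Ω p t f := by
  have hk : IsHeatKernel Ω V (heatKernel Ω V) := Classical.epsilon_spec ⟨p, hp⟩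
  filter_upwards [hk.ae_eq hΩ hV hV2 hp ht] with x hx
  refine integral_congr_ae ?_
  filter_upwards [hx] with y hy
  rw [hy]

end Uniqueness

/-! ### The Dirichlet and Neumann semigroups as free heat flows -/

section

variable {n : ℕ}

lemma heatOp_dirichlet_ae_eq {f : EuclideanSpace ℝ (Fin (n + 1)) → ℂ}
    (hf : Tempered (symExt (-1) f)) {t : ℝ} (ht : 0 < t) :
    heatOp (halfSpace n) (W120 (halfSpace n)) t f =ᵐ[volume.restrict (halfSpace n)]
      flow t (symExt (-1) f) := by
  rw [← kernelOp_reflKernel hf ht]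
  exact heatOp_ae_eq isOpen_halfSpace isFormDomain_W120 (fun _ _ h => h.2.1)
    (isHeatKernel_dirichlet n) ht f

lemma heatOp_neumann_ae_eq {f : EuclideanSpace ℝ (Fin (n + 1)) → ℂ}
    (hf : Tempered (symExt 1 f)) {t : ℝ} (ht : 0 < t) :
    heatOp (halfSpace n) (W12 (halfSpace n)) t f =ᵐ[volume.restrict (halfSpace n)]
      flow t (symExt 1 f) := by
  rw [← kernelOp_reflKernel hf ht]
  exact heatOp_ae_eq isOpen_halfSpace isFormDomain_W12 (fun _ _ h => h.2.1)
    (isHeatKernel_neumann n) ht f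

end

/-! ### The growth class -/

section Growth

lemma Tempered.locallyIntegrable {E : Type*} [NormedAddCommGroup E] [InnerProductSpace ℝ E]
    [MeasurableSpace E] [BorelSpace E] [FiniteDimensional ℝ E] {F : E → ℂ} (hF : Tempered F) :
    LocallyIntegrable F := by
  obtain ⟨m, hm⟩ := hF
  rw [locallyIntegrable_iff]
  intro K hK
  have hc : ContinuousOn (fun y : E => (1 + ‖y‖) ^ m) K := by fun_prop
  refine (hm.integrableOn.continuousOn_smul hc hK).congr (Eventually.of_forall fun y => ?_)
  have : (1 + ‖y‖) ^ m ≠ 0 := by positivity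
  simp only [smul_smul, mul_inv_cancel₀ this, one_smul]

variable {d : ℕ} {Ω : Set (EuclideanSpace ℝ (Fin d))} {f g : EuclideanSpace ℝ (Fin d) → ℂ}

lemma inv_one_add_pow_le_of_le {s : ℝ} (hs : 0 ≤ s) {m k : ℕ} (h : m ≤ k) :
    ((1 + s) ^ k)⁻¹ ≤ ((1 + s) ^ m)⁻¹ := by
  gcongr
  linarith

/-- As `δ` is free, the condition only asks for some polynomial weight. Natural powers of `1 + ‖x‖`
are easier to compare than real powers of `‖x‖`. -/
lemma memM_iff : MemM Ω f ↔ LocallyIntegrableOn f Ω volume ∧ ∃ N : ℕ,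
    IntegrableOn (fun x => ((1 + ‖x‖) ^ N)⁻¹ * ‖f x‖ ^ 2) Ω volume := by
  unfold MemM
  refine and_congr_right fun hf => ?_
  have hm := hf.aestronglyMeasurable
  constructor
  · rintro ⟨δ, hδ, h⟩
    refine ⟨⌈(d : ℝ) + δ⌉₊, (h.const_mul 2).mono'
      ((continuous_inv_one_add_norm_pow _).aestronglyMeasurable.mul (hm.norm.pow 2))
      (Eventually.of_forall fun x => ?_)⟩
    rw [Real.norm_of_nonneg (by positivity), mul_div_assoc', le_div_iff₀ (by positivity), mul_assoc,
      inv_mul_le_iff₀ (by positivity)]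
    have h1 : ‖x‖ ^ ((d : ℝ) + δ) ≤ (1 + ‖x‖) ^ ⌈(d : ℝ) + δ⌉₊ := by
      rw [← Real.rpow_natCast]
      calc ‖x‖ ^ ((d : ℝ) + δ) ≤ (1 + ‖x‖) ^ ((d : ℝ) + δ) := by
            gcongr; linarith
        _ ≤ _ := Real.rpow_le_rpow_of_exponent_le (by linarith [norm_nonneg x]) (Nat.le_ceil _)
    have h2 : 1 ≤ (1 + ‖x‖) ^ ⌈(d : ℝ) + δ⌉₊ := one_le_pow₀ (by linarith [norm_nonneg x])
    nlinarith [sq_nonneg ‖f x‖]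
  · rintro ⟨N, h⟩
    -- With `δ = N + 1`, positive even for `N = 0`, the exponent `d + δ` is a natural number; the
    -- constant comes from `(1 + s) ^ m ≤ 2 ^ m (1 + s ^ m)`.
    refine ⟨N + 1, by positivity, (h.const_mul (2 ^ (d + N + 1))).mono' ?_
      (Eventually.of_forall fun x => ?_)⟩
    · refine ((hm.norm.aemeasurable.pow_const 2).div ?_).aestronglyMeasurable
      exact (measurable_const.add (measurable_norm.pow_const _)).aemeasurable
    · have e : (d : ℝ) + ((N : ℝ) + 1) = ((d + N + 1 : ℕ) : ℝ) := by push_cast; ring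
      rw [Real.norm_of_nonneg (by positivity), e, Real.rpow_natCast, div_eq_inv_mul, ← mul_assoc]
      gcongr
      refine le_trans ?_ (mul_le_mul_of_nonneg_left
        (inv_one_add_pow_le_of_le (norm_nonneg x) (show N ≤ d + N + 1 by omega)) (by positivity))
      rw [← div_eq_mul_inv, le_div_iff₀ (by positivity), inv_mul_le_iff₀ (by positivity)]
      calc (1 + ‖x‖) ^ (d + N + 1) ≤ 2 ^ (d + N + 1 - 1) * (1 ^ (d + N + 1) + ‖x‖ ^ (d + N + 1)) :=
            add_pow_le zero_le_one (norm_nonneg _) _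
        _ ≤ 2 ^ (d + N + 1) * (1 + ‖x‖ ^ (d + N + 1)) := by
            rw [one_pow]
            gcongr
            · norm_num
            · omega
        _ = _ := mul_comm _ _

lemma MemM.congr_ae (hf : MemM Ω f) (h : f =ᵐ[volume.restrict Ω] g) : MemM Ω g := by
  obtain ⟨h1, δ, hδ, h2⟩ := hf
  refine ⟨fun x hx => ?_, δ, hδ, h2.congr (h.mono fun x hx => by simp only [hx])⟩
  obtain ⟨s, hs, hi⟩ := h1 x hx
  exact ⟨s ∩ Ω, inter_mem hs self_mem_nhdsWithin, (hi.mono_set Set.inter_subset_left).congr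
    (ae_restrict_of_ae_restrict_of_subset Set.inter_subset_right h)⟩

lemma MemM.add (hf : MemM Ω f) (hg : MemM Ω g) : MemM Ω (f + g) := by
  rw [memM_iff] at *
  obtain ⟨hf1, N, hf2⟩ := hf
  obtain ⟨hg1, N', hg2⟩ := hg
  refine ⟨hf1.add hg1, N + N', ((hf2.add hg2).const_mul 2).mono'
    ((continuous_inv_one_add_norm_pow _).aestronglyMeasurable.mul
      ((hf1.aestronglyMeasurable.add hg1.aestronglyMeasurable).norm.pow 2))
    (Eventually.of_forall fun x => ?_)⟩
  rw [Real.norm_of_nonneg (by positivity)]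
  have h1 : ‖(f + g) x‖ ^ 2 ≤ 2 * (‖f x‖ ^ 2 + ‖g x‖ ^ 2) := by
    have := norm_add_le (f x) (g x)
    calc ‖(f + g) x‖ ^ 2 ≤ (‖f x‖ + ‖g x‖) ^ 2 := by gcongr; exact this
      _ ≤ _ := by nlinarith [sq_nonneg (‖f x‖ - ‖g x‖)]
  have h2 := inv_one_add_pow_le_of_le (norm_nonneg x) (show N ≤ N + N' by omega)
  have h3 := inv_one_add_pow_le_of_le (norm_nonneg x) (show N' ≤ N + N' by omega)
  calc ((1 + ‖x‖) ^ (N + N'))⁻¹ * ‖(f + g) x‖ ^ 2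
      ≤ ((1 + ‖x‖) ^ (N + N'))⁻¹ * (2 * (‖f x‖ ^ 2 + ‖g x‖ ^ 2)) := by gcongr
    _ = 2 * (((1 + ‖x‖) ^ (N + N'))⁻¹ * ‖f x‖ ^ 2 + ((1 + ‖x‖) ^ (N + N'))⁻¹ * ‖g x‖ ^ 2) := by ring
    _ ≤ _ := by
        simp only [Pi.add_apply]
        gcongr

lemma memM_of_norm_le {C : ℝ} {m : ℕ} (hf : AEStronglyMeasurable f)
    (h : ∀ x, ‖f x‖ ≤ C * (1 + ‖x‖) ^ m) : MemM Ω f := by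
  have hT : Tempered f := .of_norm_le hf (ae_of_all _ h)
  refine memM_iff.2 ⟨hT.locallyIntegrable.locallyIntegrableOn _,
    2 * m + (Module.finrank ℝ (EuclideanSpace ℝ (Fin d)) + 1), Integrable.integrableOn ?_⟩
  refine (integrable_inv_one_add_norm_pow.const_mul (C ^ 2)).mono'
    ((continuous_inv_one_add_norm_pow _).aestronglyMeasurable.mul (hf.norm.pow 2))
    (Eventually.of_forall fun x => ?_)
  rw [Real.norm_of_nonneg (by positivity), inv_mul_le_iff₀ (by positivity)]
  have h0 : (1 + ‖x‖) ^ (Module.finrank ℝ (EuclideanSpace ℝ (Fin d)) + 1) ≠ 0 := by positivity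
  calc ‖f x‖ ^ 2 ≤ (C * (1 + ‖x‖) ^ m) ^ 2 := by gcongr; exact h x
    _ = _ := by
      rw [pow_add]
      field_simp
      ring

/-- The John–Nirenberg estimate enters here: the weighted integral of `‖f‖²`, not only of `‖f‖`, has
to be finite. -/
lemma HasOsc.memM {A : ℝ≥0} (hf : AEStronglyMeasurable f) (h : HasOsc f A) : MemM Ω f := by
  refine memM_iff.2 ⟨(h.tempered hf).locallyIntegrable.locallyIntegrableOn _,
    Module.finrank ℝ (EuclideanSpace ℝ (Fin d)) + 1, Integrable.integrableOn ?_⟩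
  refine ⟨(continuous_inv_one_add_norm_pow _).aestronglyMeasurable.mul (hf.norm.pow 2), ?_⟩
  refine lt_of_le_of_lt (lintegral_mono fun x => le_of_eq ?_) (h.lintegral_poly_sq_lt_top hf)
  rw [enorm_mul, enorm_pow, enorm_norm, ← ofReal_norm, Real.norm_of_nonneg (by positivity)]
  simp [poly]

/-- The inequality `s ≤ s² + 1` trades the square for an extra weight that is itself integrable. -/
lemma MemM.tempered_indicator (hΩ : MeasurableSet Ω) (hf : MemM Ω f) :
    Tempered (Ω.indicator f) := by
  obtain ⟨h1, N, h2⟩ := memM_iff.1 hf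
  set D := Module.finrank ℝ (EuclideanSpace ℝ (Fin d)) + 1
  refine ⟨N + D, ?_⟩
  have h3 : IntegrableOn (fun x => ((1 + ‖x‖) ^ (N + D))⁻¹ • f x) Ω := by
    refine (h2.add integrable_inv_one_add_norm_pow.integrableOn).mono'
      ((continuous_inv_one_add_norm_pow _).aestronglyMeasurable.smul h1.aestronglyMeasurable)
      (Eventually.of_forall fun x => ?_)
    rw [norm_smul, Real.norm_of_nonneg (by positivity)]
    have h2 := inv_one_add_pow_le_of_le (norm_nonneg x) (show N ≤ N + D by omega)
    have h3 := inv_one_add_pow_le_of_le (norm_nonneg x) (show D ≤ N + D by omega)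
    calc ((1 + ‖x‖) ^ (N + D))⁻¹ * ‖f x‖ ≤ ((1 + ‖x‖) ^ (N + D))⁻¹ * (‖f x‖ ^ 2 + 1) := by
          gcongr
          nlinarith [sq_nonneg (‖f x‖ - 1)]
      _ = ((1 + ‖x‖) ^ (N + D))⁻¹ * ‖f x‖ ^ 2 + ((1 + ‖x‖) ^ (N + D))⁻¹ := by ring
      _ ≤ ((1 + ‖x‖) ^ N)⁻¹ * ‖f x‖ ^ 2 + ((1 + ‖x‖) ^ D)⁻¹ := by gcongr
  refine ((integrable_indicator_iff hΩ).2 h3).congr (Eventually.of_forall fun x => ?_)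
  by_cases hx : x ∈ Ω <;> simp [hx]

end Growth

/-! ### Transfer between the half space and the whole space -/

section Symmetry

variable {n : ℕ} {σ : ℝ} {f g : EuclideanSpace ℝ (Fin (n + 1)) → ℂ}

lemma Tempered.symExt (hf : Tempered (zeroExt f)) (σ : ℝ) : Tempered (symExt σ f) :=
  hf.add (hf.comp_reflect.const_smul σ)

lemma MemM.tempered_symExt (hf : MemM (halfSpace n) f) (σ : ℝ) :
    Tempered (HalfSpaceBMO.symExt σ f) :=
  Tempered.symExt (by
    rw [zeroExt_eq_indicator]; exact hf.tempered_indicator measurableSet_halfSpace) σ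

variable (n) in
lemma ae_last_ne_zero : ∀ᵐ x : EuclideanSpace ℝ (Fin (n + 1)), x (Fin.last n) ≠ 0 := by
  set L : EuclideanSpace ℝ (Fin (n + 1)) →L[ℝ] ℝ := EuclideanSpace.proj (Fin.last n)
  have h : LinearMap.ker (L : EuclideanSpace ℝ (Fin (n + 1)) →ₗ[ℝ] ℝ) ≠ ⊤ := fun h => by
    have h1 : EuclideanSpace.single (Fin.last n) (1 : ℝ) ∈
        LinearMap.ker (L : EuclideanSpace ℝ (Fin (n + 1)) →ₗ[ℝ] ℝ) := h ▸ Submodule.mem_top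
    have h2 : (EuclideanSpace.single (Fin.last n) (1 : ℝ) : EuclideanSpace ℝ (Fin (n + 1)))
      (Fin.last n) = 0 := h1
    simp at h2
  have h0 := Measure.addHaar_submodule (volume : Measure (EuclideanSpace ℝ (Fin (n + 1)))) _ h
  rw [ae_iff]
  refine le_antisymm ((measure_mono fun x hx => ?_).trans h0.le) bot_le
  have hx' : x (Fin.last n) = 0 := not_not.1 hx
  exact hx'

lemma reflect_mem_halfSpace {x : EuclideanSpace ℝ (Fin (n + 1))} :
    reflect x ∈ halfSpace n ↔ x (Fin.last n) < 0 := by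
  change 0 < reflect x (Fin.last n) ↔ _
  rw [reflect_last, neg_pos]

lemma ae_of_ae_halfSpace {P : EuclideanSpace ℝ (Fin (n + 1)) → Prop}
    (h : ∀ᵐ x ∂volume.restrict (halfSpace n), P x) (hr : ∀ x, P x → P (reflect x)) :
    ∀ᵐ x, P x := by
  rw [ae_restrict_iff' measurableSet_halfSpace] at h
  filter_upwards [h, measurePreserving_reflect.quasiMeasurePreserving.ae h, ae_last_ne_zero n]
    with x h1 h2 h3
  rcases h3.lt_or_gt with h4 | h4
  · have := hr _ (h2 (reflect_mem_halfSpace.2 h4))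
    rwa [reflect_reflect] at this
  · exact h1 h4

lemma preimage_reflect_ball (y : EuclideanSpace ℝ (Fin (n + 1))) (r : ℝ) :
    reflect ⁻¹' Metric.ball (reflect y) r = Metric.ball y r := by
  ext x
  rw [Set.mem_preimage, Metric.mem_ball, Metric.mem_ball, dist_reflect]

lemma setLIntegral_comp_reflect (a : EuclideanSpace ℝ (Fin (n + 1)) → ℝ≥0∞)
    (S : Set (EuclideanSpace ℝ (Fin (n + 1)))) :
    ∫⁻ x in reflect ⁻¹' S, a (reflect x) = ∫⁻ x in S, a x :=
  measurePreserving_reflect.setLIntegral_comp_preimage_emb measurableEmbedding_reflect a S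

lemma ball_ae_le_union (y : EuclideanSpace ℝ (Fin (n + 1))) (r : ℝ) :
    Metric.ball y r ≤ᵐ[volume]
      (Metric.ball y r ∩ halfSpace n ∪ Metric.ball y r ∩ reflect ⁻¹' halfSpace n : Set _) := by
  filter_upwards [ae_last_ne_zero n] with x hx hxb
  rcases hx.lt_or_gt with h | h
  · exact Or.inr ⟨hxb, reflect_mem_halfSpace.2 h⟩
  · exact Or.inl ⟨hxb, h⟩

/-- The lower part of the ball is folded onto the upper half space; the boundary hyperplane is a
null set. -/
lemma setLIntegral_ball_le_add (a : EuclideanSpace ℝ (Fin (n + 1)) → ℝ≥0∞)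
    (y : EuclideanSpace ℝ (Fin (n + 1))) (r : ℝ) :
    ∫⁻ x in Metric.ball y r, a x ≤ (∫⁻ x in Metric.ball y r ∩ halfSpace n, a x) +
      ∫⁻ x in Metric.ball (reflect y) r ∩ halfSpace n, a (reflect x) := by
  refine (lintegral_mono_set' (ball_ae_le_union y r)).trans ((lintegral_union_le _ _ _).trans ?_)
  refine add_le_add le_rfl (le_of_eq ?_)
  rw [← setLIntegral_comp_reflect (fun x => a (reflect x)), Set.preimage_inter,
    preimage_reflect_ball]
  simp only [reflect_reflect]

lemma ball_reflect_inter_subset {y : EuclideanSpace ℝ (Fin (n + 1))} (hy : y ∈ halfSpace n)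
    (r : ℝ) : Metric.ball (reflect y) r ∩ halfSpace n ⊆ Metric.ball y r ∩ halfSpace n := by
  rintro x ⟨h1, h2⟩
  refine ⟨?_, h2⟩
  rw [Metric.mem_ball, dist_eq_norm] at *
  exact (norm_sub_le_norm_sub_reflect h2 hy).trans_lt h1

/-- For a centre in the half space the folded lower part of the ball lies in its upper part. Balls
of the half space and full balls are therefore interchangeable up to a factor `2`. -/
lemma setLIntegral_ball_le_two_mul {a : EuclideanSpace ℝ (Fin (n + 1)) → ℝ≥0∞}
    (ha : ∀ x, a (reflect x) = a x) {y : EuclideanSpace ℝ (Fin (n + 1))} (hy : y ∈ halfSpace n)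
    (r : ℝ) : ∫⁻ x in Metric.ball y r, a x ≤ 2 * ∫⁻ x in Metric.ball y r ∩ halfSpace n, a x := by
  refine (setLIntegral_ball_le_add a y r).trans ?_
  rw [two_mul]
  simp only [ha]
  exact add_le_add le_rfl (lintegral_mono_set (ball_reflect_inter_subset hy r))

lemma volume_ball_le_two_mul {y : EuclideanSpace ℝ (Fin (n + 1))} (hy : y ∈ halfSpace n) (r : ℝ) :
    volume (Metric.ball y r) ≤ 2 * volume (Metric.ball y r ∩ halfSpace n) := by
  simpa using setLIntegral_ball_le_two_mul (a := fun _ => 1) (fun _ => rfl) hy r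

lemma symExt_add (σ : ℝ) (f g : EuclideanSpace ℝ (Fin (n + 1)) → ℂ) :
    HalfSpaceBMO.symExt σ (f + g) = HalfSpaceBMO.symExt σ f + HalfSpaceBMO.symExt σ g := by
  ext x
  simp only [HalfSpaceBMO.symExt, zeroExt, Pi.add_apply]
  split_ifs <;> simp only [Complex.real_smul] <;> ring

lemma symExt_sub (σ : ℝ) (f g : EuclideanSpace ℝ (Fin (n + 1)) → ℂ) :
    HalfSpaceBMO.symExt σ (f - g) = HalfSpaceBMO.symExt σ f - HalfSpaceBMO.symExt σ g := by
  ext x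
  simp only [HalfSpaceBMO.symExt, zeroExt, Pi.sub_apply]
  split_ifs <;> simp only [Complex.real_smul] <;> ring

lemma symExt_congr_ae (hσ : σ * σ = 1) (h : f =ᵐ[volume.restrict (halfSpace n)] g) :
    HalfSpaceBMO.symExt σ f =ᵐ[volume] HalfSpaceBMO.symExt σ g := by
  refine ae_of_ae_halfSpace ?_ fun x hx => ?_
  · filter_upwards [h, ae_restrict_mem measurableSet_halfSpace] with x hx hxΩ
    rw [symExt_of_mem hxΩ, symExt_of_mem hxΩ, hx]
  · rw [symExt_reflect hσ, symExt_reflect hσ, hx]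

lemma symExt_ae_eq_of_reflect (hσ : σ * σ = 1) {H : EuclideanSpace ℝ (Fin (n + 1)) → ℂ}
    (hH : ∀ x, H (reflect x) = σ • H x) : HalfSpaceBMO.symExt σ H =ᵐ[volume] H := by
  refine ae_of_ae_halfSpace ?_ fun x hx => ?_
  · filter_upwards [ae_restrict_mem measurableSet_halfSpace] with x hx
    exact symExt_of_mem hx
  · rw [symExt_reflect hσ, hH, hx]

lemma ae_eq_of_symExt_ae_eq {H : EuclideanSpace ℝ (Fin (n + 1)) → ℂ}
    (h : HalfSpaceBMO.symExt σ f =ᵐ[volume] H) : f =ᵐ[volume.restrict (halfSpace n)] H := by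
  filter_upwards [ae_restrict_of_ae h, ae_restrict_mem measurableSet_halfSpace] with x hx hxΩ
  rw [← hx, symExt_of_mem hxΩ]

lemma HasOsc.comp_reflect {F : EuclideanSpace ℝ (Fin (n + 1)) → ℂ} {A : ℝ≥0∞} (h : HasOsc F A) :
    HasOsc (fun x => F (reflect x)) A := by
  intro x r hr
  obtain ⟨a, ha⟩ := h (reflect x) r hr
  refine ⟨a, ?_⟩
  rw [← preimage_reflect_ball, setLIntegral_comp_reflect (fun y => ‖F y - a‖ₑ),
    measurePreserving_reflect.measure_preimage_emb measurableEmbedding_reflect]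
  exact ha

end Symmetry

/-! ### The operator space as a sum of bounded mean oscillation and kernel -/

section Comparison

variable {n : ℕ} {σ : ℝ} {f g k : EuclideanSpace ℝ (Fin (n + 1)) → ℂ}
  {V : (EuclideanSpace ℝ (Fin (n + 1)) → ℂ) →
    (Fin (n + 1) → EuclideanSpace ℝ (Fin (n + 1)) → ℂ) → Prop}

/-- The semigroup attached to `V` is the heat flow of extensions with parity `σ`. -/
def IsReflectedFlow (σ : ℝ) (V : (EuclideanSpace ℝ (Fin (n + 1)) → ℂ) →
    (Fin (n + 1) → EuclideanSpace ℝ (Fin (n + 1)) → ℂ) → Prop) : Prop :=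
  ∀ f, Tempered (symExt σ f) → ∀ t, 0 < t →
    heatOp (halfSpace n) V t f =ᵐ[volume.restrict (halfSpace n)] flow t (symExt σ f)

/-- The extension and its flow have the same parity, so their equality on the half space propagates
to the whole space. -/
lemma memK_iff (hσ : σ * σ = 1) (hV : IsReflectedFlow σ V) :
    MemK (halfSpace n) V f ↔ MemM (halfSpace n) f ∧
      ∀ t, 0 < t → flow t (symExt σ f) =ᵐ[volume] symExt σ f := by
  refine and_congr_right fun hf => forall_congr' fun t => imp_congr_right fun ht => ?_
  have h1 := hV f (hf.tempered_symExt σ) t ht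
  constructor
  · intro h
    refine ae_of_ae_halfSpace ?_ fun x hx => ?_
    · filter_upwards [h1, h, ae_restrict_mem measurableSet_halfSpace] with x h2 h3 h4
      rw [← h2, h3, symExt_of_mem h4]
    · rw [flow_symExt_reflect hσ, symExt_reflect hσ, hx]
  · intro h
    exact h1.trans (ae_eq_of_symExt_ae_eq h.symm).symm

lemma enorm_symExt_sub_flow_reflect (hσ : σ * σ = 1) (t : ℝ)
    (f : EuclideanSpace ℝ (Fin (n + 1)) → ℂ) (x : EuclideanSpace ℝ (Fin (n + 1))) :
    ‖symExt σ f (reflect x) - flow t (symExt σ f) (reflect x)‖ₑ =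
      ‖symExt σ f x - flow t (symExt σ f) x‖ₑ := by
  rw [symExt_reflect hσ, flow_symExt_reflect hσ, ← smul_sub]
  rcases mul_self_eq_one_iff.1 hσ with h | h
  · rw [h, one_smul]
  · rw [h, neg_one_smul, enorm_neg]

lemma setLIntegral_sub_heatOp (hV : IsReflectedFlow σ V) (hf : MemM (halfSpace n) f) {t : ℝ}
    (ht : 0 < t) (B : Set (EuclideanSpace ℝ (Fin (n + 1)))) :
    ∫⁻ x in B ∩ halfSpace n, ‖f x - heatOp (halfSpace n) V t f x‖ₑ =
      ∫⁻ x in B ∩ halfSpace n, ‖symExt σ f x - flow t (symExt σ f) x‖ₑ := by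
  refine lintegral_congr_ae (ae_restrict_of_ae_restrict_of_subset Set.inter_subset_right ?_)
  filter_upwards [hV f (hf.tempered_symExt σ) t ht, ae_restrict_mem measurableSet_halfSpace]
    with x h1 h2
  rw [h1, symExt_of_mem h2]

lemma volume_ball_inter_ne_zero {y : EuclideanSpace ℝ (Fin (n + 1))} (hy : y ∈ halfSpace n) {r : ℝ}
    (hr : 0 < r) : volume (Metric.ball y r ∩ halfSpace n) ≠ 0 :=
  ((Metric.isOpen_ball.inter isOpen_halfSpace).measure_pos volume
    ⟨y, Metric.mem_ball_self hr, hy⟩).ne'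

lemma volume_ball_inter_ne_top (y : EuclideanSpace ℝ (Fin (n + 1))) (r : ℝ) :
    volume (Metric.ball y r ∩ halfSpace n) ≠ ⊤ :=
  ((measure_mono Set.inter_subset_left).trans_lt measure_ball_lt_top).ne

lemma bmoLNorm_le (hV : IsReflectedFlow σ V) (hf : MemM (halfSpace n) f) {N : ℝ≥0∞}
    (h : ∀ y r, 0 < r → ∫⁻ x in Metric.ball y r, ‖symExt σ f x - flow (r ^ 2) (symExt σ f) x‖ₑ ≤
      N * volume (Metric.ball y r)) : bmoLNorm (halfSpace n) V f ≤ 2 * N := by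
  refine iSup_le fun y => iSup_le fun hy => iSup_le fun r => iSup_le fun hr => ?_
  rw [setLIntegral_sub_heatOp hV hf (by positivity), mul_comm, ← div_eq_mul_inv]
  refine ENNReal.div_le_of_le_mul ?_
  calc _ ≤ ∫⁻ x in Metric.ball y r, ‖symExt σ f x - flow (r ^ 2) (symExt σ f) x‖ₑ :=
        lintegral_mono_set Set.inter_subset_left
    _ ≤ N * volume (Metric.ball y r) := h y r hr
    _ ≤ N * (2 * volume (Metric.ball y r ∩ halfSpace n)) := by
        gcongr; exact volume_ball_le_two_mul hy r
    _ = _ := by ring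

/-- Centres in the half space come from the definition and their mirror images from parity. Centres
on the boundary are not reached, hence the bound for almost every `y`. -/
lemma setLIntegral_ball_le_of_bmoLNorm_le (hσ : σ * σ = 1) (hV : IsReflectedFlow σ V)
    (hf : MemM (halfSpace n) f) {N : ℝ≥0∞} (h : bmoLNorm (halfSpace n) V f ≤ N) :
    ∀ᵐ y, ∀ r, 0 < r →
      ∫⁻ x in Metric.ball y r, ‖symExt σ f x - flow (r ^ 2) (symExt σ f) x‖ₑ ≤
        2 * N * volume (Metric.ball y r) := by
  refine ae_of_ae_halfSpace ?_ fun y hy r hr => ?_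
  · filter_upwards [ae_restrict_mem measurableSet_halfSpace] with y hy r hr
    have h1 : (volume (Metric.ball y r ∩ halfSpace n))⁻¹ *
        ∫⁻ x in Metric.ball y r ∩ halfSpace n, ‖f x - heatOp (halfSpace n) V (r ^ 2) f x‖ₑ ≤ N := by
      refine le_trans ?_ h
      unfold bmoLNorm
      refine le_iSup₂_of_le y hy ?_
      exact le_iSup₂ (f := fun (r : ℝ) (_ : 0 < r) => (volume (Metric.ball y r ∩ halfSpace n))⁻¹ *
        ∫⁻ x in Metric.ball y r ∩ halfSpace n, ‖f x - heatOp (halfSpace n) V (r ^ 2) f x‖ₑ) r hr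
    rw [setLIntegral_sub_heatOp hV hf (by positivity), mul_comm, ← div_eq_mul_inv,
      ENNReal.div_le_iff (volume_ball_inter_ne_zero hy hr) (volume_ball_inter_ne_top y r)] at h1
    calc _ ≤ _ := setLIntegral_ball_le_two_mul (enorm_symExt_sub_flow_reflect hσ (r ^ 2) f) hy r
      _ ≤ 2 * (N * volume (Metric.ball y r ∩ halfSpace n)) := by gcongr
      _ ≤ 2 * (N * volume (Metric.ball y r)) := by gcongr; exact Set.inter_subset_left
      _ = _ := by ring
  · have h1 := hy r hr
    rw [← setLIntegral_comp_reflect, preimage_reflect_ball] at *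
    rw [← measurePreserving_reflect.measure_preimage_emb measurableEmbedding_reflect,
      preimage_reflect_ball]
    simp only [enorm_symExt_sub_flow_reflect hσ]
    exact hy r hr

-- The caloric part of an extension with parity `σ` has parity `σ` itself, so it is almost
-- everywhere the extension of its restriction, which therefore belongs to the kernel space.
variable (n) in
lemma exists_caloric_part_symExt : ∃ C : ℝ≥0, ∀ (σ : ℝ)
    (V : (EuclideanSpace ℝ (Fin (n + 1)) → ℂ) →
      (Fin (n + 1) → EuclideanSpace ℝ (Fin (n + 1)) → ℂ) → Prop), σ * σ = 1 →
    IsReflectedFlow σ V → ∀ f, MemBMOL (halfSpace n) V f →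
      ∃ H, MemK (halfSpace n) V H ∧ symExt σ H =ᵐ[volume] H ∧
        HasOsc (symExt σ (f - H)) (C * bmoLNorm (halfSpace n) V f) := by
  obtain ⟨C, hC⟩ := exists_caloric_part (EuclideanSpace ℝ (Fin (n + 1)))
  refine ⟨C * 2, fun σ V hσ hV f hf => ?_⟩
  set N : ℝ≥0 := (bmoLNorm (halfSpace n) V f).toNNReal with hN
  have hNe : (N : ℝ≥0∞) = bmoLNorm (halfSpace n) V f := ENNReal.coe_toNNReal hf.2.ne
  have hT := hf.1.tempered_symExt σ
  obtain ⟨H, hHm, ⟨A, m, hHA⟩, hHflow, hHlim, hosc⟩ := hC (symExt σ f) (2 * N) hT (by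
    filter_upwards [setLIntegral_ball_le_of_bmoLNorm_le hσ hV hf.1 hNe.ge] with y hy r hr
    push_cast
    exact hy r hr)
  have hpar : ∀ x, H (reflect x) = σ • H x := by
    intro x
    refine tendsto_nhds_unique (hHlim (reflect x)) (((hHlim x).const_smul σ).congr fun j => ?_)
    -- The origin is fixed by the reflection, so the value subtracted in the normalisation is
    -- compatible with the parity.
    have h0 := flow_symExt_reflect hσ ((j : ℝ) + 1) f 0
    rw [reflect_zero] at h0
    rw [flow_symExt_reflect hσ, smul_sub, ← h0]
  have hsym := symExt_ae_eq_of_reflect hσ hpar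
  have hHM : MemM (halfSpace n) H := memM_of_norm_le hHm.aestronglyMeasurable hHA
  refine ⟨H, (memK_iff hσ hV).2 ⟨hHM, fun t ht => ?_⟩, hsym, ?_⟩
  · rw [flow_congr_ae hsym, hHflow t ht]
    exact hsym.symm
  · have e : ((C * (2 * N) : ℝ≥0) : ℝ≥0∞) = (C * 2 : ℝ≥0) * bmoLNorm (halfSpace n) V f := by
      rw [← hNe]; push_cast; ring
    rw [← e]
    refine hosc.congr_ae ?_
    rw [symExt_sub]
    filter_upwards [hsym] with x hx
    simp only [Pi.sub_apply, hx]

lemma MemBMO.exists_ae_eq_const (hσ : σ * σ = 1) (hV : IsReflectedFlow σ V)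
    (hg : MemBMO (symExt σ g)) (hk : MemK (halfSpace n) V g) :
    ∃ c : ℂ, symExt σ g =ᵐ[volume] fun _ => c := by
  obtain ⟨A, hA⟩ := hg.exists_hasOsc
  exact hA.exists_ae_eq_const hg.1.aestronglyMeasurable ((memK_iff hσ hV).1 hk).2

lemma MemBMO.memM (hg : MemBMO (symExt σ g)) : MemM (halfSpace n) g := by
  obtain ⟨A, hA⟩ := hg.exists_hasOsc
  exact (hA.memM hg.1.aestronglyMeasurable).congr_ae (ae_eq_of_symExt_ae_eq EventuallyEq.rfl).symm

lemma HasOsc.add {E : Type*} [NormedAddCommGroup E] [InnerProductSpace ℝ E]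
    [MeasurableSpace E] [BorelSpace E] [FiniteDimensional ℝ E] {F G : E → ℂ} {A B : ℝ≥0∞}
    (hF : AEStronglyMeasurable F) (h : HasOsc F A) (h' : HasOsc G B) : HasOsc (F + G) (A + B) := by
  intro x r hr
  obtain ⟨a, ha⟩ := h x r hr
  obtain ⟨b, hb⟩ := h' x r hr
  refine ⟨a + b, ?_⟩
  rw [add_mul]
  refine le_trans ?_ (add_le_add ha hb)
  have hm : AEMeasurable (fun y => ‖F y - a‖ₑ) (volume.restrict (Metric.ball x r)) :=
    (hF.sub aestronglyMeasurable_const).enorm.restrict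
  rw [← lintegral_add_left' hm]
  refine lintegral_mono fun y => ?_
  rw [Pi.add_apply, add_sub_add_comm]
  exact enorm_add_le _ _

lemma HasOsc.neg {E : Type*} [NormedAddCommGroup E] [InnerProductSpace ℝ E]
    [MeasurableSpace E] [BorelSpace E] [FiniteDimensional ℝ E] {F : E → ℂ} {A : ℝ≥0∞}
    (h : HasOsc F A) : HasOsc (-F) A := by
  intro x r hr
  obtain ⟨a, ha⟩ := h x r hr
  refine ⟨-a, le_of_eq_of_le ?_ ha⟩
  congr 1; ext y
  rw [Pi.neg_apply, neg_sub_neg, ← enorm_neg, neg_sub]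

lemma HasOsc.add_const {E : Type*} [NormedAddCommGroup E] [InnerProductSpace ℝ E]
    [MeasurableSpace E] [BorelSpace E] [FiniteDimensional ℝ E] {F : E → ℂ} {A : ℝ≥0∞}
    (h : HasOsc F A) (c : ℂ) : HasOsc (fun x => F x + c) A := by
  intro x r hr
  obtain ⟨a, ha⟩ := h x r hr
  exact ⟨a + c, by simpa only [add_sub_add_right_eq_sub] using ha⟩

-- The caloric summand `k` cancels in `F - flow (r²) F`, so only the estimate for `symExt σ g` is
-- needed.
variable (n) in
lemma exists_bmoLNorm_le : ∃ C : ℝ≥0, ∀ (σ : ℝ)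
    (V : (EuclideanSpace ℝ (Fin (n + 1)) → ℂ) →
      (Fin (n + 1) → EuclideanSpace ℝ (Fin (n + 1)) → ℂ) → Prop), σ * σ = 1 →
    IsReflectedFlow σ V → ∀ f g k, MemBMO (symExt σ g) → MemK (halfSpace n) V k →
      f =ᵐ[volume.restrict (halfSpace n)] g + k →
        MemM (halfSpace n) f ∧ bmoLNorm (halfSpace n) V f ≤ C * bmoNorm (symExt σ g) := by
  obtain ⟨C₁, hC₁⟩ := exists_hasOsc_bmoNorm (n + 1)
  obtain ⟨C₂, hC₂⟩ := exists_lintegral_sub_flow_le (EuclideanSpace ℝ (Fin (n + 1)))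
  refine ⟨2 * (C₂ * C₁), fun σ V hσ hV f g k hg hk hfgk => ?_⟩
  have hgM := hg.memM
  obtain ⟨hkM, hkf⟩ := (memK_iff hσ hV).1 hk
  have hfM : MemM (halfSpace n) f := (hgM.add hkM).congr_ae hfgk.symm
  refine ⟨hfM, ?_⟩
  set N : ℝ≥0 := (bmoNorm (symExt σ g)).toNNReal with hN
  have hNe : (N : ℝ≥0∞) = bmoNorm (symExt σ g) := ENNReal.coe_toNNReal hg.2.ne
  have hosc : HasOsc (symExt σ g) ((C₁ * N : ℝ≥0) : ℝ≥0∞) := by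
    have := hC₁ (symExt σ g)
    rw [← hNe] at this
    exact_mod_cast this
  have hFe : symExt σ f =ᵐ[volume] symExt σ g + symExt σ k := by
    rw [← symExt_add]; exact symExt_congr_ae hσ hfgk
  have key := bmoLNorm_le (N := ((C₂ * (C₁ * N) : ℝ≥0) : ℝ≥0∞)) hV hfM fun y r hr => by
    refine le_of_eq_of_le (lintegral_congr_ae (ae_restrict_of_ae ?_))
      (hC₂ (symExt σ g) (C₁ * N) hg.1.aestronglyMeasurable hosc y r hr)
    rw [flow_congr_ae hFe, flow_add (hgM.tempered_symExt σ) (hkM.tempered_symExt σ) (by positivity)]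
    filter_upwards [hFe, hkf (r ^ 2) (by positivity)] with x h1 h2
    rw [h1, Pi.add_apply, Pi.add_apply, h2, add_sub_add_right_eq_sub]
  refine key.trans (le_of_eq ?_)
  rw [← hNe]; push_cast; ring

lemma memBMO_symExt_sub {H : EuclideanSpace ℝ (Fin (n + 1)) → ℂ}
    (hf : MemM (halfSpace n) f) (hH : MemM (halfSpace n) H) {A : ℝ≥0}
    (h : HasOsc (symExt σ (f - H)) A) : MemBMO (symExt σ (f - H)) := by
  refine h.memBMO ?_
  rw [symExt_sub]
  exact ((hf.tempered_symExt σ).sub (hH.tempered_symExt σ)).locallyIntegrable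

lemma memBMOL_iff (hσ : σ * σ = 1) (hV : IsReflectedFlow σ V) :
    MemBMOL (halfSpace n) V f ↔ ∃ g k, MemBMO (symExt σ g) ∧ MemK (halfSpace n) V k ∧
      f =ᵐ[volume.restrict (halfSpace n)] g + k := by
  constructor
  · intro hf
    obtain ⟨C, hC⟩ := exists_caloric_part_symExt n
    obtain ⟨H, hHK, -, hosc⟩ := hC σ V hσ hV f hf
    have hN : (((bmoLNorm (halfSpace n) V f).toNNReal : ℝ≥0) : ℝ≥0∞) =
      bmoLNorm (halfSpace n) V f := ENNReal.coe_toNNReal hf.2.ne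
    rw [← hN] at hosc
    refine ⟨f - H, H, memBMO_symExt_sub hf.1 hHK.1 (A := C * _) (by exact_mod_cast hosc), hHK, ?_⟩
    rw [sub_add_cancel]
  · rintro ⟨g, k, hg, hk, h⟩
    obtain ⟨C, hC⟩ := exists_bmoLNorm_le n
    obtain ⟨h1, h2⟩ := hC σ V hσ hV f g k hg hk h
    exact ⟨h1, h2.trans_lt (ENNReal.mul_lt_top ENNReal.coe_lt_top hg.2)⟩

-- The decomposition with caloric part `H` satisfies the bound, but `g` comes from another
-- decomposition. The difference `H - k` is both caloric and of bounded mean oscillation, hence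
-- constant, and constants do not affect oscillation.
variable (n) in
lemma exists_bmoNorm_symExt_le : ∃ C : ℝ≥0, ∀ (σ : ℝ)
    (V : (EuclideanSpace ℝ (Fin (n + 1)) → ℂ) →
      (Fin (n + 1) → EuclideanSpace ℝ (Fin (n + 1)) → ℂ) → Prop), σ * σ = 1 →
    IsReflectedFlow σ V → ∀ f g k, MemBMO (symExt σ g) → MemK (halfSpace n) V k →
      f =ᵐ[volume.restrict (halfSpace n)] g + k →
        bmoNorm (symExt σ g) ≤ C * bmoLNorm (halfSpace n) V f := by
  obtain ⟨C₁, hC₁⟩ := exists_caloric_part_symExt n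
  obtain ⟨C₂, hC₂⟩ := exists_bmoNorm_le (n + 1)
  refine ⟨C₂ * C₁, fun σ V hσ hV f g k hg hk hfgk => ?_⟩
  have hf : MemBMOL (halfSpace n) V f := (memBMOL_iff hσ hV).2 ⟨g, k, hg, hk, hfgk⟩
  obtain ⟨H, hHK, -, hosc⟩ := hC₁ σ V hσ hV f hf
  set N : ℝ≥0 := (bmoLNorm (halfSpace n) V f).toNNReal with hN
  have hNe : (N : ℝ≥0∞) = bmoLNorm (halfSpace n) V f := ENNReal.coe_toNNReal hf.2.ne
  rw [← hNe] at hosc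
  obtain ⟨hkM, hkf⟩ := (memK_iff hσ hV).1 hk
  obtain ⟨hHM, hHf⟩ := (memK_iff hσ hV).1 hHK
  obtain ⟨A, hA⟩ := hg.exists_hasOsc
  have hFe : symExt σ f =ᵐ[volume] symExt σ g + symExt σ k := by
    rw [← symExt_add]; exact symExt_congr_ae hσ hfgk
  have hTk := hkM.tempered_symExt σ
  have hTH := hHM.tempered_symExt σ
  have hdiff : symExt σ g + -symExt σ (f - H) =ᵐ[volume] symExt σ H - symExt σ k := by
    rw [symExt_sub]
    filter_upwards [hFe] with x hx
    simp only [Pi.add_apply, Pi.neg_apply, Pi.sub_apply, hx]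
    ring
  -- The bound `A` for `g` is not controlled by the norm of `f`. It is used only qualitatively, to
  -- apply the Liouville theorem, and does not enter the final constant.
  have hD : HasOsc (symExt σ H - symExt σ k) ((A + C₁ * N : ℝ≥0) : ℝ≥0∞) := by
    push_cast
    exact (hA.add hg.1.aestronglyMeasurable hosc.neg).congr_ae hdiff
  obtain ⟨c, hc⟩ := hD.exists_ae_eq_const
    (hTH.aestronglyMeasurable.sub hTk.aestronglyMeasurable) fun t ht => by
      rw [flow_sub hTH hTk ht]
      exact (hHf t ht).sub (hkf t ht)
  have hgo : HasOsc (symExt σ g) ((C₁ : ℝ≥0∞) * N) := by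
    refine (hosc.add_const c).congr_ae ?_
    filter_upwards [hdiff, hc] with x h1 h2
    rw [h2] at h1
    rw [← h1, Pi.add_apply, Pi.neg_apply]
    ring
  refine (hC₂ _ _ hg.1 hgo).trans (le_of_eq ?_)
  rw [← hNe]; push_cast; ring

end Comparison

/-! ### Comparison of the classical spaces on the half space -/

section Extensions

variable {n : ℕ} {f g : EuclideanSpace ℝ (Fin (n + 1)) → ℂ}

lemma abs_last_sub_lt {x y : EuclideanSpace ℝ (Fin (n + 1))} {r : ℝ} (hy : y ∈ Metric.ball x r) :
    |y (Fin.last n) - x (Fin.last n)| < r := by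
  have h1 := PiLp.norm_apply_le (y - x) (Fin.last n)
  rw [← dist_eq_norm, PiLp.sub_apply, Real.norm_eq_abs] at h1
  exact h1.trans_lt (Metric.mem_ball.1 hy)

/-- Oscillation only has to be tested on balls that avoid the boundary or are centred on it. -/
lemma hasOsc_of_cases {G : EuclideanSpace ℝ (Fin (n + 1)) → ℂ} {A : ℝ≥0∞}
    (h : ∀ x r, 0 < r → (r ≤ x (Fin.last n) ∨ x (Fin.last n) ≤ -r ∨ x (Fin.last n) = 0) →
      ∃ a : ℂ, ∫⁻ y in Metric.ball x r, ‖G y - a‖ₑ ≤ A * volume (Metric.ball x r)) :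
    HasOsc G (2 ^ (n + 1) * A) := by
  intro x r hr
  by_cases hx : r ≤ x (Fin.last n) ∨ x (Fin.last n) ≤ -r
  · obtain ⟨a, ha⟩ := h x r hr (hx.imp_right Or.inl)
    refine ⟨a, ha.trans ?_⟩
    gcongr
    exact le_mul_of_one_le_left' (one_le_pow₀ (by norm_num))
  -- A ball crossing the boundary lies in the ball of doubled radius centred at the projection `z`
  -- of its centre onto the boundary.
  · rw [not_or, not_le, not_le] at hx
    set e : EuclideanSpace ℝ (Fin (n + 1)) := EuclideanSpace.single (Fin.last n) 1 with he
    set z := x - x (Fin.last n) • e with hz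
    obtain ⟨a, ha⟩ := h z (2 * r) (by positivity) (Or.inr (Or.inr (by simp [hz, he])))
    refine ⟨a, (lintegral_mono_set ?_).trans (ha.trans (le_of_eq ?_))⟩
    · refine Metric.ball_subset_ball' ?_
      have : dist x z ≤ r := by
        rw [dist_eq_norm, hz, sub_sub_cancel, norm_smul, he, PiLp.norm_single, norm_one, mul_one,
          Real.norm_eq_abs]
        exact (abs_lt.2 ⟨by linarith, hx.1⟩).le
      linarith
    · have := volume_ball_mul z x (k := 2) two_pos hr
      rw [finrank_euclideanSpace_fin] at this
      push_cast at this
      rw [this]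
      ring

lemma HasOsc.symExt_neg_one (hf : AEStronglyMeasurable (zeroExt f)) {A : ℝ≥0∞}
    (h : HasOsc (zeroExt f) A) : HasOsc (symExt (-1) f) (2 * A) := by
  have e : symExt (-1) f = zeroExt f + -fun x => zeroExt f (reflect x) := by
    ext x; simp [symExt]
  rw [e, two_mul]
  exact h.add hf h.comp_reflect.neg

lemma zeroExt_of_last_nonpos {x : EuclideanSpace ℝ (Fin (n + 1))} (hx : x (Fin.last n) ≤ 0) :
    zeroExt f x = 0 := if_neg hx.not_gt

lemma enorm_le_enorm_sub_add_enorm_add (z a : ℂ) : ‖z‖ₑ ≤ ‖z - a‖ₑ + ‖z + a‖ₑ := by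
  have h : ‖z‖ ≤ ‖z - a‖ + ‖z + a‖ := by
    have h1 := norm_add_le (z - a) (z + a)
    rw [sub_add_add_cancel, ← two_mul, norm_mul] at h1
    have h2 : ‖(2 : ℂ)‖ = 2 := by simp
    rw [h2] at h1
    linarith [norm_nonneg z]
  have h' : ‖z‖₊ ≤ ‖z - a‖₊ + ‖z + a‖₊ := h
  simp only [enorm_eq_nnnorm]
  exact_mod_cast h'

/-- On a ball centred on the boundary, oddness makes `-a` as good a constant as `a`, so the mean of
the odd extension is bounded with constant zero. The same then holds for the zero extension, which
is dominated by it. -/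
lemma HasOsc.zeroExt_of_symExt (hf : AEStronglyMeasurable (symExt (-1) f)) {A : ℝ≥0∞}
    (h : HasOsc (symExt (-1) f) A) : HasOsc (zeroExt f) (2 ^ (n + 1) * (2 * A)) := by
  refine hasOsc_of_cases fun x r hr hx => ?_
  have hA : A * volume (Metric.ball x r) ≤ 2 * A * volume (Metric.ball x r) := by
    gcongr
    exact le_mul_of_one_le_left' (by norm_num)
  rcases hx with hx | hx | hx
  · obtain ⟨a, ha⟩ := h x r hr
    refine ⟨a, le_trans (le_of_eq (setLIntegral_congr_fun measurableSet_ball fun y hy => ?_))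
      (ha.trans hA)⟩
    have hy' : y ∈ halfSpace n := by
      have := abs_lt.1 (abs_last_sub_lt hy)
      change 0 < y (Fin.last n)
      linarith
    simp only [zeroExt_eq_indicator_symExt (-1), Set.indicator_of_mem hy']
  · refine ⟨0, le_trans (le_of_eq ?_) bot_le⟩
    rw [setLIntegral_congr_fun (g := fun _ => 0) measurableSet_ball fun y hy => ?_]
    · exact lintegral_zero
    · have := abs_lt.1 (abs_last_sub_lt hy)
      simp only [zeroExt_of_last_nonpos (f := f) (x := y) (by linarith), sub_zero, enorm_zero]
  · obtain ⟨a, ha⟩ := h x r hr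
    have hb : ∫⁻ y in Metric.ball x r, ‖symExt (-1) f y + a‖ₑ ≤ A * volume (Metric.ball x r) := by
      refine le_of_eq_of_le ?_ ha
      rw [← setLIntegral_comp_reflect]
      conv_lhs => rw [← reflect_eq_self hx]
      rw [preimage_reflect_ball]
      refine lintegral_congr fun y => ?_
      rw [symExt_reflect (by norm_num), neg_one_smul, neg_add_eq_sub, ← enorm_neg, neg_sub]
    refine ⟨0, ?_⟩
    have hm : AEMeasurable (fun y => ‖symExt (-1) f y - a‖ₑ) (volume.restrict (Metric.ball x r)) :=
      (hf.sub aestronglyMeasurable_const).enorm.restrict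
    calc ∫⁻ y in Metric.ball x r, ‖zeroExt f y - 0‖ₑ
        ≤ ∫⁻ y in Metric.ball x r, (‖symExt (-1) f y - a‖ₑ + ‖symExt (-1) f y + a‖ₑ) := by
          refine lintegral_mono fun y => ?_
          rw [sub_zero]
          refine le_trans ?_ (enorm_le_enorm_sub_add_enorm_add _ _)
          rw [zeroExt_eq_indicator_symExt (-1)]
          exact enorm_indicator_le_enorm_self _ _
      _ ≤ A * volume (Metric.ball x r) + A * volume (Metric.ball x r) := by
          rw [lintegral_add_left' hm]
          exact add_le_add ha hb
      _ = _ := by ring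

/-- On a ball centred on the boundary the even extension is two copies of the upper half, so the
constant of `F` works with a factor `2`. A ball in the lower half space is reflected into the upper
one. -/
lemma HasOsc.symExt_one_of_eqOn {F : EuclideanSpace ℝ (Fin (n + 1)) → ℂ}
    (hFf : Set.EqOn F f (halfSpace n)) {A : ℝ≥0∞} (h : HasOsc F A) :
    HasOsc (symExt 1 f) (2 ^ (n + 1) * (2 * A)) := by
  have hrefl : ∀ y, symExt 1 f (reflect y) = symExt 1 f y := fun y => by
    rw [symExt_reflect (one_mul 1), one_smul]
  refine hasOsc_of_cases fun x r hr hx => ?_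
  have hA : A * volume (Metric.ball x r) ≤ 2 * A * volume (Metric.ball x r) := by
    gcongr
    exact le_mul_of_one_le_left' (by norm_num)
  rcases hx with hx | hx | hx
  · obtain ⟨a, ha⟩ := h x r hr
    refine ⟨a, le_trans (le_of_eq (setLIntegral_congr_fun measurableSet_ball fun y hy => ?_))
      (ha.trans hA)⟩
    have hy' : y ∈ halfSpace n := by
      have := abs_lt.1 (abs_last_sub_lt hy)
      change 0 < y (Fin.last n)
      linarith
    simp only [symExt_of_mem hy', hFf hy']
  · obtain ⟨a, ha⟩ := h.comp_reflect x r hr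
    refine ⟨a, le_trans (le_of_eq (setLIntegral_congr_fun measurableSet_ball fun y hy => ?_))
      (ha.trans hA)⟩
    have hy' : reflect y ∈ halfSpace n := by
      have := abs_lt.1 (abs_last_sub_lt hy)
      rw [reflect_mem_halfSpace]
      linarith
    simp only [← hrefl y, symExt_of_mem hy', hFf hy']
  · obtain ⟨a, ha⟩ := h x r hr
    refine ⟨a, ?_⟩
    have e : ∫⁻ y in Metric.ball x r ∩ halfSpace n, ‖symExt 1 f y - a‖ₑ ≤
        A * volume (Metric.ball x r) := by
      refine le_trans (le_of_eq (setLIntegral_congr_fun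
        (measurableSet_ball.inter measurableSet_halfSpace) fun y hy => ?_))
        ((lintegral_mono_set Set.inter_subset_left).trans ha)
      simp only [symExt_of_mem hy.2, hFf hy.2]
    refine (setLIntegral_ball_le_add _ x r).trans ?_
    rw [reflect_eq_self hx]
    simp only [hrefl]
    exact (add_le_add e e).trans (le_of_eq (by ring))

lemma memBMOz_iff : MemBMOz f ↔ MemBMO (symExt (-1) f) := by
  constructor
  · intro h
    have h' : MemBMO (zeroExt f) := h
    obtain ⟨A, hA⟩ := h'.exists_hasOsc
    have hm := h'.1.aestronglyMeasurable
    refine HasOsc.memBMO (A := 2 * A) (Tempered.symExt (hA.tempered hm) (-1)).locallyIntegrable ?_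
    exact_mod_cast hA.symExt_neg_one hm
  · intro h
    obtain ⟨A, hA⟩ := h.exists_hasOsc
    refine HasOsc.memBMO (A := 2 ^ (n + 1) * (2 * A)) ?_ ?_
    · rw [zeroExt_eq_indicator_symExt (-1)]
      exact h.1.indicator measurableSet_halfSpace
    · exact_mod_cast hA.zeroExt_of_symExt h.1.aestronglyMeasurable

variable (n) in
lemma exists_bmoZNorm_le : ∃ C : ℝ≥0, ∀ f : EuclideanSpace ℝ (Fin (n + 1)) → ℂ, MemBMOz f →
    bmoZNorm f ≤ C * bmoNorm (symExt (-1) f) ∧ bmoNorm (symExt (-1) f) ≤ C * bmoZNorm f := by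
  obtain ⟨C₁, hC₁⟩ := exists_hasOsc_bmoNorm (n + 1)
  obtain ⟨C₂, hC₂⟩ := exists_bmoNorm_le (n + 1)
  refine ⟨C₂ * (2 ^ (n + 1) * (2 * C₁)), fun f hf => ?_⟩
  have hz : MemBMO (zeroExt f) := hf
  have ho := memBMOz_iff.1 hf
  constructor
  · refine (hC₂ _ _ hz.1 ((hC₁ _).zeroExt_of_symExt ho.1.aestronglyMeasurable)).trans (le_of_eq ?_)
    push_cast; ring
  · refine (hC₂ _ _ ho.1 ((hC₁ _).symExt_neg_one hz.1.aestronglyMeasurable)).trans ?_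
    calc (C₂ : ℝ≥0∞) * (2 * (C₁ * bmoNorm (zeroExt f)))
        ≤ C₂ * (2 ^ (n + 1) * (2 * (C₁ * bmoNorm (zeroExt f)))) := by
          exact mul_le_mul' le_rfl (le_mul_of_one_le_left' (one_le_pow₀ (by norm_num)))
      _ = _ := by rw [bmoZNorm]; push_cast; ring

lemma symExt_one_eqOn : Set.EqOn (symExt 1 f) f (halfSpace n) := fun _ hx => symExt_of_mem hx

lemma locallyIntegrable_symExt_of_eqOn {F : EuclideanSpace ℝ (Fin (n + 1)) → ℂ} (hF : MemBMO F)
    (hFf : Set.EqOn F f (halfSpace n)) (σ : ℝ) : LocallyIntegrable (symExt σ f) := by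
  obtain ⟨A, hA⟩ := hF.exists_hasOsc
  have hM : MemM (halfSpace n) f := (hA.memM hF.1.aestronglyMeasurable).congr_ae
    ((ae_restrict_mem measurableSet_halfSpace).mono hFf)
  exact (hM.tempered_symExt σ).locallyIntegrable

lemma memBMOr_iff : MemBMOr f ↔ MemBMO (symExt 1 f) := by
  refine ⟨fun ⟨F, hF, hFf⟩ => ?_, fun h => ⟨_, h, symExt_one_eqOn⟩⟩
  obtain ⟨A, hA⟩ := hF.exists_hasOsc
  refine HasOsc.memBMO (A := 2 ^ (n + 1) * (2 * A)) (locallyIntegrable_symExt_of_eqOn hF hFf 1) ?_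
  exact_mod_cast hA.symExt_one_of_eqOn hFf

lemma bmoRNorm_le (h : MemBMO (symExt 1 f)) : bmoRNorm f ≤ bmoNorm (symExt 1 f) :=
  iInf₂_le (f := fun (F : EuclideanSpace ℝ (Fin (n + 1)) → ℂ)
    (_ : MemBMO F ∧ Set.EqOn F f (halfSpace n)) => bmoNorm F) _ ⟨h, symExt_one_eqOn⟩

variable (n) in
lemma exists_bmoNorm_le_bmoRNorm : ∃ C : ℝ≥0, ∀ f : EuclideanSpace ℝ (Fin (n + 1)) → ℂ,
    bmoNorm (symExt 1 f) ≤ C * bmoRNorm f := by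
  obtain ⟨C₁, hC₁⟩ := exists_hasOsc_bmoNorm (n + 1)
  obtain ⟨C₂, hC₂⟩ := exists_bmoNorm_le (n + 1)
  -- Adding one keeps the constant nonzero, so that it can be moved inside the infimum even when `f`
  -- has no extension and the infimum is infinite.
  refine ⟨C₂ * (2 ^ (n + 1) * (2 * C₁)) + 1, fun f => ?_⟩
  have h0 : ((C₂ * (2 ^ (n + 1) * (2 * C₁)) + 1 : ℝ≥0) : ℝ≥0∞) ≠ 0 := by
    rw [ENNReal.coe_ne_zero]; positivity
  unfold bmoRNorm
  rw [ENNReal.mul_iInf_of_ne h0 ENNReal.coe_ne_top]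
  refine le_iInf fun F => ?_
  rw [ENNReal.mul_iInf_of_ne h0 ENNReal.coe_ne_top]
  refine le_iInf fun ⟨hF, hFf⟩ => ?_
  refine (hC₂ _ _ (locallyIntegrable_symExt_of_eqOn hF hFf 1)
    ((hC₁ F).symExt_one_of_eqOn hFf)).trans ?_
  calc (C₂ : ℝ≥0∞) * (2 ^ (n + 1) * (2 * (C₁ * bmoNorm F)))
      = ((C₂ * (2 ^ (n + 1) * (2 * C₁)) : ℝ≥0) : ℝ≥0∞) * bmoNorm F := by push_cast; ring
    _ ≤ _ := by
        gcongr
        exact le_self_add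

variable (n) in
lemma isReflectedFlow_dirichlet :
    IsReflectedFlow (-1) (W120 (halfSpace n)) := fun _ hf _ ht => heatOp_dirichlet_ae_eq hf ht

variable (n) in
lemma isReflectedFlow_neumann :
    IsReflectedFlow 1 (W12 (halfSpace n)) := fun _ hf _ ht => heatOp_neumann_ae_eq hf ht

/-- The odd extension is a constant by the Liouville theorem, and an odd constant is zero. -/
lemma MemBMOz.ae_eq_zero (hg : MemBMOz g) (hk : MemK (halfSpace n) (W120 (halfSpace n)) g) :
    g =ᵐ[volume.restrict (halfSpace n)] 0 := by
  obtain ⟨c, hc⟩ := (memBMOz_iff.1 hg).exists_ae_eq_const (by norm_num)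
    (isReflectedFlow_dirichlet n) hk
  obtain ⟨x, h1, h2⟩ := (hc.and (measurePreserving_reflect.quasiMeasurePreserving.ae hc)).exists
  rw [symExt_reflect (by norm_num), h1, neg_one_smul] at h2
  have h0 : c = 0 := self_eq_neg.1 h2.symm
  subst h0
  exact ae_eq_of_symExt_ae_eq hc

/-- The Liouville theorem gives one direction. For the other, the even extension of a constant is
almost everywhere constant, and the flow fixes constants because the kernel has mass one. -/
lemma memK_neumann_iff (hg : MemBMOr g) : MemK (halfSpace n) (W12 (halfSpace n)) g ↔
    ∃ c : ℂ, g =ᵐ[volume.restrict (halfSpace n)] fun _ => c := by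
  constructor
  · intro hk
    obtain ⟨c, hc⟩ := (memBMOr_iff.1 hg).exists_ae_eq_const (one_mul 1)
      (isReflectedFlow_neumann n) hk
    exact ⟨c, ae_eq_of_symExt_ae_eq hc⟩
  · rintro ⟨c, hc⟩
    have h1 : symExt 1 g =ᵐ[volume] fun _ => c := (symExt_congr_ae (one_mul 1) hc).trans
      (symExt_ae_eq_of_reflect (one_mul 1) fun _ => (one_smul ℝ c).symm)
    refine (memK_iff (one_mul 1) (isReflectedFlow_neumann n)).2 ⟨MemM.congr_ae
      (memM_of_norm_le (C := ‖c‖) (m := 0) aestronglyMeasurable_const (by simp)) hc.symm,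
      fun t ht => ?_⟩
    rw [flow_congr_ae h1, flow_const ht]
    exact h1.symm

end Extensions

end
end HalfSpaceBMO

/-! ### The theorem -/

theorem proposition3p2 (n : ℕ) :
    (∃ C : ℝ≥0,
      (∀ f : EuclideanSpace ℝ (Fin (n + 1)) → ℂ, MemBMOz f ↔ MemBMOo f) ∧
      (∀ f : EuclideanSpace ℝ (Fin (n + 1)) → ℂ, MemBMOz f →
        bmoZNorm f ≤ C * bmoONorm f ∧ bmoONorm f ≤ C * bmoZNorm f) ∧
      (∀ f : EuclideanSpace ℝ (Fin (n + 1)) → ℂ,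
        MemBMOL (halfSpace n) (W120 (halfSpace n)) f ↔
          ∃ g k : EuclideanSpace ℝ (Fin (n + 1)) → ℂ,
            MemBMOz g ∧ MemK (halfSpace n) (W120 (halfSpace n)) k ∧
              f =ᵐ[volume.restrict (halfSpace n)] g + k) ∧
      (∀ f g k : EuclideanSpace ℝ (Fin (n + 1)) → ℂ,
        MemBMOz g → MemK (halfSpace n) (W120 (halfSpace n)) k →
          f =ᵐ[volume.restrict (halfSpace n)] g + k →
            bmoLNorm (halfSpace n) (W120 (halfSpace n)) f ≤ C * bmoZNorm g ∧
              bmoZNorm g ≤ C * bmoLNorm (halfSpace n) (W120 (halfSpace n)) f) ∧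
      (∀ g : EuclideanSpace ℝ (Fin (n + 1)) → ℂ,
        MemBMOz g → MemK (halfSpace n) (W120 (halfSpace n)) g →
          g =ᵐ[volume.restrict (halfSpace n)] 0)) ∧
    (∃ C : ℝ≥0,
      (∀ f : EuclideanSpace ℝ (Fin (n + 1)) → ℂ, MemBMOr f ↔ MemBMOe f) ∧
      (∀ f : EuclideanSpace ℝ (Fin (n + 1)) → ℂ, MemBMOr f →
        bmoRNorm f ≤ C * bmoENorm f ∧ bmoENorm f ≤ C * bmoRNorm f) ∧
      (∀ f : EuclideanSpace ℝ (Fin (n + 1)) → ℂ,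
        MemBMOL (halfSpace n) (W12 (halfSpace n)) f ↔
          ∃ g k : EuclideanSpace ℝ (Fin (n + 1)) → ℂ,
            MemBMOr g ∧ MemK (halfSpace n) (W12 (halfSpace n)) k ∧
              f =ᵐ[volume.restrict (halfSpace n)] g + k) ∧
      (∀ f g k : EuclideanSpace ℝ (Fin (n + 1)) → ℂ,
        MemBMOr g → MemK (halfSpace n) (W12 (halfSpace n)) k →
          f =ᵐ[volume.restrict (halfSpace n)] g + k →
            bmoLNorm (halfSpace n) (W12 (halfSpace n)) f ≤ C * bmoRNorm g ∧
              bmoRNorm g ≤ C * bmoLNorm (halfSpace n) (W12 (halfSpace n)) f) ∧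
      (∀ g : EuclideanSpace ℝ (Fin (n + 1)) → ℂ,
        MemBMOr g →
          (MemK (halfSpace n) (W12 (halfSpace n)) g ↔
            ∃ c : ℂ, g =ᵐ[volume.restrict (halfSpace n)] fun _ => c))) := by
  constructor
  · obtain ⟨a, ha⟩ := exists_bmoZNorm_le n
    obtain ⟨b, hb⟩ := exists_bmoLNorm_le n
    obtain ⟨c, hc⟩ := exists_bmoNorm_symExt_le n
    have hσ : (-1 : ℝ) * -1 = 1 := by norm_num
    have hV := isReflectedFlow_dirichlet n
    -- One constant serves all the estimates: `a` compares zero and odd extensions, while `b * a`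
    -- and `a * c` arise by passing through the odd extension.
    have h1 : a ≤ a + b * a + a * c := le_add_right le_self_add
    have h2 : b * a ≤ a + b * a + a * c := le_add_right le_add_self
    have h3 : a * c ≤ a + b * a + a * c := le_add_self
    refine ⟨a + b * a + a * c, fun f => ?_, fun f hf => ?_, fun f => ?_,
      fun f g k hg hk hfgk => ⟨?_, ?_⟩, fun g hg hk => hg.ae_eq_zero hk⟩
    · rw [memBMOz_iff, symExt_neg_one, MemBMOo]
    · rw [bmoONorm, ← symExt_neg_one]
      exact ⟨(ha f hf).1.trans (by gcongr), (ha f hf).2.trans (by gcongr)⟩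
    · simp only [memBMOz_iff]
      exact memBMOL_iff hσ hV
    · calc _ ≤ b * bmoNorm (symExt (-1) g) :=
            (hb (-1) _ hσ hV f g k (memBMOz_iff.1 hg) hk hfgk).2
        _ ≤ b * (a * bmoZNorm g) := by gcongr; exact (ha g hg).2
        _ = (b * a : ℝ≥0) * bmoZNorm g := by push_cast; ring
        _ ≤ _ := by gcongr
    · calc _ ≤ a * bmoNorm (symExt (-1) g) := (ha g hg).1
        _ ≤ a * (c * bmoLNorm (halfSpace n) (W120 (halfSpace n)) f) := by
            gcongr; exact hc (-1) _ hσ hV f g k (memBMOz_iff.1 hg) hk hfgk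
        _ = (a * c : ℝ≥0) * bmoLNorm (halfSpace n) (W120 (halfSpace n)) f := by push_cast; ring
        _ ≤ _ := by gcongr
  · obtain ⟨a, ha⟩ := exists_bmoNorm_le_bmoRNorm n
    obtain ⟨b, hb⟩ := exists_bmoLNorm_le n
    obtain ⟨c, hc⟩ := exists_bmoNorm_symExt_le n
    have hσ : (1 : ℝ) * 1 = 1 := one_mul 1
    have hV := isReflectedFlow_neumann n
    have h0 : 1 ≤ 1 + a + b * a + c := le_add_right (le_add_right le_self_add)
    have h1 : a ≤ 1 + a + b * a + c := le_add_right (le_add_right le_add_self)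
    have h2 : b * a ≤ 1 + a + b * a + c := le_add_right le_add_self
    have h3 : c ≤ 1 + a + b * a + c := le_add_self
    refine ⟨1 + a + b * a + c, fun f => ?_, fun f hf => ?_, fun f => ?_,
      fun f g k hg hk hfgk => ⟨?_, ?_⟩, fun g hg => memK_neumann_iff hg⟩
    · rw [memBMOr_iff, symExt_one, MemBMOe]
    · rw [bmoENorm, ← symExt_one]
      refine ⟨(bmoRNorm_le (memBMOr_iff.1 hf)).trans ?_, (ha f).trans (by gcongr)⟩
      exact le_mul_of_one_le_left' (by exact_mod_cast h0)
    · simp only [memBMOr_iff]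
      exact memBMOL_iff hσ hV
    · calc _ ≤ b * bmoNorm (symExt 1 g) :=
            (hb 1 _ hσ hV f g k (memBMOr_iff.1 hg) hk hfgk).2
        _ ≤ b * (a * bmoRNorm g) := by gcongr; exact ha g
        _ = (b * a : ℝ≥0) * bmoRNorm g := by push_cast; ring
        _ ≤ _ := by gcongr
    · calc _ ≤ bmoNorm (symExt 1 g) := bmoRNorm_le (memBMOr_iff.1 hg)
        _ ≤ c * bmoLNorm (halfSpace n) (W12 (halfSpace n)) f :=
            hc 1 _ hσ hV f g k (memBMOr_iff.1 hg) hk hfgk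
        _ ≤ _ := by gcongr
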